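/- Let $T^2=S^1\times S^1$ and let $f:T^2\to S^1$ be a $C^\infty$ map all of whose critical points (points where $df=0$) are isolated. Let $\Gamma_f$ be the Kronrod--Reeb graph of $f$, i.e. the quotient space of $T^2$ by the partition into connected components of the level sets $f^{-1}(c)$, $c\in S^1$, and let $q_f:T^2\to\Gamma_f$ be the quotient map. Then $\Gamma_f$ is a finite graph (a Hausdorff space with the structure of a finite CW complex of dimension at most one), and the following hold. (1) For every base point $x\in T^2$, the homomorphism $\pi_1(T^2,x)\to\pi_1(\Gamma_f,q_f(x))$ induced by $q_f$ is surjective and has non-trivial kernel. Moreover the first Betti number satisfies $b_1(\Gamma_f)=\operatorname{rank}H_1(\Gamma_f;\mathbb Z)\le 1$, and $\Gamma_f$ either is a tree (a connected graph without cycles) or contains exactly one cycle, where a cycle is a subset homeomorphic to the circle. (2) If $f$ is not null-homotopic (i.e. not homotopic to a constant map), then $\Gamma_f$ is not a tree. -/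

import Mathlib

open Set Topology CategoryTheory
open scoped Manifold ContDiff

noncomputable section

/-- Two points are equivalent when they lie in the same leaf of `f`, that is, in the same connected
component of a level set of `f`. -/
def leafSetoid {X P : Type*} [TopologicalSpace X] (f : X → P) : Setoid X where
  r x y := y ∈ connectedComponentIn (f ⁻¹' {f x}) x
  iseqv := by
    have key : ∀ {x y : X}, y ∈ connectedComponentIn (f ⁻¹' {f x}) x →
        connectedComponentIn (f ⁻¹' {f y}) y = connectedComponentIn (f ⁻¹' {f x}) x := by
      intro x y h
      have hy : f y = f x := by simpa using connectedComponentIn_subset _ _ h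
      rw [hy]
      exact (connectedComponentIn_eq h).symm
    refine ⟨fun x => mem_connectedComponentIn rfl, fun {x y} h => ?_, fun {x y z} h h' => ?_⟩
    · rw [key h]
      exact mem_connectedComponentIn rfl
    · rwa [key h] at h'

/-- The Kronrod-Reeb graph `Γ_f`: the space of leaves of `f`, with the quotient topology. -/
def ReebGraph {X P : Type*} [TopologicalSpace X] (f : X → P) : Type _ :=
  Quotient (leafSetoid f)

instance {X P : Type*} [TopologicalSpace X] (f : X → P) : TopologicalSpace (ReebGraph f) :=
  inferInstanceAs (TopologicalSpace (Quotient (leafSetoid f)))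

/-- The quotient map `q_f : X → Γ_f`. -/
def reebQuotient {X P : Type*} [TopologicalSpace X] (f : X → P) : C(X, ReebGraph f) where
  toFun := Quotient.mk (leafSetoid f)
  continuous_toFun := continuous_quotient_mk'

/-- `X` carries the structure of a finite CW complex of dimension at most one. -/
def IsFiniteGraph (X : Type*) [TopologicalSpace X] : Prop :=
  T2Space X ∧ ∃ K : CWComplex (univ : Set X),
    (∀ n, Finite (K.cell n)) ∧ ∀ n, 2 ≤ n → IsEmpty (K.cell n)

/-- A cycle of a graph: a subset homeomorphic to the circle. (Loops and pairs of parallel edges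
are cycles too.) -/
def IsCycle {X : Type*} [TopologicalSpace X] (S : Set X) : Prop :=
  Nonempty (S ≃ₜ Circle)

/-- A tree: a connected graph without cycles. -/
def IsTreeSpace (X : Type*) [TopologicalSpace X] : Prop :=
  IsFiniteGraph X ∧ ConnectedSpace X ∧ ∀ S : Set X, ¬ IsCycle S

/-- The first Betti number: the rank of the first integral singular homology group. -/
def bettiOne (X : Type) [TopologicalSpace X] : Cardinal :=
  Module.rank ℤ (((AlgebraicTopology.singularHomologyFunctor (ModuleCat.{0} ℤ) 1).obj
    (ModuleCat.of ℤ ℤ)).obj (TopCat.of X))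

/-- The `2`-torus, with the product smooth structure. -/
abbrev Torus : Type := Circle × Circle

/-- `x` is a critical point (singularity) of the circle-valued map `f`. As the target is
one-dimensional, this means that the differential of `f` vanishes at `x`. -/
def IsCritical (f : Torus → Circle) (x : Torus) : Prop :=
  mfderiv ((𝓡 1).prod (𝓡 1)) (𝓡 1) f x = 0

/-- A smooth map all of whose critical points are isolated. -/
def HasIsolatedSingularities (f : Torus → Circle) : Prop :=
  ContMDiff ((𝓡 1).prod (𝓡 1)) (𝓡 1) ∞ f ∧
    ∀ x, IsCritical f x → ∀ᶠ y in 𝓝[≠] x, ¬ IsCritical f y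

end

/-!
The map `f` factors as `g ∘ q` with `q` the quotient map onto the space of leaves `Γ` and
`g = reebMap f : Γ → Circle`. Everything rests on two properties: the fibres of `q` are connected,
and `g` is light, that is, its fibres contain no nondegenerate connected sets.

*`Γ` is a finite graph.* By compactness the critical points form a finite set `C`. By the implicit
function theorem, a point outside `C` has arbitrarily small neighbourhoods which meet all nearby
levels in connected sets (`exists_finite_isLocallyFibered`), so `g` is a local homeomorphism off the
finite set `q '' C` (`isLocalHomeomorphOn_reebMap`). Cut the circle at the finitely many exceptional
values. Over each open arc `g` has sections, and lightness lets every section be extended to the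
closed arc; the extended sections are the edges of `Γ` (`exists_graphStructure`).

*`q` is surjective on fundamental groups.* `Γ` is covered by the open stars of the vertices and the
open edges, in which any two paths with the same endpoints are homotopic in `Γ`, and whose preimages
in the torus are open and connected. Paths in `Γ` can therefore be lifted piece by piece
(`FundamentalGroup.map_surjective_of_open_cover`).

*Any two points `z ≠ w` inside edges disconnect `Γ`*
(`GraphStructure.not_isPreconnected_compl_pair`). Each of them is marked by a map `Γ → Circle` which
goes once around the circle along the edge containing the point, is constant off this edge, and
takes the value `-1` only at the point (`GraphStructure.exists_marker`). If `z` and `w` did not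
disconnect `Γ`, the two maps would be independent in the integral cohomology of `Γ`, and so would
their composites with `q` in that of the torus, as the fibres of `q` are connected. The pair of
composites would then be a self-map of the torus of nonzero determinant on `ℤ ^ 2`, which is
surjective; but the two markers are never both equal to `-1`.

*Consequences.* Two edges outside a spanning tree would contain two points which do not disconnect.
So at most one edge lies outside it, and the fundamental group of `Γ` is cyclic
(`GraphStructure.isCyclic_fundamentalGroup`). Hence the first homology group is generated by the
class of one loop, and the Betti number is at most one (`bettiOne_le_one`). A cycle, if there is
one, is the closure of the set of non-separating points inside edges, hence unique
(`IsCycle.eq_closure`). As the fundamental group of the torus is not cyclic, the kernel of the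
homomorphism induced by `q` is not trivial. Finally, a graph without cycles is simply connected
(`GraphStructure.simplyConnectedSpace`); then `g` lifts to the real line and `f` is null-homotopic.
-/

set_option linter.unusedSectionVars false

/-! ### The space of leaves of a map on a compact Hausdorff space -/

section Leaves

open Filter

variable {X P : Type*} [TopologicalSpace X] [TopologicalSpace P]

/-- Different components of a compact fibre are separated by a splitting of a whole tube around
that fibre into two open parts. -/
theorem exists_open_separation_of_fiber [CompactSpace X] [T2Space X] [T2Space P] {f : X → P}
    (hf : Continuous f) {x y : X} (hxy : f y = f x)
    (hy : y ∉ connectedComponentIn (f ⁻¹' {f x}) x) :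
    ∃ W₁ W₂ : Set X, IsOpen W₁ ∧ IsOpen W₂ ∧ Disjoint W₁ W₂ ∧ x ∈ W₁ ∧ y ∈ W₂ ∧
      ∃ B : Set P, IsOpen B ∧ f x ∈ B ∧ f ⁻¹' B ⊆ W₁ ∪ W₂ := by
  set F := f ⁻¹' {f x} with hF
  have hFc : IsClosed F := isClosed_singleton.preimage hf
  have : CompactSpace F := isCompact_iff_compactSpace.1 hFc.isCompact
  have hxF : x ∈ F := rfl
  have hyF : y ∈ F := hxy
  rw [connectedComponentIn_eq_image hxF] at hy
  have hy' : (⟨y, hyF⟩ : F) ∉ connectedComponent (⟨x, hxF⟩ : F) := fun h => hy ⟨_, h, rfl⟩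
  rw [connectedComponent_eq_iInter_isClopen, mem_iInter] at hy'
  push Not at hy'
  obtain ⟨⟨Z, hZ, hxZ⟩, hyZ⟩ := hy'
  have hc1 : IsCompact ((↑) '' Z : Set X) := hZ.1.isCompact.image continuous_subtype_val
  have hc2 : IsCompact ((↑) '' Zᶜ : Set X) := hZ.compl.1.isCompact.image continuous_subtype_val
  have hd : Disjoint ((↑) '' Z : Set X) ((↑) '' Zᶜ) :=
    (disjoint_image_iff Subtype.val_injective).2 disjoint_compl_right
  obtain ⟨W₁, W₂, o1, o2, s1, s2, d⟩ := SeparatedNhds.of_isCompact_isCompact hc1 hc2 hd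
  refine ⟨W₁, W₂, o1, o2, d, s1 ⟨_, hxZ, rfl⟩, s2 ⟨_, hyZ, rfl⟩, (f '' (W₁ ∪ W₂)ᶜ)ᶜ,
    (hf.isClosedMap _ (o1.union o2).isClosed_compl).isOpen_compl, ?_, ?_⟩
  · rintro ⟨z, hz, hzx⟩
    by_cases h : (⟨z, hzx⟩ : F) ∈ Z
    · exact hz (Or.inl (s1 ⟨_, h, rfl⟩))
    · exact hz (Or.inr (s2 ⟨_, h, rfl⟩))
  · intro z hz
    by_contra h
    exact hz ⟨z, h, rfl⟩

/-- The map induced by `f` on the space of its leaves. -/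
def reebMap (f : X → P) : ReebGraph f → P :=
  Quotient.lift f fun x y h => by
    have := connectedComponentIn_subset _ _ (h : y ∈ connectedComponentIn (f ⁻¹' {f x}) x)
    exact (this : f y = f x).symm

variable {f : X → P}

theorem reebMap_reebQuotient (x : X) : reebMap f (reebQuotient f x) = f x := rfl

theorem continuous_reebMap (hf : Continuous f) : Continuous (reebMap f) :=
  hf.quotient_lift _

theorem isQuotientMap_reebQuotient : IsQuotientMap (reebQuotient f) :=
  isQuotientMap_quotient_mk'

theorem reebQuotient_surjective : Function.Surjective (reebQuotient f) :=
  isQuotientMap_reebQuotient.surjective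

theorem reebQuotient_eq_iff {x y : X} :
    reebQuotient f x = reebQuotient f y ↔ y ∈ connectedComponentIn (f ⁻¹' {f x}) x :=
  Quotient.eq (r := leafSetoid f)

theorem preimage_reebQuotient_singleton (x : X) :
    reebQuotient f ⁻¹' {reebQuotient f x} = connectedComponentIn (f ⁻¹' {f x}) x := by
  ext y
  rw [mem_preimage, mem_singleton_iff, eq_comm, reebQuotient_eq_iff]

theorem isConnected_preimage_reebQuotient_singleton (v : ReebGraph f) :
    IsConnected (reebQuotient f ⁻¹' {v}) := by
  obtain ⟨x, rfl⟩ := reebQuotient_surjective v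
  rw [preimage_reebQuotient_singleton, isConnected_connectedComponentIn_iff]
  rfl

/-- Points of the same level in a preconnected part of that level lie in one leaf. -/
theorem reebQuotient_eq_of_isPreconnected {S : Set X} (hS : IsPreconnected S) {c : P}
    (hc : S ⊆ f ⁻¹' {c}) {x y : X} (hx : x ∈ S) (hy : y ∈ S) :
    reebQuotient f x = reebQuotient f y := by
  rw [reebQuotient_eq_iff]
  have hfx : f x = c := hc hx
  rw [hfx]
  exact hS.subset_connectedComponentIn hx hc hy

instance [CompactSpace X] : CompactSpace (ReebGraph f) :=
  inferInstanceAs (CompactSpace (Quotient (leafSetoid f)))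

instance [ConnectedSpace X] : ConnectedSpace (ReebGraph f) :=
  reebQuotient_surjective.connectedSpace (reebQuotient f).continuous

instance [PathConnectedSpace X] : PathConnectedSpace (ReebGraph f) :=
  reebQuotient_surjective.pathConnectedSpace (reebQuotient f).continuous

instance [LocallyPathConnectedSpace X] : LocallyPathConnectedSpace (ReebGraph f) :=
  inferInstanceAs (LocallyPathConnectedSpace (Quotient (leafSetoid f)))

theorem t2Space_reebGraph [CompactSpace X] [T2Space X] [T2Space P] (hf : Continuous f) :
    T2Space (ReebGraph f) := by
  refine ⟨fun a b hab => ?_⟩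
  by_cases h : reebMap f a = reebMap f b
  · obtain ⟨x, rfl⟩ := reebQuotient_surjective a
    obtain ⟨y, rfl⟩ := reebQuotient_surjective b
    obtain ⟨W₁, W₂, o1, o2, d, hx, hy, B, oB, hB, hsub⟩ :=
      exists_open_separation_of_fiber hf (x := x) (y := y) h.symm
        (fun hm => hab (reebQuotient_eq_iff.2 hm))
    have key : ∀ (W W' : Set X), IsOpen W → IsOpen W' → Disjoint W W' → f ⁻¹' B ⊆ W ∪ W' →
        ∀ {u v : X}, u ∈ W → f u ∈ B → reebQuotient f u = reebQuotient f v →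
        v ∈ W ∧ f v ∈ B := by
      intro W W' o o' d hs u v hu huB huv
      have huv' := reebQuotient_eq_iff.1 huv
      have hlev := connectedComponentIn_subset (f ⁻¹' {f u}) u
      have hfu : f v = f u := hlev huv'
      refine ⟨?_, by rwa [hfu]⟩
      refine (isPreconnected_connectedComponentIn).subset_left_of_subset_union o o' d
        (fun z hz => hs ?_) ⟨u, mem_connectedComponentIn (F := f ⁻¹' {f u}) rfl, hu⟩ huv'
      have : f z = f u := hlev hz
      rwa [mem_preimage, this]
    -- a leaf over `B` lies in one of the two parts, so each part is a union of leaves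
    have hopen : ∀ (W W' : Set X), IsOpen W → IsOpen W' → Disjoint W W' → f ⁻¹' B ⊆ W ∪ W' →
        reebQuotient f ⁻¹' (reebQuotient f '' (W ∩ f ⁻¹' B)) = W ∩ f ⁻¹' B := by
      intro W W' o o' d hs
      refine Subset.antisymm ?_ (subset_preimage_image _ _)
      rintro v ⟨u, ⟨hu, huB⟩, huv⟩
      exact key W W' o o' d hs hu huB huv
    have e1 := hopen W₁ W₂ o1 o2 d hsub
    have e2 := hopen W₂ W₁ o2 o1 d.symm (by rwa [union_comm])
    refine ⟨reebQuotient f '' (W₁ ∩ f ⁻¹' B), reebQuotient f '' (W₂ ∩ f ⁻¹' B), ?_, ?_,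
      ⟨x, ⟨hx, hB⟩, rfl⟩, ⟨y, ⟨hy, ?_⟩, rfl⟩, ?_⟩
    · rw [← isQuotientMap_reebQuotient.isOpen_preimage, e1]
      exact o1.inter (oB.preimage hf)
    · rw [← isQuotientMap_reebQuotient.isOpen_preimage, e2]
      exact o2.inter (oB.preimage hf)
    · have : f y = f x := h.symm
      rwa [mem_preimage, this]
    · rw [← disjoint_preimage_iff reebQuotient_surjective, e1, e2]
      exact d.mono inter_subset_left inter_subset_left
  · obtain ⟨u, v, hu, hv, h1, h2, hd⟩ := t2_separation h
    exact ⟨_, _, hu.preimage (continuous_reebMap hf), hv.preimage (continuous_reebMap hf), h1, h2,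
      hd.preimage _⟩

variable [CompactSpace X] [T2Space X] [T2Space P]

theorem isClosedMap_reebQuotient (hf : Continuous f) : IsClosedMap (reebQuotient f) :=
  have := t2Space_reebGraph hf
  (reebQuotient f).continuous.isClosedMap

/-- The quotient map onto the space of leaves is monotone: preimages of preconnected sets are
preconnected. -/
theorem IsPreconnected.preimage_reebQuotient (hf : Continuous f) {S : Set (ReebGraph f)}
    (hS : IsPreconnected S) : IsPreconnected (reebQuotient f ⁻¹' S) := by
  have hcl := isClosedMap_reebQuotient hf
  rw [isPreconnected_closed_iff]
  intro A B hA hB hAB hSA hSB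
  have := isPreconnected_closed_iff.1 hS _ _ (hcl A hA) (hcl B hB) ?_ ?_ ?_
  · obtain ⟨v, hvS, ⟨a, ha, hav⟩, ⟨b, hb, hbv⟩⟩ := this
    have hfib := (isConnected_preimage_reebQuotient_singleton v).isPreconnected
    have hsub : reebQuotient f ⁻¹' {v} ⊆ reebQuotient f ⁻¹' S :=
      preimage_mono (singleton_subset_iff.2 hvS)
    obtain ⟨z, hz, hz'⟩ := isPreconnected_closed_iff.1 hfib A B hA hB (hsub.trans hAB)
      ⟨a, hav, ha⟩ ⟨b, hbv, hb⟩
    exact ⟨z, hsub hz, hz'⟩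
  · intro v hv
    obtain ⟨x, rfl⟩ := reebQuotient_surjective v
    exact (hAB hv).imp (fun h => ⟨x, h, rfl⟩) fun h => ⟨x, h, rfl⟩
  · obtain ⟨x, h1, h2⟩ := hSA
    exact ⟨_, h1, x, h2, rfl⟩
  · obtain ⟨x, h1, h2⟩ := hSB
    exact ⟨_, h1, x, h2, rfl⟩

/-- The induced map on the space of leaves is light: its fibres contain no nondegenerate connected
sets. -/
theorem subsingleton_of_reebMap_const (hf : Continuous f) {S : Set (ReebGraph f)}
    (hS : IsPreconnected S) {c : P} (hc : ∀ v ∈ S, reebMap f v = c) : S.Subsingleton := by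
  intro v hv w hw
  obtain ⟨x, rfl⟩ := reebQuotient_surjective v
  obtain ⟨y, rfl⟩ := reebQuotient_surjective w
  exact reebQuotient_eq_of_isPreconnected (hS.preimage_reebQuotient hf)
    (fun z hz => hc _ hz) hv hw

/-- `f` is locally fibered at `x` if `x` has arbitrarily small neighbourhoods which meet all levels
near that of `x` in connected sets. -/
def IsLocallyFibered (f : X → P) (x : X) : Prop :=
  ∀ U ∈ 𝓝 x, ∃ B : Set X, IsOpen B ∧ x ∈ B ∧ B ⊆ U ∧
    ∀ᶠ t in 𝓝 (f x), IsConnected (B ∩ f ⁻¹' {t})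

theorem IsLocallyFibered.eventually_nonempty {x : X} (h : IsLocallyFibered f x) {U : Set X}
    (hU : U ∈ 𝓝 x) : ∀ᶠ t in 𝓝 (f x), (U ∩ f ⁻¹' {t}).Nonempty := by
  obtain ⟨B, -, -, hB, ht⟩ := h U hU
  filter_upwards [ht] with t ht
  exact ht.nonempty.mono (inter_subset_inter_left _ hB)

/-- The induced map is open at a leaf containing a locally fibered point. -/
theorem nhds_le_map_reebMap {x : X} (h : IsLocallyFibered f x) :
    𝓝 (f x) ≤ map (reebMap f) (𝓝 (reebQuotient f x)) := by
  intro O hO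
  rw [mem_map] at hO
  filter_upwards [h.eventually_nonempty ((reebQuotient f).continuous.continuousAt hO)]
  rintro t ⟨z, hz, rfl⟩
  exact hz

/-- A connected compact part `K` of a level consisting of locally fibered points has a
neighbourhood which meets all nearby levels in preconnected sets: the neighbourhoods of two nearby
points of `K` meet each of these levels, and they do so in a common point. -/
theorem exists_open_isPreconnected_levels {K : Set X} {c : P}
    (hK : IsCompact K) (hKc : IsPreconnected K) (hKn : K.Nonempty) (hlev : ∀ x ∈ K, f x = c)
    (hreg : ∀ x ∈ K, IsLocallyFibered f x) :
    ∃ B : Set X, IsOpen B ∧ K ⊆ B ∧ ∀ᶠ t in 𝓝 c, IsPreconnected (B ∩ f ⁻¹' {t}) := by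
  -- an equivalence relation on `K` with open classes, hence the full relation
  let R : X → X → Prop := fun a b =>
    ∃ B : Set X, IsOpen B ∧ a ∈ B ∧ b ∈ B ∧ ∀ᶠ t in 𝓝 c, IsPreconnected (B ∩ f ⁻¹' {t})
  have hR : ∀ {a b : X}, a ∈ K → b ∈ K → R a b := by
    intro a b ha hb
    refine hKc.induction₂ R ?_ ?_ ?_ ha hb
    · intro x hx
      obtain ⟨B, oB, hxB, -, ht⟩ := hreg x hx univ Filter.univ_mem
      rw [hlev x hx] at ht
      filter_upwards [mem_nhdsWithin_of_mem_nhds (oB.mem_nhds hxB)] with y hy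
      exact ⟨B, oB, hxB, hy, ht.mono fun t h => h.isPreconnected⟩
    · rintro x y z hx hy hz ⟨B, oB, hxB, hyB, hB⟩ ⟨B', oB', hyB', hzB', hB'⟩
      refine ⟨B ∪ B', oB.union oB', Or.inl hxB, Or.inr hzB', ?_⟩
      have hne := (hreg y hy).eventually_nonempty ((oB.inter oB').mem_nhds ⟨hyB, hyB'⟩)
      rw [hlev y hy] at hne
      filter_upwards [hB, hB', hne] with t h h' ⟨p, ⟨hp, hp'⟩, hpt⟩
      rw [union_inter_distrib_right]
      exact h.union p ⟨hp, hpt⟩ ⟨hp', hpt⟩ h'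
    · rintro x y hx hy ⟨B, oB, hxB, hyB, hB⟩
      exact ⟨B, oB, hyB, hxB, hB⟩
  obtain ⟨a, ha⟩ := hKn
  choose! B oB haB hbB hB using fun (b : X) (hb : b ∈ K) => hR ha hb
  obtain ⟨s, hs, hsK⟩ := hK.elim_nhds_subcover B fun b hb => (oB b hb).mem_nhds (hbB b hb)
  refine ⟨⋃ b ∈ s, B b, isOpen_biUnion fun b hb => oB b (hs b hb), hsK, ?_⟩
  have h1 : ∀ᶠ t in 𝓝 c, ∀ b ∈ s, IsPreconnected (B b ∩ f ⁻¹' {t}) :=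
    (s.eventually_all).2 fun b hb => hB b (hs b hb)
  have h2 := (hreg a ha).eventually_nonempty (U := ⋂ b ∈ s, B b)
    ((Filter.biInter_finset_mem s).2 fun b hb => (oB b (hs b hb)).mem_nhds (haB b (hs b hb)))
  rw [hlev a ha] at h2
  filter_upwards [h1, h2] with t h1 ⟨p, hp, hpt⟩
  rw [iUnion₂_inter]
  rw [mem_iInter₂] at hp
  have : (⋃ b ∈ s, B b ∩ f ⁻¹' {t}) = ⋃₀ ((fun b => B b ∩ f ⁻¹' {t}) '' (s : Set X)) := by
    rw [sUnion_image]; rfl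
  rw [this]
  refine isPreconnected_sUnion p _ ?_ ?_
  · rintro _ ⟨b, hb, rfl⟩
    exact ⟨hp b hb, hpt⟩
  · rintro _ ⟨b, hb, rfl⟩
    exact h1 b hb

/-- The induced map is locally injective at a leaf all of whose points are locally fibered. -/
theorem exists_injOn_reebMap (hf : Continuous f) {v : ReebGraph f}
    (hreg : ∀ x, reebQuotient f x = v → IsLocallyFibered f x) :
    ∃ O : Set (ReebGraph f), IsOpen O ∧ v ∈ O ∧ InjOn (reebMap f) O := by
  have := t2Space_reebGraph hf
  have hK := isConnected_preimage_reebQuotient_singleton v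
  obtain ⟨B, oB, hKB, ht⟩ := exists_open_isPreconnected_levels (c := reebMap f v)
    (isClosed_singleton.preimage (reebQuotient f).continuous).isCompact hK.isPreconnected
    hK.nonempty (fun x hx => by rw [← (hx : reebQuotient f x = v)]; rfl) (fun x hx => hreg x hx)
  obtain ⟨N, hN, oN, hvN⟩ := mem_nhds_iff.1 ht
  have oBN : IsOpen (B ∩ f ⁻¹' N) := oB.inter (oN.preimage hf)
  refine ⟨(reebQuotient f '' (B ∩ f ⁻¹' N)ᶜ)ᶜ,
    (isClosedMap_reebQuotient hf _ oBN.isClosed_compl).isOpen_compl, ?_, ?_⟩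
  · rintro ⟨x, hx, hxv⟩
    refine hx ⟨hKB hxv, ?_⟩
    rw [mem_preimage, ← reebMap_reebQuotient (f := f) x, hxv]
    exact hvN
  · intro y hy z hz hyz
    obtain ⟨x, rfl⟩ := reebQuotient_surjective y
    obtain ⟨x', rfl⟩ := reebQuotient_surjective z
    have hmem : ∀ u, reebQuotient f u ∈ (reebQuotient f '' (B ∩ f ⁻¹' N)ᶜ)ᶜ → u ∈ B ∩ f ⁻¹' N := by
      intro u hu
      by_contra h
      exact hu ⟨u, h, rfl⟩
    have hx := hmem _ hy
    have hx' := hmem _ hz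
    exact reebQuotient_eq_of_isPreconnected (hN hx.2) (c := f x) (fun u hu => hu.2)
      ⟨hx.1, rfl⟩ ⟨hx'.1, hyz.symm⟩

/-- Away from the leaves meeting a closed set `C` off which `f` is locally fibered, the induced map
is a local homeomorphism. -/
theorem isLocalHomeomorphOn_reebMap (hf : Continuous f) {C : Set X} (hC : IsClosed C)
    (hreg : ∀ x, x ∉ C → IsLocallyFibered f x) :
    IsLocalHomeomorphOn (reebMap f) (reebQuotient f '' C)ᶜ := by
  refine IsLocalHomeomorphOn.mk _ _ fun v hv => ?_
  have hreg' : ∀ v ∉ reebQuotient f '' C, ∀ x, reebQuotient f x = v → IsLocallyFibered f x :=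
    fun v hv x hx => hreg x fun hxC => hv ⟨x, hxC, hx⟩
  obtain ⟨O, oO, hvO, hinj⟩ := exists_injOn_reebMap hf (hreg' v hv)
  have : Nonempty (ReebGraph f) := ⟨v⟩
  have oC : IsOpen (reebQuotient f '' C)ᶜ := (isClosedMap_reebQuotient hf C hC).isOpen_compl
  have hinj' : InjOn (reebMap f) (O ∩ (reebQuotient f '' C)ᶜ) := hinj.mono inter_subset_left
  let e := hinj'.toPartialEquiv
  have he : e.source = O ∩ (reebQuotient f '' C)ᶜ := rfl
  have hopen : IsOpenMap (e.source.domRestrict e) := by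
    rw [isOpenMap_iff_nhds_le]
    rintro ⟨w, hw⟩
    obtain ⟨x, rfl⟩ := reebQuotient_surjective w
    refine (nhds_le_map_reebMap (hreg' _ hw.2 x rfl)).trans ?_
    have := map_nhds_subtype_coe_eq_nhds hw ((oO.inter oC).mem_nhds hw)
    rw [← this, Filter.map_map]
    exact le_rfl
  refine ⟨OpenPartialHomeomorph.ofContinuousOpenRestrict e
    (continuous_reebMap hf).continuousOn hopen (oO.inter oC), ⟨hvO, hv⟩, fun _ _ => rfl⟩

end Leaves

/-! ### Finite topological graphs -/

/-- A decomposition of a space into finitely many vertices and finitely many open arcs, each given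
with a parametrization by the unit interval whose endpoints are vertices. Loops and parallel edges
are allowed. -/
structure GraphStructure.{u} (Y : Type u) [TopologicalSpace Y] where
  /-- the vertices -/
  V : Set Y
  finite_V : V.Finite
  /-- the edges -/
  E : Type u
  finite_E : Finite E
  /-- the parametrization of an edge -/
  edge : E → C(unitInterval, Y)
  edge_zero : ∀ e, edge e 0 ∈ V
  edge_one : ∀ e, edge e 1 ∈ V
  edge_notMem : ∀ e, ∀ t ∈ Ioo (0 : unitInterval) 1, edge e t ∉ V
  edge_inj : ∀ e, ∀ t ∈ Ioo (0 : unitInterval) 1, ∀ e', ∀ t' ∈ Ioo (0 : unitInterval) 1,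
    edge e t = edge e' t' → e = e' ∧ t = t'
  exhaust : ∀ y ∉ V, ∃ e, ∃ t ∈ Ioo (0 : unitInterval) 1, edge e t = y

section LightMaps

open Filter

universe u

variable {Y : Type u} [TopologicalSpace Y] [CompactSpace Y] [T2Space Y]

/-- A map lying over a convergent map converges if the projection is light. -/
theorem exists_tendsto_of_light {P A : Type*} [TopologicalSpace P] [T2Space P] {g : Y → P}
    (hg : Continuous g)
    (light : ∀ S : Set Y, IsPreconnected S → ∀ c, (∀ v ∈ S, g v = c) → S.Subsingleton)
    {l : Filter A} [l.NeBot] {σ : A → Y}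
    (hl : ∀ s ∈ l, ∃ s' ⊆ s, s' ∈ l ∧ IsPreconnected (σ '' s')) {c : P}
    (hc : Tendsto (g ∘ σ) l (𝓝 c)) : ∃ y, Tendsto σ l (𝓝 y) ∧ g y = c := by
  have hgc : ∀ z, ClusterPt z (map σ l) → g z = c := by
    intro z hz
    have h := hz.map (f := g) hg.continuousAt tendsto_map
    rw [Filter.map_map] at h
    have : ClusterPt (g z) (𝓝 c) := h.mono hc
    exact eq_of_nhds_neBot this
  obtain ⟨y, hy⟩ := exists_clusterPt_of_compactSpace (map σ l)
  refine ⟨y, le_nhds_of_unique_clusterPt fun z hz => ?_, hgc y hy⟩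
  by_contra hne
  have hzy : z ∉ connectedComponentIn (g ⁻¹' {g y}) y := fun hz' =>
    hne ((light _ isPreconnected_connectedComponentIn (g y)
      (fun v hv => connectedComponentIn_subset (g ⁻¹' {g y}) y hv)) hz'
      (mem_connectedComponentIn (F := g ⁻¹' {g y}) rfl))
  obtain ⟨W₁, W₂, o1, o2, d, h1, h2, B, oB, hB, hsub⟩ :=
    exists_open_separation_of_fiber hg ((hgc z hz).trans (hgc y hy).symm) hzy
  rw [hgc y hy] at hB
  obtain ⟨s', hs', hs'l, hpre⟩ := hl _ (hc (oB.mem_nhds hB))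
  have hsub' : σ '' s' ⊆ W₁ ∪ W₂ := by
    rintro _ ⟨t, ht, rfl⟩
    exact hsub (hs' ht)
  have hmem : σ '' s' ∈ map σ l := image_mem_map hs'l
  obtain ⟨p, hp, hp'⟩ := clusterPt_iff_nonempty.1 hy (o1.mem_nhds h1) hmem
  obtain ⟨r, hr, hr'⟩ := clusterPt_iff_nonempty.1 hz (o2.mem_nhds h2) hmem
  have := hpre.subset_left_of_subset_union o1 o2 d hsub' ⟨p, hp', hp⟩ hr'
  exact disjoint_left.1 d this hr

variable {g : Y → Circle} {V₀ : Set Y}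

/-- Over an open arc free of exceptional values there is a unique section through a given point. -/
theorem existsUnique_section (hg : Continuous g) (hloc : IsLocalHomeomorphOn g V₀ᶜ) {a b m : ℝ}
    (hm : m ∈ Ioo a b) (hab : ∀ t ∈ Ioo a b, Circle.exp t ∉ g '' V₀) {y : Y}
    (hy : g y = Circle.exp m) :
    ∃! F : C(Ioo a b, Y), F ⟨m, hm⟩ = y ∧ g ∘ F = fun t : Ioo a b => Circle.exp t := by
  have hcov : IsCoveringMapOn g (g '' V₀)ᶜ :=
    IsCoveringMapOn.of_isLocalHomeomorphOn hg (hloc.mono fun v hv hv' => hv ⟨v, hv', rfl⟩)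
  have : ContractibleSpace (Ioo a b) := (convex_Ioo a b).contractibleSpace ⟨m, hm⟩
  have : LocallyPathConnectedSpace (Ioo a b) := (convex_Ioo a b).locallyPathConnectedSpace
  exact hcov.existsUnique_continuousMap_lifts
    (f := (⟨fun t : Ioo a b => Circle.exp t, by fun_prop⟩ : C(Ioo a b, Circle)))
    (a₀ := ⟨m, hm⟩) hy (fun t => hab t t.2)

/-- Sections over an open arc extend continuously to its ends. -/
theorem exists_section_Icc (hg : Continuous g)
    (light : ∀ S : Set Y, IsPreconnected S → ∀ c, (∀ v ∈ S, g v = c) → S.Subsingleton)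
    (hloc : IsLocalHomeomorphOn g V₀ᶜ) {a b m : ℝ}
    (hm : m ∈ Ioo a b) (hab : ∀ t ∈ Ioo a b, Circle.exp t ∉ g '' V₀) {y : Y}
    (hy : g y = Circle.exp m) :
    ∃ σ : ℝ → Y, ContinuousOn σ (Icc a b) ∧ (∀ t ∈ Icc a b, g (σ t) = Circle.exp t) ∧ σ m = y := by
  obtain ⟨F, ⟨hF, hFg⟩, -⟩ := existsUnique_section hg hloc hm hab hy
  have hlt : a < b := hm.1.trans hm.2
  classical
  let τ : ℝ → Y := fun t => if h : t ∈ Ioo a b then F ⟨t, h⟩ else y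
  have hτ : ∀ t (h : t ∈ Ioo a b), τ t = F ⟨t, h⟩ := fun t h => dif_pos h
  have hτc : ContinuousOn τ (Ioo a b) := by
    rw [continuousOn_iff_continuous_domRestrict]
    have : (Ioo a b).domRestrict τ = F := by
      ext t; exact hτ t t.2
    rw [this]; exact F.continuous
  have hτg : ∀ t ∈ Ioo a b, g (τ t) = Circle.exp t := by
    intro t ht
    rw [hτ t ht]
    exact congrFun hFg ⟨t, ht⟩
  obtain ⟨p, hp, hpg⟩ : ∃ p, Tendsto τ (𝓝[>] a) (𝓝 p) ∧ g p = Circle.exp a := by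
    refine exists_tendsto_of_light hg light (fun s hs => ?_) ?_
    · obtain ⟨u, hu, hus⟩ := mem_nhdsGT_iff_exists_Ioo_subset.1 hs
      refine ⟨Ioo a (min u b), fun t ht => hus ⟨ht.1, ht.2.trans_le (min_le_left _ _)⟩,
        Ioo_mem_nhdsGT (lt_min hu hlt), isPreconnected_Ioo.image _ (hτc.mono ?_)⟩
      exact Ioo_subset_Ioo_right (min_le_right _ _)
    · have : Tendsto (fun t => Circle.exp t) (𝓝[>] a) (𝓝 (Circle.exp a)) :=
        (Circle.exp.continuous.tendsto a).mono_left nhdsWithin_le_nhds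
      refine this.congr' ?_
      filter_upwards [Ioo_mem_nhdsGT hlt] with t ht
      exact (hτg t ht).symm
  obtain ⟨q, hq, hqg⟩ : ∃ q, Tendsto τ (𝓝[<] b) (𝓝 q) ∧ g q = Circle.exp b := by
    refine exists_tendsto_of_light hg light (fun s hs => ?_) ?_
    · obtain ⟨u, hu, hus⟩ := mem_nhdsLT_iff_exists_Ioo_subset.1 hs
      refine ⟨Ioo (max u a) b, fun t ht => hus ⟨(le_max_left _ _).trans_lt ht.1, ht.2⟩,
        Ioo_mem_nhdsLT (max_lt hu hlt), isPreconnected_Ioo.image _ (hτc.mono ?_)⟩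
      exact Ioo_subset_Ioo_left (le_max_right _ _)
    · have : Tendsto (fun t => Circle.exp t) (𝓝[<] b) (𝓝 (Circle.exp b)) :=
        (Circle.exp.continuous.tendsto b).mono_left nhdsWithin_le_nhds
      refine this.congr' ?_
      filter_upwards [Ioo_mem_nhdsLT hlt] with t ht
      exact (hτg t ht).symm
  have hext : ∀ t ∈ Ioo a b, extendFrom (Ioo a b) τ t = τ t := fun t ht =>
    extendFrom_extends hτc t ht
  refine ⟨extendFrom (Ioo a b) τ, continuousOn_Icc_extendFrom_Ioo hτc hp hq, ?_, ?_⟩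
  · intro t ht
    rcases eq_or_lt_of_le ht.1 with rfl | h1
    · rw [eq_lim_at_left_extendFrom_Ioo hlt hp, hpg]
    rcases eq_or_lt_of_le ht.2 with rfl | h2
    · rw [eq_lim_at_right_extendFrom_Ioo hlt hq, hqg]
    rw [hext t ⟨h1, h2⟩, hτg t ⟨h1, h2⟩]
  · rw [hext m hm, hτ m hm, hF]

/-- Two sections over an open arc free of exceptional values which meet are equal. -/
theorem section_unique (hg : Continuous g) (hloc : IsLocalHomeomorphOn g V₀ᶜ) {a b m : ℝ}
    (hm : m ∈ Ioo a b) (hab : ∀ t ∈ Ioo a b, Circle.exp t ∉ g '' V₀) {σ τ : ℝ → Y}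
    (hσ : ContinuousOn σ (Icc a b)) (hτ : ContinuousOn τ (Icc a b))
    (hσg : ∀ t ∈ Icc a b, g (σ t) = Circle.exp t) (hτg : ∀ t ∈ Icc a b, g (τ t) = Circle.exp t)
    (h : σ m = τ m) : EqOn σ τ (Ioo a b) := by
  have huniq := existsUnique_section hg hloc hm hab (hσg m (Ioo_subset_Icc_self hm))
  let mk : ∀ ρ : ℝ → Y, ContinuousOn ρ (Icc a b) → C(Ioo a b, Y) := fun ρ hρ =>
    ⟨fun t => ρ t, (hρ.mono Ioo_subset_Icc_self).domRestrict⟩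
  have := huniq.unique (y₁ := mk σ hσ) (y₂ := mk τ hτ)
    ⟨rfl, funext fun t => hσg t (Ioo_subset_Icc_self t.2)⟩
    ⟨h.symm, funext fun t => hτg t (Ioo_subset_Icc_self t.2)⟩
  intro t ht
  exact congrArg (fun F : C(Ioo a b, Y) => F ⟨t, ht⟩) this

/-- The points of `s` directly before and after `t`. -/
theorem Set.Finite.exists_consecutive {s : Set ℝ} (hs : s.Finite) {t : ℝ} (ht : t ∉ s) {p q : ℝ}
    (hp : p ∈ s) (hpt : p ≤ t) (hq : q ∈ s) (htq : t ≤ q) :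
    ∃ a ∈ s, ∃ b ∈ s, t ∈ Ioo a b ∧ ∀ r ∈ Ioo a b, r ∉ s := by
  obtain ⟨a, ⟨ha, hat⟩, hamax⟩ := exists_max_image (s ∩ Iic t) id (hs.subset inter_subset_left)
    ⟨p, hp, hpt⟩
  obtain ⟨b, ⟨hb, htb⟩, hbmin⟩ := exists_min_image (s ∩ Ici t) id (hs.subset inter_subset_left)
    ⟨q, hq, htq⟩
  refine ⟨a, ha, b, hb, ⟨lt_of_le_of_ne hat ?_, lt_of_le_of_ne htb ?_⟩, fun r hr hrs => ?_⟩
  · rintro rfl; exact ht ha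
  · rintro rfl; exact ht hb
  · rcases le_total r t with h | h
    · exact absurd (hamax r ⟨hrs, h⟩) (not_le.2 hr.1)
    · exact absurd (hbmin r ⟨hrs, h⟩) (not_le.2 hr.2)

/-- The affine parametrization of the segment from `a` to `b`. -/
def segmentParam (a b : ℝ) (s : unitInterval) : ℝ := a + s * (b - a)

theorem continuous_segmentParam (a b : ℝ) : Continuous (segmentParam a b) := by
  unfold segmentParam; fun_prop

theorem segmentParam_mem_Icc {a b : ℝ} (h : a < b) (s : unitInterval) :
    segmentParam a b s ∈ Icc a b := by
  have h0 := s.2.1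
  have h1 := s.2.2
  constructor <;> unfold segmentParam <;> nlinarith

theorem segmentParam_mem_Ioo {a b : ℝ} (h : a < b) {s : unitInterval} (hs : s ∈ Ioo 0 1) :
    segmentParam a b s ∈ Ioo a b := by
  have h0 : (0 : ℝ) < s := hs.1
  have h1 : (s : ℝ) < 1 := hs.2
  constructor <;> unfold segmentParam <;> nlinarith

theorem segmentParam_injective {a b : ℝ} (h : a < b) : Function.Injective (segmentParam a b) := by
  intro s t hst
  have : (s : ℝ) * (b - a) = t * (b - a) := by simpa [segmentParam] using hst
  exact Subtype.ext (mul_right_cancel₀ (sub_ne_zero.2 h.ne') this)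

theorem exists_segmentParam_eq {a b t : ℝ} (ht : t ∈ Ioo a b) :
    ∃ s ∈ Ioo (0 : unitInterval) 1, segmentParam a b s = t := by
  have hab : 0 < b - a := sub_pos.2 (ht.1.trans ht.2)
  have h1 : 0 < (t - a) / (b - a) := div_pos (sub_pos.2 ht.1) hab
  have h2 : (t - a) / (b - a) < 1 := (div_lt_one hab).2 (by linarith [ht.2])
  refine ⟨⟨(t - a) / (b - a), h1.le, h2.le⟩, ⟨h1, h2⟩, ?_⟩
  unfold segmentParam
  rw [div_mul_cancel₀ _ hab.ne']
  ring

/-- A compact Hausdorff space with a light map to the circle which is a local homeomorphism off a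
finite set is a finite graph: the edges are the sections over the arcs into which the exceptional
values, together with `1`, cut the circle. The fibres over these values are finite because each
point of such a fibre, unless it is exceptional, is an end of one of the finitely many edges. -/
theorem exists_graphStructure (hg : Continuous g)
    (light : ∀ S : Set Y, IsPreconnected S → ∀ c, (∀ v ∈ S, g v = c) → S.Subsingleton)
    (hV₀ : V₀.Finite) (hloc : IsLocalHomeomorphOn g V₀ᶜ) : Nonempty (GraphStructure Y) := by
  -- the value `1` is added to `Q` so that every arc of the complement lifts to an interval in
  -- `[0, 2π]`; `Θ` consists of the arguments of the values in `Q`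
  set Q : Set Circle := g '' V₀ ∪ {1} with hQ
  have hQfin : Q.Finite := (hV₀.image g).union (finite_singleton 1)
  set Θ : Set ℝ := Icc 0 (2 * Real.pi) ∩ Circle.exp ⁻¹' Q with hΘ
  have hpi := Real.two_pi_pos
  have h0Θ : (0 : ℝ) ∈ Θ := ⟨⟨le_rfl, hpi.le⟩, Or.inr Circle.exp_zero⟩
  have h1Θ : 2 * Real.pi ∈ Θ := ⟨⟨hpi.le, le_rfl⟩, Or.inr Circle.exp_two_pi⟩
  have hinj : InjOn Circle.exp (Ico 0 (2 * Real.pi)) := Circle.exp_injOn_Ico (by simp)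
  have hΘfin : Θ.Finite := by
    have : (Ico 0 (2 * Real.pi) ∩ Circle.exp ⁻¹' Q).Finite := by
      refine Finite.of_finite_image (f := Circle.exp) (hQfin.subset ?_)
        (hinj.mono inter_subset_left)
      rintro _ ⟨t, ht, rfl⟩
      exact ht.2
    refine (this.union (finite_singleton (2 * Real.pi))).subset ?_
    rintro t ⟨ht, htQ⟩
    rcases eq_or_lt_of_le ht.2 with h | h
    · exact Or.inr h
    · exact Or.inl ⟨⟨ht.1, h⟩, htQ⟩
  -- the complementary arcs of `Q`, given by their end arguments
  let consec : ℝ → ℝ → Prop := fun a b => a ∈ Θ ∧ b ∈ Θ ∧ a < b ∧ ∀ r ∈ Ioo a b, r ∉ Θ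
  have hcI : ∀ {a b : ℝ}, consec a b → Ioo a b ⊆ Ico 0 (2 * Real.pi) := fun h t ht =>
    ⟨h.1.1.1.trans ht.1.le, ht.2.trans_le h.2.1.1.2⟩
  have hcQ : ∀ {a b : ℝ}, consec a b → ∀ t ∈ Ioo a b, Circle.exp t ∉ Q := fun h t ht htQ =>
    h.2.2.2 t ht ⟨⟨(hcI h ht).1, (hcI h ht).2.le⟩, htQ⟩
  have hcV : ∀ {a b : ℝ}, consec a b → ∀ t ∈ Ioo a b, Circle.exp t ∉ g '' V₀ := fun h t ht htQ =>
    hcQ h t ht (Or.inl htQ)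
  have hceq : ∀ {a b a' b' t : ℝ}, consec a b → consec a' b' → t ∈ Ioo a b → t ∈ Ioo a' b' →
      a = a' ∧ b = b' := by
    intro a b a' b' t h h' ht ht'
    constructor
    · rcases lt_trichotomy a a' with hl | hl | hl
      · exact absurd h'.1 (h.2.2.2 a' ⟨hl, ht'.1.trans ht.2⟩)
      · exact hl
      · exact absurd h.1 (h'.2.2.2 a ⟨hl, ht.1.trans ht'.2⟩)
    · rcases lt_trichotomy b b' with hl | hl | hl
      · exact absurd h.2.1 (h'.2.2.2 b ⟨ht'.1.trans ht.2, hl⟩)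
      · exact hl
      · exact absurd h'.2.1 (h.2.2.2 b' ⟨ht.1.trans ht'.2, hl⟩)
  have hmid : ∀ {a b : ℝ}, consec a b → (a + b) / 2 ∈ Ioo a b := fun h =>
    ⟨by linarith [h.2.2.1], by linarith [h.2.2.1]⟩
  -- an edge is recorded by its midpoint
  let E := {z : Y // ∃ a b, consec a b ∧ g z = Circle.exp ((a + b) / 2)}
  choose α β hαβ hz using fun e : E => e.2
  choose σ hσc hσg hσm using fun e : E =>
    exists_section_Icc hg light hloc (hmid (hαβ e)) (hcV (hαβ e)) (hz e)
  have hEfin : Finite E := by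
    -- over unexceptional values `g` is a covering of a compact space, so the fibres are finite
    have hcov : IsCoveringMapOn g (g '' V₀)ᶜ :=
      IsCoveringMapOn.of_isLocalHomeomorphOn hg (hloc.mono fun v hv hv' => hv ⟨v, hv', rfl⟩)
    have hfib : ∀ c ∉ g '' V₀, (g ⁻¹' {c}).Finite := fun c hc =>
      (isClosed_singleton.preimage hg).isCompact.finite ⟨(hcov c hc).discreteTopology_fiber⟩
    have : (⋃ p ∈ (Θ ×ˢ Θ) ∩ {p | consec p.1 p.2},
        g ⁻¹' {Circle.exp ((p.1 + p.2) / 2)}).Finite :=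
      ((hΘfin.prod hΘfin).subset inter_subset_left).biUnion fun p hp =>
        hfib _ (hcV hp.2 _ (hmid hp.2))
    refine (this.subset ?_).to_subtype
    rintro z ⟨a, b, h, hzz⟩
    exact mem_biUnion (x := (a, b)) ⟨⟨h.1, h.2.1⟩, h⟩ hzz
  let c : E → C(unitInterval, Y) := fun e =>
    ⟨fun s => σ e (segmentParam (α e) (β e) s), (hσc e).comp_continuous
      (continuous_segmentParam _ _) (segmentParam_mem_Icc (hαβ e).2.2.1)⟩
  have hcg : ∀ e s, g (c e s) = Circle.exp (segmentParam (α e) (β e) s) := fun e s =>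
    hσg e _ (segmentParam_mem_Icc (hαβ e).2.2.1 s)
  have hex : ∀ y, g y ∉ Q → ∃ e, ∃ s ∈ Ioo (0 : unitInterval) 1, c e s = y := by
    intro y hy
    obtain ⟨t, ht⟩ : ∃ t ∈ Ico 0 (2 * Real.pi), Circle.exp t = g y := by
      obtain ⟨s, hs⟩ := Circle.exp_surjective (g y)
      refine ⟨toIcoMod hpi 0 s, by simpa using toIcoMod_mem_Ico hpi 0 s, ?_⟩
      rw [← hs, toIcoMod, Circle.periodic_exp.sub_zsmul_eq]
    have htΘ : t ∉ Θ := fun h => hy (by rw [← ht.2]; exact h.2)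
    obtain ⟨a, ha, b, hb, htab, hcons⟩ :=
      hΘfin.exists_consecutive htΘ h0Θ ht.1.1 h1Θ ht.1.2.le
    have hab : consec a b := ⟨ha, hb, htab.1.trans htab.2, hcons⟩
    obtain ⟨ρ, hρc, hρg, hρt⟩ := exists_section_Icc hg light hloc htab (hcV hab) ht.2.symm
    let e : E := ⟨ρ ((a + b) / 2), a, b, hab, hρg _ (Ioo_subset_Icc_self (hmid hab))⟩
    have hee : a = α e ∧ b = β e := by
      have hgz := hz e
      have h1 : g e.1 = Circle.exp ((a + b) / 2) := hρg _ (Ioo_subset_Icc_self (hmid hab))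
      have h2 := hinj (hcI hab (hmid hab)) (hcI (hαβ e) (hmid (hαβ e))) (h1.symm.trans hgz)
      refine hceq hab (hαβ e) (hmid hab) ?_
      rw [h2]
      exact hmid (hαβ e)
    have hEq : EqOn ρ (σ e) (Ioo a b) := by
      refine section_unique hg hloc (hmid hab) (hcV hab) hρc ?_ hρg ?_ ?_
      · rw [hee.1, hee.2]; exact hσc e
      · rw [hee.1, hee.2]; exact hσg e
      · have := hσm e
        rw [← hee.1, ← hee.2] at this
        exact this.symm
    obtain ⟨s, hs, hst⟩ := exists_segmentParam_eq htab
    refine ⟨e, s, hs, ?_⟩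
    have : segmentParam (α e) (β e) s = t := by rw [← hee.1, ← hee.2, hst]
    change σ e (segmentParam (α e) (β e) s) = y
    rw [this, ← hEq htab, hρt]
  have hends : ∀ e, g (c e 0) ∈ Q ∧ g (c e 1) ∈ Q := by
    intro e
    rw [hcg, hcg]
    have h0 : segmentParam (α e) (β e) 0 = α e := by simp [segmentParam]
    have h1 : segmentParam (α e) (β e) 1 = β e := by simp [segmentParam]
    rw [h0, h1]
    exact ⟨(hαβ e).1.2, (hαβ e).2.1.2⟩
  have hint : ∀ e, ∀ s ∈ Ioo (0 : unitInterval) 1, g (c e s) ∉ Q := by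
    intro e s hs
    rw [hcg]
    exact hcQ (hαβ e) _ (segmentParam_mem_Ioo (hαβ e).2.2.1 hs)
  refine ⟨⟨g ⁻¹' Q, ?_, E, hEfin, c, fun e => (hends e).1, fun e => (hends e).2, hint, ?_,
    fun y hy => hex y hy⟩⟩
  · have hfinite : (V₀ ∪ (range (fun e => c e 0) ∪ range (fun e => c e 1))).Finite :=
      hV₀.union ((finite_range _).union (finite_range _))
    refine hfinite.subset fun y hy => ?_
    by_cases hyV : y ∈ V₀
    · exact Or.inl hyV
    right
    -- `y` is a limit of points of edges
    have hcl : y ∈ closure (g ⁻¹' Qᶜ) := by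
      rw [mem_closure_iff_nhds]
      intro O hO
      obtain ⟨φ, hyφ, hφ⟩ := hloc y hyV
      have hnh : g '' O ∈ 𝓝 (g y) := by
        rw [hφ, ← φ.map_nhds_eq hyφ]
        exact image_mem_map hO
      -- otherwise the neighbourhood `g '' O` of `g y` would be contained in the finite set `Q`
      by_contra hne
      rw [not_nonempty_iff_eq_empty] at hne
      have hsub : g '' O ⊆ Q := by
        rintro _ ⟨z, hz, rfl⟩
        by_contra hzQ
        have : z ∈ O ∩ g ⁻¹' Qᶜ := ⟨hz, hzQ⟩
        rw [hne] at this
        exact this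
      have : Nontrivial Circle := ⟨⟨_, _, Circle.exp_pi_ne_one⟩⟩
      exact (infinite_of_mem_nhds _ (Filter.mem_of_superset hnh hsub)) hQfin
    have hsub : closure (g ⁻¹' Qᶜ) ⊆ ⋃ e, range (c e) := by
      refine closure_minimal ?_ (isClosed_iUnion_of_finite fun e =>
        (isCompact_range (c e).continuous).isClosed)
      intro z hz
      obtain ⟨e, s, -, hs⟩ := hex z hz
      exact mem_iUnion.2 ⟨e, s, hs⟩
    obtain ⟨e, s, hs⟩ := mem_iUnion.1 (hsub hcl)
    by_cases hs0 : s = 0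
    · exact Or.inl ⟨e, by rw [← hs, hs0]⟩
    by_cases hs1 : s = 1
    · exact Or.inr ⟨e, by rw [← hs, hs1]⟩
    · exact absurd (by rw [hs]; exact hy)
        (hint e s ⟨lt_of_le_of_ne s.2.1 (Ne.symm hs0),
          lt_of_le_of_ne s.2.2 hs1⟩)
  · intro e s hs e' s' hs' h
    have hm := segmentParam_mem_Ioo (hαβ e).2.2.1 hs
    have hm' := segmentParam_mem_Ioo (hαβ e').2.2.1 hs'
    have ht : segmentParam (α e) (β e) s = segmentParam (α e') (β e') s' := by
      refine hinj (hcI (hαβ e) hm) (hcI (hαβ e') hm') ?_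
      rw [← hcg, ← hcg, h]
    have hab := hceq (hαβ e) (hαβ e') hm (by rw [ht]; exact hm')
    have hEq : EqOn (σ e) (σ e') (Ioo (α e) (β e)) := by
      refine section_unique hg hloc hm (hcV (hαβ e)) (hσc e) ?_ (hσg e) ?_ ?_
      · rw [hab.1, hab.2]; exact hσc e'
      · rw [hab.1, hab.2]; exact hσg e'
      · refine Eq.trans h ?_
        change σ e' (segmentParam (α e') (β e') s') = _
        rw [ht]
    have hee : e = e' := by
      apply Subtype.ext
      rw [← hσm e, hEq (hmid (hαβ e)), hab.1, hab.2, hσm e']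
    subst hee
    exact ⟨rfl, segmentParam_injective (hαβ e).2.2.1 ht⟩

end LightMaps

namespace GraphStructure

universe u

variable {Y : Type u} [TopologicalSpace Y] (G : GraphStructure Y)

instance : Finite G.E := G.finite_E

instance : Finite G.V := G.finite_V

theorem mem_Ioo_of_notMem {e : G.E} {t : unitInterval} (h : G.edge e t ∉ G.V) :
    t ∈ Ioo (0 : unitInterval) 1 := by
  refine ⟨lt_of_le_of_ne t.2.1 ?_, lt_of_le_of_ne t.2.2 ?_⟩
  · intro h0
    have : t = 0 := h0.symm
    exact h (this ▸ G.edge_zero e)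
  · intro h1
    have : t = 1 := h1
    exact h (this ▸ G.edge_one e)

theorem eq_of_edge_mem {e : G.E} {t : unitInterval} (h : G.edge e t ∈ G.V) : t = 0 ∨ t = 1 := by
  by_contra hne
  push Not at hne
  exact G.edge_notMem e t ⟨lt_of_le_of_ne t.2.1 hne.1.symm, lt_of_le_of_ne t.2.2 hne.2⟩ h

theorem eq_of_edge_eq {e e' : G.E} {t t' : unitInterval} (ht : t ∈ Ioo (0 : unitInterval) 1)
    (h : G.edge e t = G.edge e' t') : e = e' ∧ t = t' :=
  G.edge_inj e t ht e' t' (G.mem_Ioo_of_notMem (h ▸ G.edge_notMem e t ht)) h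

/-- The tautological map from the disjoint union of the vertices and of the closed edges. -/
def glue : G.V ⊕ (Σ _ : G.E, unitInterval) → Y :=
  Sum.elim (fun v => v) fun p => G.edge p.1 p.2

theorem continuous_glue : Continuous G.glue :=
  continuous_sum_dom.2 ⟨continuous_subtype_val, continuous_sigma fun e => (G.edge e).continuous⟩

theorem glue_surjective : Function.Surjective G.glue := by
  intro y
  by_cases h : y ∈ G.V
  · exact ⟨Sum.inl ⟨y, h⟩, rfl⟩
  · obtain ⟨e, t, -, rfl⟩ := G.exhaust y h
    exact ⟨Sum.inr ⟨e, t⟩, rfl⟩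

variable [T2Space Y]

theorem isQuotientMap_glue : IsQuotientMap G.glue :=
  G.continuous_glue.isClosedMap.isQuotientMap G.continuous_glue G.glue_surjective

theorem isOpen_iff {U : Set Y} : IsOpen U ↔ ∀ e, IsOpen (G.edge e ⁻¹' U) := by
  refine ⟨fun h e => h.preimage (G.edge e).continuous, fun h => ?_⟩
  rw [← G.isQuotientMap_glue.isOpen_preimage, isOpen_sum_iff, isOpen_sigma_iff]
  exact ⟨isOpen_discrete _, h⟩

/-- Continuous maps out of a graph are given by their values at the vertices and by compatible maps
on the edges. -/
theorem exists_lift {Z : Type*} [TopologicalSpace Z] (a : Y → Z) (b : G.E → C(unitInterval, Z))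
    (h0 : ∀ e, b e 0 = a (G.edge e 0)) (h1 : ∀ e, b e 1 = a (G.edge e 1)) :
    ∃ F : C(Y, Z), (∀ v ∈ G.V, F v = a v) ∧ ∀ e t, F (G.edge e t) = b e t := by
  classical
  let F : Y → Z := fun y => if h : y ∈ G.V then a y else
    b (G.exhaust y h).choose (G.exhaust y h).choose_spec.choose
  have hV : ∀ v ∈ G.V, F v = a v := fun v hv => dif_pos hv
  have hE : ∀ e t, F (G.edge e t) = b e t := by
    intro e t
    by_cases h : G.edge e t ∈ G.V
    · rw [hV _ h]
      rcases G.eq_of_edge_mem h with rfl | rfl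
      · exact (h0 e).symm
      · exact (h1 e).symm
    · have hs := (G.exhaust _ h).choose_spec.choose_spec
      have := G.eq_of_edge_eq hs.1 hs.2
      refine (dif_neg h).trans ?_
      exact congr (congrArg (fun e => (b e : unitInterval → Z)) this.1) this.2
  refine ⟨⟨F, ?_⟩, hV, hE⟩
  rw [G.isQuotientMap_glue.continuous_iff, continuous_sum_dom]
  refine ⟨continuous_of_discreteTopology, continuous_sigma fun e => ?_⟩
  have : (F ∘ G.glue ∘ Sum.inr) ∘ Sigma.mk e = b e := by
    ext t; exact hE e t
  change Continuous ((F ∘ G.glue ∘ Sum.inr) ∘ Sigma.mk e)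
  rw [this]
  exact (b e).continuous

theorem isOpen_edge_image (e : G.E) {U : Set unitInterval} (hU : IsOpen U)
    (hsub : U ⊆ Ioo 0 1) : IsOpen (G.edge e '' U) := by
  rw [G.isOpen_iff]
  intro e'
  by_cases h : e' = e
  · subst h
    convert hU
    ext t
    refine ⟨?_, fun ht => ⟨t, ht, rfl⟩⟩
    rintro ⟨s, hs, hst⟩
    rwa [← (G.eq_of_edge_eq (hsub hs) hst).2]
  · convert isOpen_empty
    ext t
    refine ⟨?_, fun ht => ht.elim⟩
    rintro ⟨s, hs, hst⟩
    exact h (G.eq_of_edge_eq (hsub hs) hst).1.symm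

/-- The vertices and the edges are the cells of a CW structure. -/
theorem isFiniteGraph (G : GraphStructure Y) : IsFiniteGraph Y := by
  classical
  refine ⟨inferInstance, ?_⟩
  -- the cells are parametrized by the interval `[-1, 1]`, the unit ball of `Fin 1 → ℝ`
  let f : G.E → (Fin 1 → ℝ) → Y := fun e x =>
    G.edge e (projIcc 0 1 zero_le_one ((x 0 + 1) / 2))
  have hball : ∀ x : Fin 1 → ℝ, x ∈ Metric.ball (0 : Fin 1 → ℝ) 1 ↔ |x 0| < 1 := by
    intro x
    rw [mem_ball_zero_iff, pi_norm_lt_iff one_pos]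
    simp
  have hpar : ∀ x ∈ Metric.ball (0 : Fin 1 → ℝ) 1, (x 0 + 1) / 2 ∈ Ioo (0 : ℝ) 1 := by
    intro x hx
    rw [hball, abs_lt] at hx
    constructor <;> linarith
  have hproj : ∀ x (hx : x ∈ Metric.ball (0 : Fin 1 → ℝ) 1),
      projIcc (0 : ℝ) 1 zero_le_one ((x 0 + 1) / 2) =
        ⟨(x 0 + 1) / 2, Ioo_subset_Icc_self (hpar x hx)⟩ :=
    fun x hx => projIcc_of_mem _ _
  have hIoo : ∀ x ∈ Metric.ball (0 : Fin 1 → ℝ) 1,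
      projIcc (0 : ℝ) 1 zero_le_one ((x 0 + 1) / 2) ∈ Ioo (0 : unitInterval) 1 := by
    intro x hx
    rw [hproj x hx]
    exact hpar x hx
  have hcont : ∀ e, Continuous (f e) := fun e =>
    (G.edge e).continuous.comp (continuous_projIcc.comp (by fun_prop))
  have hinj : ∀ e, InjOn (f e) (Metric.ball 0 1) := by
    intro e x hx y hy h
    have := (G.edge_inj e _ (hIoo x hx) e _ (hIoo y hy) h).2
    rw [hproj x hx, hproj y hy, Subtype.mk.injEq] at this
    ext i
    rw [Subsingleton.elim i 0]
    linarith
  have himage : ∀ e, f e '' Metric.ball 0 1 = G.edge e '' Ioo 0 1 := by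
    intro e
    ext y
    constructor
    · rintro ⟨x, hx, rfl⟩
      exact ⟨_, hIoo x hx, rfl⟩
    · rintro ⟨t, ht, rfl⟩
      have h0 : (0 : ℝ) < t := ht.1
      have h1 : (t : ℝ) < 1 := ht.2
      refine ⟨fun _ => 2 * (t : ℝ) - 1, ?_, ?_⟩
      · rw [hball, abs_lt]; constructor <;> linarith
      · change G.edge e (projIcc 0 1 zero_le_one ((2 * (t : ℝ) - 1 + 1) / 2)) = _
        have : (2 * (t : ℝ) - 1 + 1) / 2 = t := by ring
        rw [this, projIcc_val]
  have hopen : ∀ e, IsOpenMap ((Metric.ball (0 : Fin 1 → ℝ) 1).domRestrict (f e)) := by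
    intro e U hU
    have hU' : IsOpen ((↑) '' U : Set (Fin 1 → ℝ)) := Metric.isOpen_ball.isOpenMap_subtype_val U hU
    let k : unitInterval → Fin 1 → ℝ := fun t _ => 2 * (t : ℝ) - 1
    have hk : Continuous k := by fun_prop
    have : (Metric.ball (0 : Fin 1 → ℝ) 1).domRestrict (f e) '' U =
        G.edge e '' (k ⁻¹' ((↑) '' U)) := by
      ext y
      constructor
      · rintro ⟨x, hx, rfl⟩
        refine ⟨_, ?_, rfl⟩
        refine ⟨x, hx, ?_⟩
        ext i
        rw [Subsingleton.elim i 0]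
        simp only [k]
        rw [hproj x.1 x.2]
        simp only; ring
      · rintro ⟨t, ⟨x, hx, hxt⟩, rfl⟩
        refine ⟨x, hx, ?_⟩
        change G.edge e _ = _
        have : x.1 0 = 2 * (t : ℝ) - 1 := congrFun hxt 0
        rw [this]
        have : (2 * (t : ℝ) - 1 + 1) / 2 = t := by ring
        rw [this, projIcc_val]
    rw [this]
    refine G.isOpen_edge_image e (hU'.preimage hk) ?_
    rintro t ⟨x, -, hxt⟩
    have h1 : x.1 0 = 2 * (t : ℝ) - 1 := congrFun hxt 0
    have h2 := (hball _).1 x.2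
    rw [h1, abs_lt] at h2
    constructor
    · change (0 : ℝ) < t
      linarith
    · change (t : ℝ) < 1
      linarith
  let φ : G.E → OpenPartialHomeomorph (Fin 1 → ℝ) Y := fun e =>
    haveI : Nonempty (Fin 1 → ℝ) := ⟨0⟩
    OpenPartialHomeomorph.ofContinuousOpenRestrict (hinj e).toPartialEquiv
      (hcont e).continuousOn (hopen e) Metric.isOpen_ball
  have hφ : ∀ e x, φ e x = f e x := fun _ _ => rfl
  let cell : ℕ → Type u := fun n => match n with
    | 0 => G.V
    | 1 => G.E
    | _ => PEmpty
  let map : (n : ℕ) → (i : cell n) → PartialEquiv (Fin n → ℝ) Y := fun n => match n with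
    | 0 => fun v : G.V => PartialEquiv.single ![] (v : Y)
    | 1 => fun e : G.E => (φ e).toPartialEquiv
    | _ + 2 => fun i : PEmpty => i.elim
  have hsphere : ∀ e : G.E, ∀ x ∈ Metric.sphere (0 : Fin 1 → ℝ) 1, f e x ∈ G.V := by
    intro e x hx
    have hx1 : |x 0| = 1 := by
      have := mem_sphere_zero_iff_norm.1 hx
      rwa [Pi.norm_def, Finset.univ_unique, Finset.sup_singleton, coe_nnnorm] at this
    rcases eq_or_eq_neg_of_abs_eq hx1 with h | h
    · have : projIcc (0 : ℝ) 1 zero_le_one ((x 0 + 1) / 2) = 1 :=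
        projIcc_of_right_le _ (by rw [h]; norm_num)
      simp only [f, this]
      exact G.edge_one e
    · have : projIcc (0 : ℝ) 1 zero_le_one ((x 0 + 1) / 2) = 0 :=
        projIcc_of_le_left _ (by rw [h]; norm_num)
      simp only [f, this]
      exact G.edge_zero e
  refine ⟨CWComplex.mkFinite univ cell map ?_ ?_ ?_ ?_ ?_ ?_ ?_ ?_, ?_, ?_⟩
  · filter_upwards [Filter.eventually_ge_atTop 2] with n hn
    obtain ⟨m, rfl⟩ := Nat.exists_eq_add_of_le' hn
    exact inferInstanceAs (IsEmpty PEmpty)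
  · rintro (_ | _ | n)
    · exact inferInstanceAs (Finite G.V)
    · exact inferInstanceAs (Finite G.E)
    · exact inferInstanceAs (Finite PEmpty)
  · rintro (_ | _ | n) i
    · simp [map, Metric.ball, eq_univ_iff_forall, Subsingleton.elim _ ![]]
    · rfl
    · exact i.elim
  · rintro (_ | _ | n) i
    · exact continuousOn_const
    · exact (hcont i).continuousOn
    · exact i.elim
  · rintro (_ | _ | n) i
    · exact continuousOn_const
    · exact (φ i).continuousOn_symm
    · exact i.elim
  · have hmem : ∀ (v : G.V), (map 0 v) '' Metric.ball 0 1 ⊆ {(v : Y)} := by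
      rintro v _ ⟨x, -, rfl⟩
      rfl
    rintro ⟨_ | _ | n, i⟩ - ⟨_ | _ | m, j⟩ - hij
    · refine Disjoint.mono (hmem i) (hmem j) ?_
      rw [disjoint_singleton]
      intro h
      exact hij (by rw [Subtype.ext h])
    · refine Disjoint.mono_left (hmem i) ?_
      rw [disjoint_singleton_left]
      change _ ∉ f j '' Metric.ball 0 1
      rw [himage]
      rintro ⟨t, ht, htv⟩
      exact G.edge_notMem j t ht (htv ▸ i.2)
    · exact j.elim
    · refine Disjoint.mono_right (hmem j) ?_
      rw [disjoint_singleton_right]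
      change _ ∉ f i '' Metric.ball 0 1
      rw [himage]
      rintro ⟨t, ht, htv⟩
      exact G.edge_notMem i t ht (htv ▸ j.2)
    · change Disjoint (f i '' Metric.ball 0 1) (f j '' Metric.ball 0 1)
      rw [himage, himage, disjoint_left]
      rintro _ ⟨t, ht, rfl⟩ ⟨t', ht', h⟩
      exact hij (by rw [(G.edge_inj _ _ ht' _ _ ht h).1])
    · exact j.elim
    · exact i.elim
    · exact i.elim
    · exact i.elim
  · rintro (_ | _ | n) i x hx
    · rw [Subsingleton.elim x 0, mem_sphere_zero_iff_norm, norm_zero] at hx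
      exact absurd hx zero_ne_one
    · refine mem_iUnion₂.2 ⟨0, zero_lt_one, mem_iUnion.2 ⟨⟨f i x, hsphere i x hx⟩, ?_⟩⟩
      exact ⟨0, Metric.mem_closedBall_self zero_le_one, rfl⟩
    · exact i.elim
  · rw [eq_univ_iff_forall]
    intro y
    by_cases h : y ∈ G.V
    · exact mem_iUnion₂.2 ⟨0, ⟨y, h⟩, 0, Metric.mem_closedBall_self zero_le_one, rfl⟩
    · obtain ⟨e, t, ht, rfl⟩ := G.exhaust y h
      refine mem_iUnion₂.2 ⟨1, e, ?_⟩
      have : G.edge e t ∈ f e '' Metric.ball 0 1 := by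
        rw [himage]; exact ⟨t, ht, rfl⟩
      exact image_mono Metric.ball_subset_closedBall this
  · rintro (_ | _ | n)
    · exact inferInstanceAs (Finite G.V)
    · exact inferInstanceAs (Finite G.E)
    · exact inferInstanceAs (Finite PEmpty)
  · intro n hn
    obtain ⟨m, rfl⟩ := Nat.exists_eq_add_of_le' hn
    exact inferInstanceAs (IsEmpty PEmpty)

end GraphStructure

/-! ### Homotopy classes of paths -/

namespace Path.Homotopic.Quotient

variable {X : Type*} [TopologicalSpace X] {x y z : X}

theorem trans_symm_cancel_left (a : Path.Homotopic.Quotient x y) (b : Path.Homotopic.Quotient x z) :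
    a.trans (a.symm.trans b) = b := by
  rw [← trans_assoc, trans_symm, refl_trans]

theorem symm_trans_cancel_left (a : Path.Homotopic.Quotient x y) (b : Path.Homotopic.Quotient y z) :
    a.symm.trans (a.trans b) = b := by
  rw [← trans_assoc, symm_trans, refl_trans]

theorem symm_of_trans (a : Path.Homotopic.Quotient x y) (b : Path.Homotopic.Quotient y z) :
    (a.trans b).symm = b.symm.trans a.symm := by
  induction a with | mk a => induction b with | mk b =>
  rw [← mk_trans, ← mk_symm, ← mk_symm, ← mk_symm, ← mk_trans, Path.trans_symm]

theorem symm_symm (a : Path.Homotopic.Quotient x y) : a.symm.symm = a := by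
  induction a with | mk a =>
  rw [← mk_symm, ← mk_symm, Path.symm_symm]

end Path.Homotopic.Quotient

section PathClasses

open Path.Homotopic.Quotient

instance : ContractibleSpace unitInterval :=
  (convex_Icc (0 : ℝ) 1).contractibleSpace ⟨0, by simp⟩

variable {Y : Type*} [TopologicalSpace Y]

/-- Paths with the same endpoints which factor, with the same endpoints, through a simply connected
space are homotopic. -/
theorem Path.Homotopic.Quotient.mk_eq_of_factors {A : Type*} [TopologicalSpace A]
    [SimplyConnectedSpace A] (φ : C(A, Y)) {x y : Y} {p q : Path x y} (p' q' : C(unitInterval, A))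
    (hp : ∀ s, p s = φ (p' s)) (hq : ∀ s, q s = φ (q' s)) (h0 : p' 0 = q' 0) (h1 : p' 1 = q' 1) :
    Path.Homotopic.Quotient.mk p = Path.Homotopic.Quotient.mk q := by
  have hx : x = φ (p' 0) := by rw [← hp, p.source]
  have hy : y = φ (p' 1) := by rw [← hp, p.target]
  subst hx hy
  let P : Path (p' 0) (p' 1) := ⟨p', rfl, rfl⟩
  let Q : Path (p' 0) (p' 1) := ⟨q', h0.symm, h1.symm⟩
  have eP : p = P.map φ.continuous := Path.ext (funext hp)
  have eQ : q = Q.map φ.continuous := Path.ext (funext hq)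
  rw [eP, eQ, Path.Homotopic.Quotient.eq]
  exact (SimplyConnectedSpace.paths_homotopic P Q).map φ

/-- The two ways around a singular square are homotopic. -/
theorem Path.Homotopic.Quotient.trans_eq_trans_of_square (K : C(unitInterval × unitInterval, Y))
    {x y z w : Y} {p : Path x y} {r : Path y w} {l : Path x z} {q : Path z w}
    (hp : ∀ s, p s = K (s, 0)) (hr : ∀ s, r s = K (1, s)) (hl : ∀ s, l s = K (0, s))
    (hq : ∀ s, q s = K (s, 1)) :
    (Path.Homotopic.Quotient.mk p).trans (Path.Homotopic.Quotient.mk r) =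
      (Path.Homotopic.Quotient.mk l).trans (Path.Homotopic.Quotient.mk q) := by
  have hx : x = K (0, 0) := by rw [← hp, p.source]
  have hy : y = K (1, 0) := by rw [← hp, p.target]
  have hz : z = K (0, 1) := by rw [← hq, q.source]
  have hw : w = K (1, 1) := by rw [← hq, q.target]
  subst hx hy hz hw
  let P : Path ((0, 0) : unitInterval × unitInterval) (1, 0) :=
    ⟨⟨fun s => (s, 0), by fun_prop⟩, rfl, rfl⟩
  let R : Path ((1, 0) : unitInterval × unitInterval) (1, 1) :=
    ⟨⟨fun s => (1, s), by fun_prop⟩, rfl, rfl⟩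
  let L : Path ((0, 0) : unitInterval × unitInterval) (0, 1) :=
    ⟨⟨fun s => (0, s), by fun_prop⟩, rfl, rfl⟩
  let Q : Path ((0, 1) : unitInterval × unitInterval) (1, 1) :=
    ⟨⟨fun s => (s, 1), by fun_prop⟩, rfl, rfl⟩
  have eP : p = P.map K.continuous := Path.ext (funext hp)
  have eQ : q = Q.map K.continuous := Path.ext (funext hq)
  have eR : r = R.map K.continuous := Path.ext (funext hr)
  have eL : l = L.map K.continuous := Path.ext (funext hl)
  rw [← mk_trans, ← mk_trans, eP, eQ, eR, eL, ← Path.map_trans, ← Path.map_trans,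
    Path.Homotopic.Quotient.eq]
  exact (SimplyConnectedSpace.paths_homotopic (P.trans R) (L.trans Q)).map K

/-- A property of classes of paths from a base point holds for all classes if it holds for the
constant path and is stable under prolongation by paths inside the members of an open cover. -/
theorem Path.Homotopic.Quotient.induction_of_open_cover {ι : Type*} {U : ι → Set Y}
    (hU : ∀ i, IsOpen (U i)) (hcov : ∀ y, ∃ i, y ∈ U i) {y₀ : Y}
    (C : ∀ y, Path.Homotopic.Quotient y₀ y → Prop) (h0 : C y₀ (Path.Homotopic.Quotient.refl y₀))
    (step : ∀ i y y' (p : Path y y'), range p ⊆ U i → ∀ h, C y h →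
      C y' (h.trans (Path.Homotopic.Quotient.mk p))) :
    ∀ y h, C y h := by
  intro y h
  induction h with | mk p =>
  obtain ⟨t, t0, tmono, ⟨n, hn⟩, ht⟩ := exists_monotone_Icc_subset_open_cover_unitInterval
    (c := fun i => p ⁻¹' U i) (fun i => (hU i).preimage p.continuous)
    (fun s _ => mem_iUnion.2 (hcov (p s)))
  have main : ∀ (n : ℕ) (r : Path y₀ (p (t n))), (∀ s, r s = p (Icc.convexComb 0 (t n) s)) →
      C _ (Path.Homotopic.Quotient.mk r) := by
    intro n
    induction n with
    | zero =>
      rw [t0, p.source]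
      intro r hr
      have : r = Path.refl y₀ := by
        ext s
        rw [hr s]
        simp
      rw [this]
      exact h0
    | succ n ih =>
      intro r hr
      obtain ⟨i, hi⟩ := ht n
      let r' : Path y₀ (p (t n)) := ⟨⟨fun s => p (Icc.convexComb 0 (t n) s), by fun_prop⟩,
        by simp, by simp⟩
      let q := p.subpath (t n) (t (n + 1))
      have hq : range q ⊆ U i := by
        rw [Path.range_subpath_of_le _ _ _ (tmono n.le_succ)]
        exact image_subset_iff.2 hi
      have hC := step i _ _ q hq _ (ih r' fun s => rfl)
      convert hC using 1
      rw [← mk_trans]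
      let A : Path (0 : unitInterval) (t n) :=
        ⟨⟨fun s => Icc.convexComb 0 (t n) s, by fun_prop⟩, by simp, by simp⟩
      let B : Path (t n) (t (n + 1)) :=
        ⟨⟨fun s => Icc.convexComb (t n) (t (n + 1)) s, by fun_prop⟩, by simp, by simp⟩
      refine Path.Homotopic.Quotient.mk_eq_of_factors p.toContinuousMap
        ⟨fun s => Icc.convexComb 0 (t (n + 1)) s, by fun_prop⟩ (A.trans B).toContinuousMap hr ?_
        (by simp) (by simp)
      intro s
      change _ = p ((A.trans B) s)
      rw [Path.trans_apply, Path.trans_apply]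
      split_ifs <;> rfl
  have h1 := main n
  rw [hn n le_rfl, p.target] at h1
  exact h1 p fun s => by simp

/-- A surjection induces surjections of fundamental groups if the target has an open cover whose
members have path connected preimages and contain only homotopically trivial loops. -/
theorem FundamentalGroup.map_surjective_of_open_cover {X : Type*} [TopologicalSpace X] {ι : Type*}
    {U : ι → Set Y} (hU : ∀ i, IsOpen (U i)) (hcov : ∀ y, ∃ i, y ∈ U i)
    (htriv : ∀ i y y' (p q : Path y y'), range p ⊆ U i → range q ⊆ U i →
      Path.Homotopic.Quotient.mk p = Path.Homotopic.Quotient.mk q)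
    (f : C(X, Y)) (hf : Function.Surjective f) (hpre : ∀ i, IsPathConnected (f ⁻¹' U i)) (x : X) :
    Function.Surjective (FundamentalGroup.map f x) := by
  have main := induction_of_open_cover hU hcov (y₀ := f x)
    (fun y h => ∀ x' (hx' : f x' = y), ∃ β : Path x x',
      Path.Homotopic.Quotient.mk ((β.map f.continuous).cast rfl hx'.symm) = h) ?_ ?_
  · intro h
    obtain ⟨β, hβ⟩ := main (f x) h x rfl
    exact ⟨Path.Homotopic.Quotient.mk β, hβ⟩
  · intro x' hx'
    obtain ⟨i, hi⟩ := hcov (f x)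
    obtain ⟨β, hβ⟩ := (hpre i).joinedIn x hi x' (by rw [mem_preimage, hx']; exact hi)
    refine ⟨β, htriv i _ _ _ _ ?_ ?_⟩
    · rintro _ ⟨s, rfl⟩
      exact hβ s
    · rintro _ ⟨s, rfl⟩
      exact hi
  · intro i y y' p hp h hC x' hx'
    obtain ⟨x₁, rfl⟩ := hf y
    subst hx'
    have h1 : f x₁ ∈ U i := hp ⟨0, p.source⟩
    have h2 : f x' ∈ U i := hp ⟨1, p.target⟩
    obtain ⟨β, rfl⟩ := hC x₁ rfl
    obtain ⟨γ, hγ⟩ := (hpre i).joinedIn x₁ h1 x' h2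
    refine ⟨β.trans γ, ?_⟩
    rw [htriv i _ _ p (γ.map f.continuous) hp (by rintro _ ⟨s, rfl⟩; exact hγ s), ← mk_trans]
    congr 1
    ext s
    simp [Path.map_trans]

end PathClasses

/-! ### Loops in a finite graph -/

namespace GraphStructure

open Path.Homotopic.Quotient

universe u

variable {Y : Type u} [TopologicalSpace Y] (G : GraphStructure Y)

/-- The open star of radius `1/3` of a vertex. -/
def star (v : Y) : Set Y :=
  {y | y = v ∨ ∃ e, ∃ t : unitInterval, G.edge e t = y ∧
    ((G.edge e 0 = v ∧ (t : ℝ) < 1 / 3) ∨ (G.edge e 1 = v ∧ 2 / 3 < (t : ℝ)))}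

/-- An edge without its endpoints. -/
def openEdge (e : G.E) : Set Y := G.edge e '' Ioo 0 1

/-- An edge as a path between its endpoints. -/
def path (e : G.E) : Path (G.edge e 0) (G.edge e 1) := ⟨G.edge e, rfl, rfl⟩

/-- The stars of the vertices and the open edges. -/
def starCover : G.V ⊕ G.E → Set Y := Sum.elim (fun v => G.star v) G.openEdge

theorem edge_mem_star_iff {v : Y} (hv : v ∈ G.V) {e : G.E} {t : unitInterval} :
    G.edge e t ∈ G.star v ↔
      (G.edge e 0 = v ∧ (t : ℝ) < 1 / 3) ∨ (G.edge e 1 = v ∧ 2 / 3 < (t : ℝ)) := by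
  have key : G.edge e t = v →
      (G.edge e 0 = v ∧ (t : ℝ) < 1 / 3) ∨ (G.edge e 1 = v ∧ 2 / 3 < (t : ℝ)) := by
    intro h
    rcases G.eq_of_edge_mem (h ▸ hv) with rfl | rfl
    · exact Or.inl ⟨h, by norm_num⟩
    · exact Or.inr ⟨h, by norm_num⟩
  refine ⟨?_, fun h => Or.inr ⟨e, t, rfl, h⟩⟩
  rintro (h | ⟨e', t', ht', h⟩)
  · exact key h
  by_cases hm : G.edge e' t' ∈ G.V
  · refine key ?_
    rw [← ht']
    rcases G.eq_of_edge_mem hm with rfl | rfl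
    · rcases h with h | h
      · exact h.1
      · exact absurd h.2 (by norm_num)
    · rcases h with h | h
      · exact absurd h.2 (by norm_num)
      · exact h.1
  · obtain ⟨rfl, rfl⟩ := G.eq_of_edge_eq (G.mem_Ioo_of_notMem hm) ht'
    exact h

theorem isPreconnected_star (v : Y) : IsPreconnected (G.star v) := by
  refine isPreconnected_of_forall v fun y hy => ?_
  rcases hy with rfl | ⟨e, t, rfl, ⟨h0, ht⟩ | ⟨h1, ht⟩⟩
  · exact ⟨{y}, singleton_subset_iff.2 (Or.inl rfl), rfl, rfl, isPreconnected_singleton⟩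
  · refine ⟨G.edge e '' Icc 0 t, ?_, ⟨0, ⟨le_rfl, t.2.1⟩, h0⟩, ⟨t, ⟨t.2.1, le_rfl⟩, rfl⟩,
      isPreconnected_Icc.image _ (G.edge e).continuous.continuousOn⟩
    rintro _ ⟨s, hs, rfl⟩
    exact Or.inr ⟨e, s, rfl, Or.inl ⟨h0, lt_of_le_of_lt hs.2 ht⟩⟩
  · refine ⟨G.edge e '' Icc t 1, ?_, ⟨1, ⟨t.2.2, le_rfl⟩, h1⟩, ⟨t, ⟨le_rfl, t.2.2⟩, rfl⟩,
      isPreconnected_Icc.image _ (G.edge e).continuous.continuousOn⟩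
    rintro _ ⟨s, hs, rfl⟩
    exact Or.inr ⟨e, s, rfl, Or.inr ⟨h1, lt_of_lt_of_le ht hs.1⟩⟩

theorem isPreconnected_openEdge (e : G.E) : IsPreconnected (G.openEdge e) :=
  isPreconnected_Ioo.image _ (G.edge e).continuous.continuousOn

theorem isConnected_starCover (i : G.V ⊕ G.E) : IsConnected (G.starCover i) := by
  rcases i with v | e
  · exact ⟨⟨v, Or.inl rfl⟩, G.isPreconnected_star v⟩
  · exact ⟨(nonempty_Ioo.2 zero_lt_one).image _, G.isPreconnected_openEdge e⟩

theorem exists_mem_starCover (y : Y) : ∃ i, y ∈ G.starCover i := by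
  by_cases h : y ∈ G.V
  · exact ⟨Sum.inl ⟨y, h⟩, Or.inl rfl⟩
  · obtain ⟨e, t, ht, rfl⟩ := G.exhaust y h
    exact ⟨Sum.inr e, t, ht, rfl⟩

variable [T2Space Y]

theorem isOpen_star {v : Y} (hv : v ∈ G.V) : IsOpen (G.star v) := by
  rw [G.isOpen_iff]
  intro e
  have : G.edge e ⁻¹' G.star v = {t : unitInterval | G.edge e 0 = v ∧ (t : ℝ) < 1 / 3} ∪
      {t : unitInterval | G.edge e 1 = v ∧ 2 / 3 < (t : ℝ)} := by
    ext t
    exact G.edge_mem_star_iff hv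
  rw [this]
  refine IsOpen.union ?_ ?_
  · exact (isOpen_const (p := G.edge e 0 = v)).inter
      (isOpen_lt continuous_subtype_val continuous_const)
  · exact (isOpen_const (p := G.edge e 1 = v)).inter
      (isOpen_lt continuous_const continuous_subtype_val)

theorem isOpen_starCover (i : G.V ⊕ G.E) : IsOpen (G.starCover i) := by
  rcases i with v | e
  · exact G.isOpen_star v.2
  · exact G.isOpen_edge_image e isOpen_Ioo Subset.rfl

/-- A homotopy of the identity which stretches the middle third of each edge over the whole edge and
hence collapses all stars of radius `1/3`. -/
theorem exists_collapse : ∃ F : C(Y, C(unitInterval, Y)), (∀ y, F y 0 = y) ∧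
    ∀ v ∈ G.V, ∀ y ∈ G.star v, F y 1 = v := by
  -- linear stretching about the midpoint `1 / 2`, from slope `1` at time `0` to slope `3` at
  -- time `1`, cut off at the ends of the edge
  let ψ : C(unitInterval × unitInterval, unitInterval) :=
    ⟨fun p => projIcc 0 1 zero_le_one ((p.1 : ℝ) + p.2 * (2 * p.1 - 1)),
      continuous_projIcc.comp (by fun_prop)⟩
  have hψ : ∀ t s : unitInterval, ψ (t, s) =
    projIcc 0 1 zero_le_one ((t : ℝ) + s * (2 * t - 1)) := fun _ _ => rfl
  have hψ0 : ∀ s, ψ (0, s) = 0 := fun s => by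
    have := s.2.1
    exact projIcc_of_le_left zero_le_one (by simpa using this)
  have hψ1 : ∀ s, ψ (1, s) = 1 := fun s => by
    have := s.2.1
    exact projIcc_of_right_le zero_le_one (by simp only [Icc.coe_one]; linarith)
  obtain ⟨F, hV, hE⟩ := G.exists_lift (Z := C(unitInterval, Y)) (fun v => ContinuousMap.const _ v)
    (fun e => ((G.edge e).comp ψ).curry)
    (fun e => ContinuousMap.ext fun s => congrArg (G.edge e) (hψ0 s))
    (fun e => ContinuousMap.ext fun s => congrArg (G.edge e) (hψ1 s))
  · have hV' : ∀ v ∈ G.V, ∀ s, F v s = v := fun v hv s => by rw [hV v hv]; rfl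
    have hE' : ∀ e t s, F (G.edge e t) s = G.edge e (ψ (t, s)) := fun e t s => by rw [hE]; rfl
    refine ⟨F, fun y => ?_, ?_⟩
    · by_cases h : y ∈ G.V
      · exact hV' y h 0
      · obtain ⟨e, t, ht, rfl⟩ := G.exhaust y h
        rw [hE', hψ]
        congr 1
        simp
    · rintro v hv y hy
      by_cases h : y ∈ G.V
      · rw [hV' y h]
        rcases hy with hy | ⟨e, t, rfl, hy⟩
        · exact hy
        · rcases G.eq_of_edge_mem h with rfl | rfl
          · rcases hy with h | h
            · exact h.1
            · exact absurd h.2 (by norm_num)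
          · rcases hy with h | h
            · exact absurd h.2 (by norm_num)
            · exact h.1
      · obtain ⟨e, t, ht, rfl⟩ := G.exhaust y h
        rw [hE', hψ]
        rcases (G.edge_mem_star_iff hv).1 hy with ⟨h0, h⟩ | ⟨h1, h⟩
        · rw [← h0, projIcc_of_le_left]
          · rfl
          · simp only [Icc.coe_one]; linarith
        · rw [← h1, projIcc_of_right_le]
          · rfl
          · simp only [Icc.coe_one]; linarith

theorem exists_lift_of_subset_openEdge {e : G.E} {x y : Y} {p : Path x y}
    (hp : range p ⊆ G.openEdge e) :
    ∃ γ : C(unitInterval, unitInterval), ∀ s, p s = G.edge e (γ s) := by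
  have hemb : IsOpenEmbedding fun t : Ioo (0 : unitInterval) 1 => G.edge e t := by
    refine .of_continuous_injective_isOpenMap (by fun_prop) ?_ ?_
    · intro t t' h
      exact Subtype.ext (G.edge_inj e t t.2 e t' t'.2 h).2
    · intro U hU
      have : (fun t : Ioo (0 : unitInterval) 1 => G.edge e t) '' U = G.edge e '' ((↑) '' U) := by
        rw [image_image]
      rw [this]
      refine G.isOpen_edge_image e (isOpen_Ioo.isOpenMap_subtype_val U hU) ?_
      rintro _ ⟨t, -, rfl⟩
      exact t.2
  choose γ hγ hγp using fun s => hp (mem_range_self s)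
  let γ' : unitInterval → Ioo (0 : unitInterval) 1 := fun s => ⟨γ s, hγ s⟩
  have hc : Continuous γ' := by
    rw [hemb.isInducing.continuous_iff]
    have : ((fun t : Ioo (0 : unitInterval) 1 => G.edge e t) ∘ γ') = p := funext hγp
    rw [this]
    exact p.continuous
  exact ⟨⟨fun s => γ' s, by fun_prop⟩, fun s => (hγp s).symm⟩

/-- Paths with the same endpoints inside a star or inside an open edge are homotopic. -/
theorem mk_eq_of_subset_starCover {i : G.V ⊕ G.E} {x y : Y} {p q : Path x y}
    (hp : range p ⊆ G.starCover i) (hq : range q ⊆ G.starCover i) :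
    Path.Homotopic.Quotient.mk p = Path.Homotopic.Quotient.mk q := by
  rcases i with ⟨v, hv⟩ | e
  · obtain ⟨F, hF0, hF1⟩ := G.exists_collapse
    have hx : x ∈ G.star v := hp ⟨0, p.source⟩
    have hy : y ∈ G.star v := hp ⟨1, p.target⟩
    let track : ∀ z ∈ G.star v, Path z v := fun z hz => ⟨F z, hF0 z, hF1 v hv z hz⟩
    have key : ∀ r : Path x y, range r ⊆ G.star v →
        (Path.Homotopic.Quotient.mk r).trans (Path.Homotopic.Quotient.mk (track y hy)) =
        (Path.Homotopic.Quotient.mk (track x hx)).trans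
          (Path.Homotopic.Quotient.mk (Path.refl v)) := by
      intro r hr
      refine trans_eq_trans_of_square ⟨fun a => F (r a.1) a.2, by fun_prop⟩ (fun s => ?_)
        (fun s => ?_) (fun s => ?_) (fun s => ?_)
      · exact (hF0 _).symm
      · change F y s = F (r 1) s
        rw [r.target]
      · change F x s = F (r 0) s
        rw [r.source]
      · exact (hF1 v hv _ (hr (mem_range_self s))).symm
    have := (key p hp).trans (key q hq).symm
    have h2 := congrArg (fun k => k.trans (Path.Homotopic.Quotient.mk (track y hy)).symm) this
    simpa only [trans_assoc, trans_symm, trans_refl] using h2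
  · obtain ⟨p', hp'⟩ := G.exists_lift_of_subset_openEdge hp
    obtain ⟨q', hq'⟩ := G.exists_lift_of_subset_openEdge hq
    have hint : ∀ (r : Path x y) (r' : C(unitInterval, unitInterval)), range r ⊆ G.openEdge e →
        (∀ s, r s = G.edge e (r' s)) → ∀ s, r' s ∈ Ioo (0 : unitInterval) 1 := by
      intro r r' hr hr' s
      obtain ⟨t, ht, h⟩ := hr (mem_range_self s)
      rw [hr'] at h
      rw [← (G.eq_of_edge_eq ht h).2]
      exact ht
    refine mk_eq_of_factors (G.edge e) p' q' hp' hq' ?_ ?_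
    · exact (G.edge_inj e _ (hint p p' hp hp' 0) e _ (hint q q' hq hq' 0)
        (by rw [← hp', ← hq', p.source, q.source])).2
    · exact (G.edge_inj e _ (hint p p' hp hp' 1) e _ (hint q q' hq hq' 1)
        (by rw [← hp', ← hq', p.target, q.target])).2

/-- A path which is constant or runs inside one closed edge. -/
def IsEdgePath {a b : Y} (r : Path a b) : Prop :=
  (∀ s, r s = a) ∨ ∃ e, ∃ γ : C(unitInterval, unitInterval), ∀ s, r s = G.edge e (γ s)

variable {y₀ : Y} {τ : ∀ v, Path.Homotopic.Quotient y₀ v} {H : Subgroup (FundamentalGroup Y y₀)}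

theorem _root_.FundamentalGroup.trans_mem {Y : Type*} [TopologicalSpace Y] {y₀ : Y}
    {H : Subgroup (FundamentalGroup Y y₀)} {a b : Path.Homotopic.Quotient y₀ y₀}
    (ha : a ∈ H) (hb : b ∈ H) : a.trans b ∈ H := H.mul_mem hb ha

theorem _root_.FundamentalGroup.symm_mem {Y : Type*} [TopologicalSpace Y] {y₀ : Y}
    {H : Subgroup (FundamentalGroup Y y₀)} {a : Path.Homotopic.Quotient y₀ y₀}
    (ha : a ∈ H) : a.symm ∈ H := H.inv_mem ha

/-- Closing up an edge path between vertices by the chosen classes of paths from the base point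
gives an element of the subgroup generated by the closed up edges. -/
theorem IsEdgePath.closing_mem
    (hH : ∀ e, ((τ (G.edge e 0)).trans (Path.Homotopic.Quotient.mk (G.path e))).trans
      (τ (G.edge e 1)).symm ∈ H)
    {v w : Y} (hv : v ∈ G.V) (hw : w ∈ G.V) {r : Path v w} (hr : G.IsEdgePath r) :
    ((τ v).trans (Path.Homotopic.Quotient.mk r)).trans (τ w).symm ∈ H := by
  have hone : ∀ v, ((τ v).trans (Path.Homotopic.Quotient.refl v)).trans (τ v).symm ∈ H := by
    intro v
    rw [trans_refl, trans_symm]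
    exact H.one_mem
  rcases hr with hr | ⟨e, γ, hr⟩
  · have hw' : w = v := by rw [← r.target, hr]
    subst hw'
    have : r = Path.refl w := Path.ext (funext hr)
    rw [this]
    exact hone w
  · have hv' : v = G.edge e (γ 0) := by rw [← hr, r.source]
    have hw' : w = G.edge e (γ 1) := by rw [← hr, r.target]
    rcases G.eq_of_edge_mem (hv' ▸ hv) with h0 | h0 <;>
    rcases G.eq_of_edge_mem (hw' ▸ hw) with h1 | h1 <;>
    rw [h0] at hv' <;> rw [h1] at hw' <;> subst hv' hw'
    · rw [mk_eq_of_factors (q := Path.refl _) (G.edge e) γ (.const _ 0) hr (fun s => rfl) h0 h1]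
      exact hone _
    · rw [mk_eq_of_factors (q := G.path e) (G.edge e) γ (.id _) hr (fun s => rfl) h0 h1]
      exact hH e
    · rw [mk_eq_of_factors (q := (G.path e).symm) (G.edge e) γ ⟨unitInterval.symm, by fun_prop⟩ hr
        (fun s => rfl) (by simp [h0]) (by simp [h1])]
      have := FundamentalGroup.symm_mem (hH e)
      rwa [symm_of_trans, symm_of_trans, symm_symm, ← trans_assoc, ← mk_symm] at this
    · rw [mk_eq_of_factors (q := Path.refl _) (G.edge e) γ (.const _ 1) hr (fun s => rfl) h0 h1]
      exact hone _

/-- Whether a class of paths closes up to an element of the subgroup does not depend on the edge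
path through which its endpoint is joined to a vertex. -/
theorem IsEdgePath.closing_mem_of_closing_mem
    (hH : ∀ e, ((τ (G.edge e 0)).trans (Path.Homotopic.Quotient.mk (G.path e))).trans
      (τ (G.edge e 1)).symm ∈ H)
    {v w y : Y} (hv : v ∈ G.V) (hw : w ∈ G.V) {r : Path v y} (hr : G.IsEdgePath r)
    {r' : Path w y} (hr' : G.IsEdgePath r') {h : Path.Homotopic.Quotient y₀ y}
    (hm : (h.trans (Path.Homotopic.Quotient.mk r).symm).trans (τ v).symm ∈ H) :
    (h.trans (Path.Homotopic.Quotient.mk r').symm).trans (τ w).symm ∈ H := by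
  suffices hs : ((τ v).trans ((Path.Homotopic.Quotient.mk r).trans
      (Path.Homotopic.Quotient.mk r').symm)).trans (τ w).symm ∈ H by
    have := FundamentalGroup.trans_mem hm hs
    simpa only [trans_assoc, symm_trans_cancel_left] using this
  by_cases hy : y ∈ G.V
  · have := FundamentalGroup.trans_mem (hr.closing_mem G hH hv hy)
      (FundamentalGroup.symm_mem (hr'.closing_mem G hH hw hy))
    simpa only [symm_of_trans, symm_symm, trans_assoc, symm_trans_cancel_left] using this
  · rcases hr with hr | ⟨e, γ, hr⟩
    · exact absurd hv (by rwa [← hr 1, r.target])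
    rcases hr' with hr' | ⟨e', γ', hr'⟩
    · exact absurd hw (by rwa [← hr' 1, r'.target])
    have h1 : G.edge e (γ 1) = y := by rw [← hr, r.target]
    have h1' : G.edge e' (γ' 1) = y := by rw [← hr', r'.target]
    obtain ⟨rfl, hγ⟩ := G.eq_of_edge_eq (G.mem_Ioo_of_notMem (h1.symm ▸ hy)) (h1.trans h1'.symm)
    rw [← mk_symm, ← mk_trans]
    refine IsEdgePath.closing_mem G hH hv hw (Or.inr ⟨e, ?_⟩)
    let P : Path (γ 0) (γ 1) := ⟨γ, rfl, rfl⟩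
    let P' : Path (γ' 0) (γ 1) := ⟨γ', rfl, hγ.symm⟩
    refine ⟨(P.trans P'.symm).toContinuousMap, fun s => ?_⟩
    change _ = G.edge e ((P.trans P'.symm) s)
    rw [Path.trans_apply, Path.trans_apply]
    split_ifs
    · exact hr _
    · exact hr' _

/-- The fundamental group of a finite graph is generated by its edges, each closed up to a loop by
fixed paths from the base point. -/
theorem subgroup_eq_top (hy₀ : y₀ ∈ G.V) (hτ : τ y₀ = Path.Homotopic.Quotient.refl y₀)
    (hH : ∀ e, ((τ (G.edge e 0)).trans (Path.Homotopic.Quotient.mk (G.path e))).trans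
      (τ (G.edge e 1)).symm ∈ H) : H = ⊤ := by
  -- a class of paths ending inside an edge is closed up by running along the edge to a vertex first
  let C : ∀ y, Path.Homotopic.Quotient y₀ y → Prop := fun y h =>
    ∃ v ∈ G.V, ∃ r : Path v y, G.IsEdgePath r ∧
      (h.trans (Path.Homotopic.Quotient.mk r).symm).trans (τ v).symm ∈ H
  have main : ∀ y h, C y h := by
    refine induction_of_open_cover G.isOpen_starCover G.exists_mem_starCover C ?_ ?_
    · refine ⟨y₀, hy₀, Path.refl y₀, Or.inl fun s => rfl, ?_⟩
      rw [hτ, mk_refl, trans_symm, trans_symm]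
      exact H.one_mem
    · rintro i y y' p hp h ⟨v, hv, r, hr, hm⟩
      rcases i with ⟨w, hw⟩ | e
      · have hstar : ∀ z ∈ G.star w, ∃ q : Path w z, G.IsEdgePath q ∧ range q ⊆ G.star w := by
          rintro z (rfl | ⟨e, t, rfl, ⟨h0, ht⟩ | ⟨h1, ht⟩⟩)
          · exact ⟨Path.refl z, Or.inl fun s => rfl, by rintro _ ⟨s, rfl⟩; exact Or.inl rfl⟩
          · subst h0
            refine ⟨⟨⟨fun s => G.edge e (Icc.convexComb 0 t s), by fun_prop⟩, by simp, by simp⟩,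
              Or.inr ⟨e, ⟨fun s => Icc.convexComb 0 t s, by fun_prop⟩, fun s => rfl⟩, ?_⟩
            rintro _ ⟨s, rfl⟩
            refine Or.inr ⟨e, _, rfl, Or.inl ⟨rfl, ?_⟩⟩
            refine lt_of_le_of_lt ?_ ht
            have h1 := t.2.1
            have h2 := s.2.2
            have : ((Icc.convexComb 0 t s : unitInterval) : ℝ) = s * t := by
              simp [Icc.convexComb]
            rw [this]
            nlinarith
          · subst h1
            refine ⟨⟨⟨fun s => G.edge e (Icc.convexComb 1 t s), by fun_prop⟩, by simp, by simp⟩,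
              Or.inr ⟨e, ⟨fun s => Icc.convexComb 1 t s, by fun_prop⟩, fun s => rfl⟩, ?_⟩
            rintro _ ⟨s, rfl⟩
            refine Or.inr ⟨e, _, rfl, Or.inr ⟨rfl, ?_⟩⟩
            refine lt_of_lt_of_le ht ?_
            have h1 := t.2.2
            have h2 := s.2.2
            have : ((Icc.convexComb 1 t s : unitInterval) : ℝ) = (1 - s) + s * t := by
              simp [Icc.convexComb]
            rw [this]
            nlinarith
        obtain ⟨q, hq, hqs⟩ := hstar y (hp ⟨0, p.source⟩)
        obtain ⟨q', hq', hqs'⟩ := hstar y' (hp ⟨1, p.target⟩)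
        refine ⟨w, hw, q', hq', ?_⟩
        have h1 := IsEdgePath.closing_mem_of_closing_mem G hH hv hw hr hq hm
        have h2 : (Path.Homotopic.Quotient.mk q').symm =
            (Path.Homotopic.Quotient.mk p).symm.trans (Path.Homotopic.Quotient.mk q).symm := by
          rw [← symm_of_trans, ← mk_trans]
          congr 1
          refine G.mk_eq_of_subset_starCover (i := Sum.inl ⟨w, hw⟩) hqs' ?_
          rw [Path.trans_range]
          exact union_subset hqs hp
        rw [h2, trans_assoc, trans_assoc, trans_assoc, trans_symm_cancel_left, ← trans_assoc]
        exact h1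
      · obtain ⟨γ, hγ⟩ := G.exists_lift_of_subset_openEdge hp
        have hy : y ∉ G.V := by
          obtain ⟨t, ht, rfl⟩ := hp ⟨0, p.source⟩
          exact G.edge_notMem e t ht
        rcases hr with hr | ⟨e', γ', hr⟩
        · exact absurd hv (by rwa [← hr 1, r.target])
        have h1 : G.edge e (γ 0) = y := by rw [← hγ, p.source]
        have h1' : G.edge e' (γ' 1) = y := by rw [← hr, r.target]
        obtain ⟨rfl, hγγ⟩ :=
          G.eq_of_edge_eq (G.mem_Ioo_of_notMem (h1.symm ▸ hy)) (h1.trans h1'.symm)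
        refine ⟨v, hv, r.trans p, Or.inr ⟨e, ?_⟩, ?_⟩
        · let P : Path (γ' 0) (γ' 1) := ⟨γ', rfl, rfl⟩
          let P' : Path (γ' 1) (γ 1) := ⟨γ, hγγ, rfl⟩
          refine ⟨(P.trans P').toContinuousMap, fun s => ?_⟩
          change _ = G.edge e ((P.trans P') s)
          rw [Path.trans_apply, Path.trans_apply]
          split_ifs
          · exact hr _
          · exact hγ _
        · rw [mk_trans, symm_of_trans, trans_assoc, trans_assoc, trans_assoc,
            trans_symm_cancel_left, ← trans_assoc]
          exact hm
  rw [eq_top_iff]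
  intro h _
  obtain ⟨v, hv, r, hr, hm⟩ := main y₀ h
  have := IsEdgePath.closing_mem_of_closing_mem G hH hv hy₀ hr
    (r' := Path.refl y₀) (Or.inl fun s => rfl) hm
  rw [hτ, mk_refl] at this
  have hrefl : (Path.Homotopic.Quotient.refl y₀).symm = Path.Homotopic.Quotient.refl y₀ := by
    rw [← mk_refl, ← mk_symm, Path.refl_symm]
  rw [hrefl, trans_refl, trans_refl] at this
  exact this

end GraphStructure

/-! ### Arcs and cycles -/

section Cycles

variable {Y : Type*} [TopologicalSpace Y]

/-- The concatenation of two arcs which meet at most at their ends is injective away from its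
terminal point. -/
theorem Path.injOn_Iio_trans {a b c : Y} {p : Path a b} {q : Path b c}
    (hp : Function.Injective p) (hq : Function.Injective q)
    (hpq : ∀ s t, p s = q t → t = 0 ∨ t = 1) : InjOn (p.trans q) (Iio 1) := by
  have mixed : ∀ s t : unitInterval, s < 1 → t < 1 → (s : ℝ) ≤ 1 / 2 → ¬ (t : ℝ) ≤ 1 / 2 →
      p.trans q s ≠ p.trans q t := by
    intro s t hs ht h1 h2 h
    rw [Path.trans_apply, Path.trans_apply, dif_pos h1, dif_neg h2] at h
    have ht' : (t : ℝ) < 1 := ht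
    rcases hpq _ _ h with h0 | h0
    · have := congrArg Subtype.val h0
      simp only [Icc.coe_zero] at this
      linarith
    · have := congrArg Subtype.val h0
      simp only [Icc.coe_one] at this
      linarith
  intro s hs t ht h
  by_cases h1 : (s : ℝ) ≤ 1 / 2 <;> by_cases h2 : (t : ℝ) ≤ 1 / 2
  · rw [Path.trans_apply, Path.trans_apply, dif_pos h1, dif_pos h2] at h
    have := congrArg Subtype.val (hp h)
    exact Subtype.ext (by simp only at this; linarith)
  · exact absurd h (mixed s t hs ht h1 h2)
  · exact absurd h.symm (mixed t s ht hs h2 h1)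
  · rw [Path.trans_apply, Path.trans_apply, dif_neg h1, dif_neg h2] at h
    have := congrArg Subtype.val (hq h)
    exact Subtype.ext (by simp only at this; linarith)

theorem Path.injective_trans {a b c : Y} {p : Path a b} {q : Path b c}
    (hp : Function.Injective p) (hq : Function.Injective q)
    (hpq : ∀ s t, p s = q t → t = 0) : Function.Injective (p.trans q) := by
  have hc : ∀ t, p.trans q t = c → t = 1 := by
    intro t ht
    rw [Path.trans_apply] at ht
    split_ifs at ht with h
    · exact absurd (hpq _ 1 (ht.trans q.target.symm)) one_ne_zero
    · have := congrArg Subtype.val (hq (ht.trans q.target.symm))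
      simp only [Icc.coe_one] at this
      exact Subtype.ext (by simp only [Icc.coe_one]; linarith)
  intro s t h
  rcases eq_or_lt_of_le (unitInterval.le_one' : s ≤ 1) with rfl | hs
  · exact (hc t (h.symm.trans (Path.target _))).symm
  rcases eq_or_lt_of_le (unitInterval.le_one' : t ≤ 1) with rfl | ht
  · exact hc s (h.trans (Path.target _))
  exact Path.injOn_Iio_trans hp hq (fun s t h => Or.inl (hpq s t h)) hs ht h

/-- The range of a simple closed path is a cycle. -/
theorem isCycle_range [T2Space Y] {a : Y} {p : Path a a} (hp : InjOn p (Iio 1)) :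
    IsCycle (range p) := by
  have : Fact ((0 : ℝ) < 1) := ⟨one_pos⟩
  let g : AddCircle (1 : ℝ) → Y := AddCircle.liftIco 1 0 p.extend
  have hg : Continuous g :=
    AddCircle.liftIco_zero_continuous (by simp) p.continuous_extend.continuousOn
  have hval : ∀ t : ℝ, ∀ ht : t ∈ Ico (0 : ℝ) 1, g t = p ⟨t, ht.1, ht.2.le⟩ := fun t ht =>
    (AddCircle.liftIco_zero_coe_apply ht).trans (Path.extend_apply p ⟨ht.1, ht.2.le⟩)
  have hrep : ∀ z : AddCircle (1 : ℝ), ∃ t ∈ Ico (0 : ℝ) 1, (t : AddCircle (1 : ℝ)) = z := by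
    intro z
    have := AddCircle.coe_image_Ico_eq (1 : ℝ) 0
    rw [zero_add] at this
    have hz : z ∈ (univ : Set (AddCircle (1 : ℝ))) := mem_univ z
    rwa [← this] at hz
  have hinj : Function.Injective g := by
    intro z w h
    obtain ⟨s, hs, rfl⟩ := hrep z
    obtain ⟨t, ht, rfl⟩ := hrep w
    rw [hval s hs, hval t ht] at h
    have := hp (show (⟨s, _⟩ : unitInterval) < 1 from hs.2)
      (show (⟨t, _⟩ : unitInterval) < 1 from ht.2) h
    rw [Subtype.mk.inj this]
  have hrange : range g = range p := by
    refine Subset.antisymm ?_ ?_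
    · rintro _ ⟨z, rfl⟩
      obtain ⟨s, hs, rfl⟩ := hrep z
      exact ⟨_, (hval s hs).symm⟩
    · rintro _ ⟨s, rfl⟩
      rcases eq_or_lt_of_le (unitInterval.le_one' : s ≤ 1) with rfl | hs
      · refine ⟨(0 : ℝ), ?_⟩
        rw [hval 0 ⟨le_rfl, one_pos⟩, p.target]
        exact p.source
      · exact ⟨(s : ℝ), hval s ⟨s.2.1, hs⟩⟩
  rw [← hrange]
  exact ⟨(hg.isClosedEmbedding hinj).isEmbedding.toHomeomorph.symm.trans
    (AddCircle.homeomorphCircle one_ne_zero)⟩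

namespace IsCycle

variable {S : Set Y}

theorem isCompact (hS : IsCycle S) : IsCompact S := by
  obtain ⟨h⟩ := hS
  have := h.symm.compactSpace
  exact isCompact_iff_compactSpace.2 inferInstance

theorem isPreconnected (hS : IsCycle S) : IsPreconnected S := by
  obtain ⟨h⟩ := hS
  have : ConnectedSpace S := h.symm.surjective.connectedSpace h.symm.continuous
  exact isPreconnected_iff_preconnectedSpace.2 inferInstance

theorem nontrivial (hS : IsCycle S) : S.Nontrivial := by
  obtain ⟨h⟩ := hS
  obtain ⟨z, hz⟩ := (Circle.isPathConnected_compl_singleton 1).nonempty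
  have : Nontrivial Circle := ⟨⟨z, 1, hz⟩⟩
  have : Nontrivial S := h.toEquiv.nontrivial
  exact nontrivial_coe_sort.1 this

theorem isPreconnected_diff_singleton (hS : IsCycle S) {x : Y} (hx : x ∈ S) :
    IsPreconnected (S \ {x}) := by
  obtain ⟨h⟩ := hS
  have := (Circle.isPathConnected_compl_singleton (h ⟨x, hx⟩)).isConnected.isPreconnected.image
    (fun z => (h.symm z : Y)) (by fun_prop)
  convert this using 1
  ext y
  constructor
  · rintro ⟨hy, hyx⟩
    refine ⟨h ⟨y, hy⟩, fun he => hyx ?_, by simp⟩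
    exact congrArg Subtype.val (h.injective he)
  · rintro ⟨z, hz, rfl⟩
    refine ⟨(h.symm z).2, fun he => hz ?_⟩
    rw [mem_singleton_iff, ← h.apply_symm_apply z]
    congr 1
    exact Subtype.ext he

theorem exists_mem_ne [T1Space Y] (hS : IsCycle S) {x : Y} (hx : x ∈ S) {U : Set Y}
    (hU : IsOpen U) (hxU : x ∈ U) : ∃ y ∈ S, y ∈ U ∧ y ≠ x := by
  have := accPt_iff_nhds.1 (hS.isPreconnected.preperfect_of_nontrivial hS.nontrivial x hx) U
    (hU.mem_nhds hxU)
  obtain ⟨y, ⟨hyU, hyS⟩, hne⟩ := this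
  exact ⟨y, hyS, hyU, hne⟩

theorem subset_closure_diff [T1Space Y] (hS : IsCycle S) {V : Set Y} (hV : V.Finite) :
    S ⊆ closure (S \ V) := by
  intro x hx
  rw [mem_closure_iff]
  intro U hU hxU
  obtain ⟨y, hyS, hyU, hne⟩ := hS.exists_mem_ne hx
    (hU.sdiff (hV.subset (sdiff_subset : V \ {x} ⊆ V)).isClosed) ⟨hxU, fun h => h.2 rfl⟩
  exact ⟨y, hyU.1, hyS, fun h => hyU.2 ⟨h, hne⟩⟩

/-- Let `c` be an open arc in a space. A cycle cannot end along the arc to the right of one of its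
points: if it did, a whole neighbourhood of the end would split off after removing a point. -/
theorem mem_of_lt [T2Space Y] (hS : IsCycle S) {c : C(unitInterval, Y)}
    (hopen : ∀ a b, IsOpen (c '' Ioo a b)) (hinj : InjOn c (Ioo 0 1)) {t s : unitInterval}
    (ht : c t ∈ S) (h0 : 0 < t) (hts : t < s) (h1 : s < 1) : c s ∈ S := by
  by_contra hs
  let J : Set unitInterval := Icc t s ∩ c ⁻¹' S
  have hJ : IsCompact J :=
    isCompact_Icc.inter_right (hS.isCompact.isClosed.preimage c.continuous)
  obtain ⟨u, hu, hmax⟩ := hJ.exists_isGreatest ⟨t, ⟨le_rfl, hts.le⟩, ht⟩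
  have hus : u < s := lt_of_le_of_ne hu.1.2 fun h => hs (h ▸ hu.2)
  have hu0 : 0 < u := h0.trans_le hu.1.1
  -- `u` is the last parameter whose point lies on the cycle, so points nearby precede it
  have near : ∀ a, a < u → 0 ≤ a → ∃ r, a < r ∧ r < u ∧ c r ∈ S := by
    intro a ha h0a
    obtain ⟨y, hyS, ⟨r, hr, rfl⟩, hne⟩ := hS.exists_mem_ne hu.2 (hopen a s) ⟨u, ⟨ha, hus⟩, rfl⟩
    refine ⟨r, hr.1, ?_, hyS⟩
    rcases lt_trichotomy r u with h | h | h
    · exact h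
    · exact absurd (h ▸ rfl) hne
    · exact absurd (hmax ⟨⟨hu.1.1.trans h.le, hr.2.le⟩, hyS⟩) (not_le.2 h)
  have key : ∀ r, 0 < r → r < u → c r ∈ S → S \ {c r} ⊆ c '' Ioo r s := by
    intro r hr0 hru hrS
    refine (hS.isPreconnected_diff_singleton hrS).subset_left_of_subset_union
      (hopen r s)
      (isCompact_Icc.image c.continuous : IsCompact (c '' Icc r s)).isClosed.isOpen_compl
      (disjoint_compl_right.mono_left (image_mono Ioo_subset_Icc_self)) ?_ ?_
    · rintro y ⟨hyS, hyr⟩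
      by_cases hy : y ∈ c '' Icc r s
      · obtain ⟨q, hq, rfl⟩ := hy
        refine Or.inl ⟨q, ⟨lt_of_le_of_ne hq.1 ?_, lt_of_le_of_ne hq.2 ?_⟩, rfl⟩
        · rintro rfl; exact hyr rfl
        · rintro rfl; exact hs hyS
      · exact Or.inr hy
    · refine ⟨c u, ⟨hu.2, fun h => ?_⟩, u, ⟨hru, hus⟩, rfl⟩
      exact hru.ne' (hinj ⟨hu0, hus.trans h1⟩ ⟨hr0, (hru.trans hus).trans h1⟩ h)
  obtain ⟨r, hr0, hru, hrS⟩ := near 0 hu0 le_rfl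
  obtain ⟨r', hr', hru', hrS'⟩ := near r hru hr0.le
  have hr1 : r ∈ Ioo (0 : unitInterval) 1 := ⟨hr0, (hru.trans hus).trans h1⟩
  obtain ⟨q, hq, hqr⟩ := key r' (hr0.trans hr') hru' hrS' ⟨hrS, fun h =>
    hr'.ne (hinj hr1 ⟨hr0.trans hr', (hru'.trans hus).trans h1⟩ h)⟩
  have := hinj ⟨(hr0.trans hr').trans hq.1, hq.2.trans h1⟩ hr1 hqr
  exact absurd (this ▸ hq.1) (not_lt.2 hr'.le)

end IsCycle

/-- A preconnected set stays preconnected when a point is removed, if some punctured neighbourhood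
of the point lies in a preconnected subset. -/
theorem IsPreconnected.diff_singleton_of_subset [T1Space Y] {A J O : Set Y} {w : Y}
    (hA : IsPreconnected A) (hJ : IsPreconnected J) (hJA : J ⊆ A \ {w}) (hO : IsOpen O)
    (hwO : w ∈ O) (hOJ : O \ {w} ⊆ J) : IsPreconnected (A \ {w}) := by
  by_cases hwA : w ∈ A
  swap
  · rwa [sdiff_singleton_eq_self hwA]
  have main : ∀ U V : Set Y, IsOpen U → IsOpen V → A \ {w} ⊆ U ∪ V → (A \ {w} ∩ V).Nonempty →
      A \ {w} ∩ (U ∩ V) = ∅ → J ⊆ U → False := by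
    intro U V hU hV hsub hne hdisj hJU
    have hcov : A ⊆ (U ∪ O) ∪ V \ {w} := fun y hy => by
      by_cases hyw : y = w
      · exact Or.inl (Or.inr (hyw ▸ hwO))
      · rcases hsub ⟨hy, hyw⟩ with h | h
        · exact Or.inl (Or.inl h)
        · exact Or.inr ⟨h, hyw⟩
    obtain ⟨z, hzA, hzUO, hzV, hzw⟩ := hA (U ∪ O) (V \ {w}) (hU.union hO)
      (hV.sdiff isClosed_singleton) hcov ⟨w, hwA, Or.inr hwO⟩
      (by obtain ⟨y, hy, hyV⟩ := hne; exact ⟨y, hy.1, hyV, hy.2⟩)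
    have hzU : z ∈ U := hzUO.elim id fun h => hJU (hOJ ⟨h, hzw⟩)
    exact eq_empty_iff_forall_notMem.1 hdisj z ⟨⟨hzA, hzw⟩, hzU, hzV⟩
  intro U V hU hV hsub hUne hVne
  by_contra hdisj
  rw [not_nonempty_iff_eq_empty] at hdisj
  rcases isPreconnected_iff_subset_of_disjoint.1 hJ U V hU hV (hJA.trans hsub)
    (by rw [← subset_empty_iff, ← hdisj]; exact inter_subset_inter_left _ hJA) with h | h
  · exact main U V hU hV hsub hVne hdisj h
  · exact main V U hV hU (by rwa [union_comm]) hUne (by rwa [inter_comm V]) h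

end Cycles

/-! ### Spanning trees -/

namespace GraphStructure

open Path.Homotopic.Quotient

universe u

variable {Y : Type u} [TopologicalSpace Y] [T2Space Y] (G : GraphStructure Y)

/-- The union of a set of vertices and of the closed edges in a set of edges. -/
def subgraph (S : Set Y) (T : Set G.E) : Set Y := S ∪ ⋃ e ∈ T, range (G.edge e)

theorem subgraph_mono {S S' : Set Y} {T T' : Set G.E} (hS : S ⊆ S') (hT : T ⊆ T') :
    G.subgraph S T ⊆ G.subgraph S' T' :=
  union_subset_union hS (biUnion_subset_biUnion_left hT)

theorem range_subset_subgraph {S : Set Y} {T : Set G.E} {e : G.E} (he : e ∈ T) :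
    range (G.edge e) ⊆ G.subgraph S T :=
  (subset_biUnion_of_mem (u := fun e => range (G.edge e)) he).trans subset_union_right

theorem mem_of_mem_subgraph {S : Set Y} {T : Set G.E}
    (hT : ∀ e ∈ T, G.edge e 0 ∈ S ∧ G.edge e 1 ∈ S) {v : Y} (hv : v ∈ G.V)
    (h : v ∈ G.subgraph S T) : v ∈ S := by
  rcases h with h | h
  · exact h
  · obtain ⟨e, he, t, rfl⟩ := mem_iUnion₂.1 h
    rcases G.eq_of_edge_mem hv with rfl | rfl
    · exact (hT e he).1
    · exact (hT e he).2

/-- An edge which does not belong to a subgraph meets it at most in its ends. -/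
theorem eq_of_edge_mem_subgraph {S : Set Y} (hS : S ⊆ G.V) {T : Set G.E} {e : G.E} (he : e ∉ T)
    {t : unitInterval} (h : G.edge e t ∈ G.subgraph S T) : t = 0 ∨ t = 1 := by
  rcases h with h | h
  · exact G.eq_of_edge_mem (hS h)
  · obtain ⟨e', he', t', h⟩ := mem_iUnion₂.1 h
    by_contra hne
    push Not at hne
    exact he ((G.eq_of_edge_eq ⟨lt_of_le_of_ne t.2.1 hne.1.symm, lt_of_le_of_ne t.2.2 hne.2⟩
      h.symm).1 ▸ he')

theorem injective_edge {e : G.E} (h : G.edge e 0 ≠ G.edge e 1) :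
    Function.Injective (G.edge e) := by
  intro s t hst
  by_cases hs : G.edge e s ∈ G.V
  · have ht : G.edge e t ∈ G.V := hst ▸ hs
    rcases G.eq_of_edge_mem hs with rfl | rfl <;> rcases G.eq_of_edge_mem ht with rfl | rfl
    · rfl
    · exact absurd hst h
    · exact absurd hst.symm h
    · rfl
  · exact (G.eq_of_edge_eq (G.mem_Ioo_of_notMem hs) hst).2

/-- If a set of vertices of a connected graph is neither empty nor everything, some edge leaves
it. -/
theorem exists_edge_leaving [PreconnectedSpace Y] {S : Set Y} {y₀ v : Y} (hy₀V : y₀ ∈ G.V)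
    (hy₀ : y₀ ∈ S) (hv : v ∈ G.V) (hvS : v ∉ S) :
    ∃ e, (G.edge e 0 ∈ S ∧ G.edge e 1 ∉ S) ∨ (G.edge e 1 ∈ S ∧ G.edge e 0 ∉ S) := by
  classical
  by_contra! hno
  have hiff : ∀ e, G.edge e 0 ∈ S ↔ G.edge e 1 ∈ S := fun e =>
    ⟨fun h => by_contra fun h' => h' ((hno e).1 h), fun h => by_contra fun h' => h' ((hno e).2 h)⟩
  obtain ⟨F, hV, -⟩ := G.exists_lift (Z := Bool) (fun y => decide (y ∈ S))
    (fun e => ContinuousMap.const _ (decide (G.edge e 0 ∈ S))) (fun e => rfl)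
    (fun e => by simp [hiff e])
  have := PreconnectedSpace.constant ‹_› F.continuous (x := y₀) (y := v)
  rw [hV _ hy₀V, hV _ hv] at this
  simp [hy₀, hvS] at this

/-- A connected graph has a spanning tree: a set `T` of edges such that any two vertices are joined
by an arc running through edges in `T`, together with classes of paths `τ` from the base point which
are compatible with the edges in `T`. -/
theorem exists_spanning_tree [PathConnectedSpace Y] {y₀ : Y} (hy₀ : y₀ ∈ G.V) :
    ∃ (T : Set G.E) (τ : ∀ v, Path.Homotopic.Quotient y₀ v),
      τ y₀ = Path.Homotopic.Quotient.refl y₀ ∧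
      (∀ e ∈ T, (τ (G.edge e 0)).trans (Path.Homotopic.Quotient.mk (G.path e)) =
        τ (G.edge e 1)) ∧
      ∀ v ∈ G.V, ∀ w ∈ G.V, v ≠ w →
        ∃ γ : Path v w, Function.Injective γ ∧ range γ ⊆ G.subgraph G.V T := by
  classical
  let Good : Set Y → Prop := fun S => ∃ (T : Set G.E) (τ : ∀ v, Path.Homotopic.Quotient y₀ v),
      τ y₀ = Path.Homotopic.Quotient.refl y₀ ∧
      (∀ e ∈ T, (τ (G.edge e 0)).trans (Path.Homotopic.Quotient.mk (G.path e)) =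
        τ (G.edge e 1)) ∧
      (∀ e ∈ T, G.edge e 0 ∈ S ∧ G.edge e 1 ∈ S) ∧
      ∀ v ∈ S, ∀ w ∈ S, v ≠ w →
        ∃ γ : Path v w, Function.Injective γ ∧ range γ ⊆ G.subgraph S T
  have hfin : {S | S ⊆ G.V ∧ y₀ ∈ S ∧ Good S}.Finite :=
    G.finite_V.finite_subsets.subset fun S hS => hS.1
  have hbase : Good {y₀} := by
    let τ₀ : ∀ v, Path.Homotopic.Quotient y₀ v := fun v =>
      Path.Homotopic.Quotient.mk (PathConnectedSpace.somePath y₀ v)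
    refine ⟨∅, Function.update τ₀ y₀ (Path.Homotopic.Quotient.refl y₀),
      Function.update_self _ _ _, fun e he => he.elim, fun e he => he.elim, ?_⟩
    rintro v rfl w rfl hne
    exact absurd rfl hne
  obtain ⟨S, ⟨hSV, hyS, T, τ, hτ, hτT, hT, harc⟩, hmax⟩ := hfin.exists_maximal
    ⟨{y₀}, singleton_subset_iff.2 hy₀, rfl, hbase⟩
  -- adding a leaf `w` attached to `v` by an edge `e` with an arc `ρ` along it
  have step : ∀ (e : G.E) (v w : Y) (ρ : Path v w), v ∈ S → w ∈ G.V → w ∉ S → e ∉ T →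
      Function.Injective ρ → range ρ = range (G.edge e) →
      (G.edge e 0 = v ∧ G.edge e 1 = w ∨ G.edge e 0 = w ∧ G.edge e 1 = v) →
      (∀ τ' : ∀ v, Path.Homotopic.Quotient y₀ v, τ' v = τ v →
        τ' w = (τ v).trans (Path.Homotopic.Quotient.mk ρ) →
        (τ' (G.edge e 0)).trans (Path.Homotopic.Quotient.mk (G.path e)) = τ' (G.edge e 1)) →
      False := by
    intro e v w ρ hv hw hwS heT hρ hρe hends hτ'
    have hvw : v ≠ w := ne_of_mem_of_not_mem hv hwS
    have hup : ∀ u ∈ S, ∀ a, Function.update τ w a u = τ u := fun u hu a =>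
      Function.update_of_ne (ne_of_mem_of_not_mem hu hwS) _ _
    have hSw : S ⊆ insert w S := subset_insert _ _
    have hTe : T ⊆ insert e T := subset_insert _ _
    have key : ∀ u ∈ S, ∃ γ : Path u w, Function.Injective γ ∧
        range γ ⊆ G.subgraph (insert w S) (insert e T) := by
      intro u hu
      have hρsub : range ρ ⊆ G.subgraph (insert w S) (insert e T) := by
        rw [hρe]
        exact G.range_subset_subgraph (mem_insert _ _)
      by_cases huv : u = v
      · subst huv
        exact ⟨ρ, hρ, hρsub⟩
      obtain ⟨γ, hγ, hγsub⟩ := harc u hu v hv huv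
      refine ⟨γ.trans ρ, Path.injective_trans hγ hρ fun s t hst => ?_, ?_⟩
      · have hmem : γ s ∈ G.subgraph S T := hγsub ⟨s, rfl⟩
        have hend : ρ t = v ∨ ρ t = w := by
          have hr : ρ t ∈ range (G.edge e) := by
            rw [← hρe]
            exact mem_range_self t
          obtain ⟨r, hr⟩ := hr
          rcases G.eq_of_edge_mem_subgraph hSV heT (t := r) (by rw [hr, ← hst]; exact hmem)
            with rfl | rfl
          · rcases hends with h | h
            · exact Or.inl (hr.symm.trans h.1)
            · exact Or.inr (hr.symm.trans h.1)
          · rcases hends with h | h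
            · exact Or.inr (hr.symm.trans h.2)
            · exact Or.inl (hr.symm.trans h.2)
        rcases hend with h | h
        · exact hρ (h.trans ρ.source.symm)
        · rw [hst, h] at hmem
          exact absurd (G.mem_of_mem_subgraph hT hw hmem) hwS
      · rw [Path.trans_range]
        exact union_subset (hγsub.trans (G.subgraph_mono hSw hTe)) hρsub
    have hgood : Good (insert w S) := by
      refine ⟨insert e T, Function.update τ w ((τ v).trans (Path.Homotopic.Quotient.mk ρ)),
        ?_, ?_, ?_, ?_⟩
      · rw [hup _ hyS, hτ]
      · rintro e' (rfl | he')
        · exact hτ' _ (hup v hv _) (Function.update_self _ _ _)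
        · rw [hup _ (hT e' he').1, hup _ (hT e' he').2, hτT e' he']
      · rintro e' (rfl | he')
        · rcases hends with h | h
          · rw [h.1, h.2]
            exact ⟨hSw hv, mem_insert _ _⟩
          · rw [h.1, h.2]
            exact ⟨mem_insert _ _, hSw hv⟩
        · exact ⟨hSw (hT e' he').1, hSw (hT e' he').2⟩
      · rintro a (rfl | ha) b (rfl | hb) hab
        · exact absurd rfl hab
        · obtain ⟨γ, hγ, hγs⟩ := key b hb
          refine ⟨γ.symm, hγ.comp unitInterval.symm_bijective.injective, ?_⟩
          rwa [Path.symm_range]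
        · exact key a ha
        · obtain ⟨γ, hγ, hγs⟩ := harc a ha b hb hab
          exact ⟨γ, hγ, hγs.trans (G.subgraph_mono hSw hTe)⟩
    exact hwS (hmax ⟨insert_subset hw hSV, hSw hyS, hgood⟩ hSw (mem_insert _ _))
  have hVS : G.V ⊆ S := by
    intro v hv
    by_contra hvS
    obtain ⟨e, ⟨h0, h1⟩ | ⟨h1, h0⟩⟩ := G.exists_edge_leaving hy₀ hyS hv hvS
    · refine step e _ _ (G.path e) h0 (G.edge_one e) h1 (fun h => h1 (hT e h).2)
        (G.injective_edge fun h => h1 (h ▸ h0)) rfl (Or.inl ⟨rfl, rfl⟩) fun τ' hv hw => ?_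
      rw [hv, hw]
    · refine step e _ _ (G.path e).symm h1 (G.edge_zero e) h0 (fun h => h0 (hT e h).1)
        ((G.injective_edge fun h => h0 (h ▸ h1)).comp unitInterval.symm_bijective.injective) ?_
        (Or.inr ⟨rfl, rfl⟩) fun τ' hv hw => ?_
      · rw [Path.symm_range]
        rfl
      · rw [hv, hw, mk_symm, trans_assoc, symm_trans, trans_refl]
  obtain rfl : S = G.V := Subset.antisymm hSV hVS
  exact ⟨T, τ, hτ, hτT, harc⟩

/-- An edge outside a spanning tree closes up to a cycle. -/
theorem exists_isCycle {T : Set G.E}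
    (harc : ∀ v ∈ G.V, ∀ w ∈ G.V, v ≠ w →
      ∃ γ : Path v w, Function.Injective γ ∧ range γ ⊆ G.subgraph G.V T) {e : G.E} (he : e ∉ T) :
    ∃ S : Set Y, IsCycle S := by
  by_cases h : G.edge e 0 = G.edge e 1
  · refine ⟨_, isCycle_range (p := (G.path e).cast rfl h) ?_⟩
    intro s hs t ht hst
    change G.edge e s = G.edge e t at hst
    by_cases hv : G.edge e s ∈ G.V
    · have hv' : G.edge e t ∈ G.V := hst ▸ hv
      rw [(G.eq_of_edge_mem hv).resolve_right (ne_of_lt hs),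
        (G.eq_of_edge_mem hv').resolve_right (ne_of_lt ht)]
    · exact (G.eq_of_edge_eq (G.mem_Ioo_of_notMem hv) hst).2
  · obtain ⟨γ, hγ, hγs⟩ := harc _ (G.edge_one e) _ (G.edge_zero e) (Ne.symm h)
    refine ⟨_, isCycle_range (p := (G.path e).trans γ)
      (Path.injOn_Iio_trans (G.injective_edge h) hγ fun s t hst => ?_)⟩
    change G.edge e s = γ t at hst
    rcases G.eq_of_edge_mem_subgraph Subset.rfl he (hst ▸ hγs ⟨t, rfl⟩) with rfl | rfl
    · exact Or.inr (hγ (hst.symm.trans γ.target.symm))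
    · exact Or.inl (hγ (hst.symm.trans γ.source.symm))

theorem nonempty_V [Nonempty Y] : G.V.Nonempty := by
  by_contra h
  rw [not_nonempty_iff_eq_empty] at h
  obtain ⟨y⟩ := ‹Nonempty Y›
  obtain ⟨e, -⟩ := G.exhaust y (h ▸ notMem_empty y)
  exact (h ▸ G.edge_zero e : G.edge e 0 ∈ (∅ : Set Y))

/-- A connected finite graph without cycles is simply connected. -/
theorem simplyConnectedSpace (G : GraphStructure Y) [PathConnectedSpace Y]
    (hS : ∀ S : Set Y, ¬ IsCycle S) : SimplyConnectedSpace Y := by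
  obtain ⟨y₀, hy₀⟩ := G.nonempty_V
  obtain ⟨T, τ, hτ, hτT, harc⟩ := G.exists_spanning_tree hy₀
  have hT : ∀ e, e ∈ T := fun e => by
    by_contra he
    obtain ⟨S, h⟩ := G.exists_isCycle harc he
    exact hS S h
  have htop : (⊥ : Subgroup (FundamentalGroup Y y₀)) = ⊤ := by
    refine G.subgroup_eq_top hy₀ hτ fun e => ?_
    rw [hτT e (hT e), trans_symm]
    exact one_mem (⊥ : Subgroup (FundamentalGroup Y y₀))
  have hsub : Subsingleton (FundamentalGroup Y y₀) :=
    Subgroup.subsingleton_iff.1 (subsingleton_of_bot_eq_top htop)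
  rw [simply_connected_iff_loops_nullhomotopic]
  refine ⟨inferInstance, fun {x} γ => ?_⟩
  have : Subsingleton (FundamentalGroup Y x) :=
    (FundamentalGroup.fundamentalGroupMulEquivOfPathConnected y₀ x).symm.injective.subsingleton
  exact Path.Homotopic.Quotient.exact (this.elim (Path.Homotopic.Quotient.mk γ)
    (Path.Homotopic.Quotient.mk (Path.refl x)))

/-! ### Graphs which any two interior points of edges disconnect -/

/-- If any two points inside the edges of a graph disconnect it, then at most one edge lies outside
a spanning tree. -/
theorem eq_of_notMem_spanning_tree
    (hD : ∀ z ∉ G.V, ∀ w ∉ G.V, z ≠ w → ¬ IsPreconnected ({z, w}ᶜ : Set Y)) {T : Set G.E} {y₀ : Y}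
    (hy₀ : y₀ ∈ G.V)
    (harc : ∀ v ∈ G.V, ∀ w ∈ G.V, v ≠ w →
      ∃ γ : Path v w, Function.Injective γ ∧ range γ ⊆ G.subgraph G.V T)
    {e e' : G.E} (he : e ∉ T) (he' : e' ∉ T) : e = e' := by
  by_contra hne
  -- The midpoints of the two edges do not disconnect: everything is joined to `y₀` by the tree.
  let m : unitInterval := ⟨1 / 2, by norm_num, by norm_num⟩
  have hm : m ∈ Ioo (0 : unitInterval) 1 := by
    constructor <;> rw [← Subtype.coe_lt_coe] <;> simp only [m] <;> norm_num
  have hmem : ∀ d : G.E, ∀ t : unitInterval, G.edge d t ∈ ({G.edge e m, G.edge e' m} : Set Y) →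
      d ∉ T ∧ t = m := by
    rintro d t (h | h)
    · obtain ⟨rfl, rfl⟩ := G.eq_of_edge_eq hm h.symm
      exact ⟨he, rfl⟩
    · obtain ⟨rfl, rfl⟩ := G.eq_of_edge_eq hm (mem_singleton_iff.1 h).symm
      exact ⟨he', rfl⟩
  have hsubV : G.V ⊆ ({G.edge e m, G.edge e' m} : Set Y)ᶜ := by
    rintro v hv (rfl | h)
    · exact G.edge_notMem e m hm hv
    · exact G.edge_notMem e' m hm (mem_singleton_iff.1 h ▸ hv)
  have hsub : G.subgraph G.V T ⊆ ({G.edge e m, G.edge e' m} : Set Y)ᶜ := by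
    refine union_subset hsubV ?_
    rintro y hy hy'
    obtain ⟨d, hd, t, rfl⟩ := mem_iUnion₂.1 hy
    exact (hmem d t hy').1 hd
  have hvert : ∀ v ∈ G.V, ∃ A : Set Y, A ⊆ ({G.edge e m, G.edge e' m} : Set Y)ᶜ ∧ y₀ ∈ A ∧ v ∈ A ∧
      IsPreconnected A := by
    intro v hv
    by_cases h : y₀ = v
    · subst h
      exact ⟨{y₀}, singleton_subset_iff.2 (hsubV hv), rfl, rfl, isPreconnected_singleton⟩
    · obtain ⟨γ, -, hγs⟩ := harc _ hy₀ _ hv h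
      exact ⟨range γ, hγs.trans hsub, ⟨0, γ.source⟩, ⟨1, γ.target⟩,
        isPreconnected_range γ.continuous⟩
  -- half an edge joins each point to a vertex
  have hhalf : ∀ v ∈ G.V, ∀ d, ∀ s t : unitInterval, ∀ I : Set unitInterval,
      _root_.IsPreconnected I →
      s ∈ I → t ∈ I → G.edge d s = v →
      (m ∈ I → G.edge d m ∉ ({G.edge e m, G.edge e' m} : Set Y)) →
      ∃ A : Set Y, A ⊆ ({G.edge e m, G.edge e' m} : Set Y)ᶜ ∧ y₀ ∈ A ∧ G.edge d t ∈ A ∧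
        IsPreconnected A := by
    rintro _ hv d s t I hI hs ht rfl hd
    obtain ⟨A, hA, hyA, hvA, hAp⟩ := hvert _ hv
    refine ⟨A ∪ G.edge d '' I, union_subset hA ?_, Or.inl hyA, Or.inr ⟨t, ht, rfl⟩,
      hAp.union _ hvA ⟨s, hs, rfl⟩ (hI.image _ (G.edge d).continuous.continuousOn)⟩
    rintro _ ⟨r, hr, rfl⟩ h
    obtain ⟨-, rfl⟩ := hmem d r h
    exact hd hr h
  refine hD _ (G.edge_notMem e m hm) _ (G.edge_notMem e' m hm)
    (fun h => hne (G.eq_of_edge_eq hm h).1) (isPreconnected_of_forall y₀ fun y hy => ?_)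
  by_cases hyV : y ∈ G.V
  · exact hvert y hyV
  obtain ⟨d, t, ht, rfl⟩ := G.exhaust y hyV
  by_cases hd : G.edge d m ∈ ({G.edge e m, G.edge e' m} : Set Y)
  swap
  · exact hhalf _ (G.edge_zero d) d 0 t univ isPreconnected_univ trivial trivial rfl fun _ => hd
  rcases lt_trichotomy t m with h | h | h
  · exact hhalf _ (G.edge_zero d) d 0 t (Icc 0 t) isPreconnected_Icc ⟨le_rfl, ht.1.le⟩
      ⟨ht.1.le, le_rfl⟩ rfl fun hmI => absurd hmI.2 (not_le.2 h)
  · exact absurd hd (h ▸ hy)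
  · exact hhalf _ (G.edge_one d) d 1 t (Icc t 1) isPreconnected_Icc ⟨ht.2.le, le_rfl⟩
      ⟨le_rfl, ht.2.le⟩ rfl fun hmI => absurd hmI.1 (not_le.2 h)

/-- If any two points inside the edges of a graph disconnect it, then its fundamental group is
cyclic. -/
theorem isCyclic_fundamentalGroup [PathConnectedSpace Y]
    (hD : ∀ z ∉ G.V, ∀ w ∉ G.V, z ≠ w → ¬ IsPreconnected ({z, w}ᶜ : Set Y)) (y : Y) :
    IsCyclic (FundamentalGroup Y y) := by
  obtain ⟨y₀, hy₀⟩ := G.nonempty_V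
  obtain ⟨T, τ, hτ, hτT, harc⟩ := G.exists_spanning_tree hy₀
  have hcyc : IsCyclic (FundamentalGroup Y y₀) := by
    let l : G.E → FundamentalGroup Y y₀ := fun e =>
      ((τ (G.edge e 0)).trans (Path.Homotopic.Quotient.mk (G.path e))).trans (τ (G.edge e 1)).symm
    have hl : ∀ e ∈ T, l e = 1 := fun e he => by
      change ((τ (G.edge e 0)).trans _).trans _ = _
      rw [hτT e he, trans_symm]
      rfl
    obtain ⟨g, hg⟩ : ∃ g, ∀ e, l e ∈ Subgroup.zpowers g := by
      by_cases h : ∃ e, e ∉ T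
      · obtain ⟨e, he⟩ := h
        refine ⟨l e, fun e' => ?_⟩
        by_cases he' : e' ∈ T
        · rw [hl e' he']
          exact one_mem _
        · rw [G.eq_of_notMem_spanning_tree hD hy₀ harc he' he]
          exact Subgroup.mem_zpowers _
      · push Not at h
        exact ⟨1, fun e => by rw [hl e (h e)]; exact one_mem _⟩
    have := G.subgroup_eq_top hy₀ hτ hg
    exact ⟨g, fun x => by
      change x ∈ Subgroup.zpowers g
      rw [this]
      exact Subgroup.mem_top x⟩
  exact isCyclic_of_surjective (FundamentalGroup.fundamentalGroupMulEquivOfPathConnected y₀ y)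
    (MulEquiv.surjective _)

section Cycles

variable {G} {S : Set Y}

/-- A cycle which contains a point inside an edge contains the edge. -/
theorem _root_.IsCycle.edge_mem (hS : IsCycle S) {e : G.E} {t : unitInterval}
    (ht : t ∈ Ioo (0 : unitInterval) 1) (hmem : G.edge e t ∈ S) {s : unitInterval}
    (hs : s ∈ Ioo (0 : unitInterval) 1) : G.edge e s ∈ S := by
  have hinj : InjOn (G.edge e) (Ioo 0 1) := fun r hr r' _ h => (G.eq_of_edge_eq hr h).2
  have hIoo : ∀ a b : unitInterval, Ioo a b ⊆ Ioo 0 1 := fun a b r hr =>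
    ⟨a.2.1.trans_lt hr.1, hr.2.trans_le b.2.2⟩
  rcases lt_trichotomy t s with h | rfl | h
  · exact hS.mem_of_lt (fun a b => G.isOpen_edge_image e isOpen_Ioo (hIoo a b)) hinj hmem
      ht.1 h hs.2
  · exact hmem
  · have hσ : ∀ r ∈ Ioo (0 : unitInterval) 1, unitInterval.symm r ∈ Ioo (0 : unitInterval) 1 := by
      intro r hr
      have h0 : (0 : ℝ) < r := hr.1
      have h1 : (r : ℝ) < 1 := hr.2
      constructor <;> rw [← Subtype.coe_lt_coe, unitInterval.coe_symm_eq] <;>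
        simp only [Icc.coe_zero, Icc.coe_one] <;> linarith
    have := hS.mem_of_lt (c := (G.edge e).comp ⟨unitInterval.symm, unitInterval.continuous_symm⟩)
      (t := unitInterval.symm t) (s := unitInterval.symm s) ?_ ?_ ?_ (hσ t ht).1 ?_ (hσ s hs).2
    · simpa using this
    · intro a b
      rw [ContinuousMap.coe_comp, image_comp]
      refine G.isOpen_edge_image e ?_ ?_
      · change IsOpen (unitInterval.symm '' Ioo a b)
        rw [image_eq_preimage_of_inverse unitInterval.symm_symm unitInterval.symm_symm]
        exact isOpen_Ioo.preimage unitInterval.continuous_symm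
      · rintro _ ⟨r, hr, rfl⟩
        exact hσ r (hIoo a b hr)
    · intro r hr r' hr' h
      exact unitInterval.symm_bijective.injective (hinj (hσ r hr) (hσ r' hr') h)
    · simpa using hmem
    · exact unitInterval.symm_lt_symm.2 h

/-- A preconnected set containing a cycle stays preconnected when a point of the cycle inside an
edge is removed. -/
theorem _root_.IsCycle.isPreconnected_diff (hS : IsCycle S) {A : Set Y}
    (hA : _root_.IsPreconnected A) (hSA : S ⊆ A) {w : Y} (hw : w ∈ S) (hwV : w ∉ G.V) :
    _root_.IsPreconnected (A \ {w}) := by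
  obtain ⟨e, t, ht, rfl⟩ := G.exhaust w hwV
  refine hA.diff_singleton_of_subset (hS.isPreconnected_diff_singleton hw)
    (sdiff_subset_sdiff_left hSA)
    (G.isOpen_edge_image e isOpen_Ioo Subset.rfl) ⟨t, ht, rfl⟩ (sdiff_subset_sdiff_left ?_)
  rintro _ ⟨s, hs, rfl⟩
  exact hS.edge_mem ht hw hs

/-- If any two points inside the edges of a connected graph disconnect it, then a cycle is
recovered from the topology as the closure of the set of the non-separating points inside edges. -/
theorem _root_.IsCycle.eq_closure [PreconnectedSpace Y]
    (hD : ∀ z ∉ G.V, ∀ w ∉ G.V, z ≠ w → ¬ _root_.IsPreconnected ({z, w}ᶜ : Set Y))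
    (hS : IsCycle S) :
    S = closure {z | z ∉ G.V ∧ _root_.IsPreconnected ({z}ᶜ : Set Y)} := by
  have hcl := hS.subset_closure_diff G.finite_V
  obtain ⟨w, hwS, hwV⟩ : (S \ G.V).Nonempty := by
    obtain ⟨x, hx⟩ := hS.nontrivial.nonempty
    exact closure_nonempty_iff.1 ⟨x, hcl hx⟩
  refine Subset.antisymm (hcl.trans (closure_mono ?_))
    (closure_minimal ?_ hS.isCompact.isClosed)
  · rintro z ⟨hzS, hzV⟩
    refine ⟨hzV, ?_⟩
    rw [compl_eq_univ_sdiff]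
    exact hS.isPreconnected_diff isPreconnected_univ (subset_univ S) hzS hzV
  · rintro z ⟨hzV, hz⟩
    by_contra hzS
    refine hD z hzV w hwV (fun h => hzS (h ▸ hwS)) ?_
    have := hS.isPreconnected_diff hz (fun x hx h => hzS (h ▸ hx)) hwS hwV
    rwa [sdiff_eq, ← compl_union, singleton_union] at this

end Cycles

end GraphStructure

/-! ### Circle-valued maps on the torus -/

section CircleMaps

open Real

/-- Two real functions on a connected set with the same image in the circle differ by a constant;
in the form: a real function with constant image in the circle is constant. -/
theorem IsPreconnected.eq_of_circleExp_eq {A : Type*} [TopologicalSpace A] {S : Set A}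
    (hS : _root_.IsPreconnected S) {h : A → ℝ} (hh : ContinuousOn h S) {c : Circle}
    (hc : ∀ x ∈ S, Circle.exp (h x) = c) {x y : A} (hx : x ∈ S) (hy : y ∈ S) : h x = h y :=
  hS.constant_of_mapsTo (T := Circle.exp ⁻¹' {c})
    ⟨(Circle.isCoveringMap_exp c).discreteTopology_fiber⟩ hh hc hx hy

theorem exists_real_lift {A : Type*} [TopologicalSpace A] [SimplyConnectedSpace A]
    [LocallyPathConnectedSpace A] (f : C(A, Circle)) :
    ∃ F : C(A, ℝ), ∀ a, Circle.exp (F a) = f a := by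
  obtain ⟨a₀⟩ : Nonempty A := inferInstance
  obtain ⟨t, ht⟩ := Circle.exp_surjective (f a₀)
  obtain ⟨F, ⟨-, hF⟩, -⟩ := Circle.isCoveringMap_exp.existsUnique_continuousMap_lifts f a₀ t ht
  exact ⟨F, congrFun hF⟩

/-- The universal covering of the torus. -/
noncomputable def torusCover : C(ℝ × ℝ, Torus) :=
  ⟨Prod.map Circle.exp Circle.exp, by fun_prop⟩

theorem torusCover_apply (p : ℝ × ℝ) : torusCover p = (Circle.exp p.1, Circle.exp p.2) := rfl

theorem isOpenQuotientMap_torusCover : IsOpenQuotientMap torusCover := by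
  have h : IsOpenQuotientMap (Circle.exp : ℝ → Circle) :=
    ⟨Circle.exp_surjective, Circle.isCoveringMap_exp.continuous, Circle.isCoveringMap_exp.isOpenMap⟩
  exact h.prodMap h

theorem torusCover_add (p : ℝ × ℝ) (k l : ℤ) :
    torusCover (p.1 + k * (2 * π), p.2 + l * (2 * π)) = torusCover p := by
  rw [torusCover_apply, torusCover_apply, Circle.exp_add, Circle.exp_add,
    Circle.exp_int_mul_two_pi, Circle.exp_int_mul_two_pi, mul_one, mul_one]

theorem torusCover_eq_iff {p p' : ℝ × ℝ} : torusCover p = torusCover p' ↔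
    ∃ k l : ℤ, p = (p'.1 + k * (2 * π), p'.2 + l * (2 * π)) := by
  rw [torusCover_apply, torusCover_apply, Prod.ext_iff, Circle.exp_eq_exp, Circle.exp_eq_exp]
  constructor
  · rintro ⟨⟨k, hk⟩, l, hl⟩
    exact ⟨k, l, Prod.ext hk hl⟩
  · rintro ⟨k, l, rfl⟩
    exact ⟨⟨k, rfl⟩, l, rfl⟩

instance : LocallyPathConnectedSpace Torus :=
  isOpenQuotientMap_torusCover.isQuotientMap.locallyPathConnectedSpace

/-- Every circle-valued map on the torus is the product of a character and of the exponential of a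
real function. -/
theorem exists_eq_zpow_mul_exp (w : C(Torus, Circle)) :
    ∃ (a b : ℤ) (D : C(Torus, ℝ)), ∀ x, w x = x.1 ^ a * x.2 ^ b * Circle.exp (D x) := by
  obtain ⟨W, hW⟩ := exists_real_lift (w.comp torusCover)
  -- `W` is periodic up to additive constants, the periods of the character
  have hper : ∀ k l : ℤ, ∃ c : ℤ, ∀ p : ℝ × ℝ,
      W (p.1 + k * (2 * π), p.2 + l * (2 * π)) = W p + c * (2 * π) := by
    intro k l
    have hexp : ∀ p : ℝ × ℝ,
        Circle.exp (W (p.1 + k * (2 * π), p.2 + l * (2 * π)) - W p) = 1 := by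
      intro p
      rw [Circle.exp_sub, hW, hW, ContinuousMap.comp_apply, ContinuousMap.comp_apply,
        torusCover_add, div_self']
    obtain ⟨c, hc⟩ := Circle.exp_eq_one.1 (hexp 0)
    refine ⟨c, fun p => ?_⟩
    have := isPreconnected_univ.eq_of_circleExp_eq
      (h := fun p : ℝ × ℝ => W (p.1 + k * (2 * π), p.2 + l * (2 * π)) - W p)
      (by fun_prop) (fun p _ => hexp p) (mem_univ p) (mem_univ 0)
    rw [hc] at this
    linarith
  obtain ⟨a, ha⟩ := hper 1 0
  obtain ⟨b, hb⟩ := hper 0 1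
  let D' : C(ℝ × ℝ, ℝ) := ⟨fun p => W p - a * p.1 - b * p.2, by fun_prop⟩
  have hD1 : ∀ t, Function.Periodic (fun s => D' (s, t)) (2 * π) := fun t s => by
    have := ha (s, t)
    simp only [Int.cast_one, one_mul, Int.cast_zero, zero_mul, add_zero] at this
    simp only [D', ContinuousMap.coe_mk, this]
    ring
  have hD2 : ∀ s, Function.Periodic (fun t => D' (s, t)) (2 * π) := fun s t => by
    have := hb (s, t)
    simp only [Int.cast_one, one_mul, Int.cast_zero, zero_mul, add_zero] at this
    simp only [D', ContinuousMap.coe_mk, this]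
    ring
  have hD' : Function.FactorsThrough D' torusCover := by
    intro p p' h
    obtain ⟨k, l, rfl⟩ := torusCover_eq_iff.1 h
    exact ((hD1 _).int_mul k p'.1).trans ((hD2 _).int_mul l p'.2)
  refine ⟨a, b, isOpenQuotientMap_torusCover.isQuotientMap.lift D' hD', fun x => ?_⟩
  obtain ⟨p, rfl⟩ := isOpenQuotientMap_torusCover.surjective x
  have h1 : isOpenQuotientMap_torusCover.isQuotientMap.lift D' hD' (torusCover p) = D' p :=
    DFunLike.congr_fun (isOpenQuotientMap_torusCover.isQuotientMap.lift_comp D' hD') p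
  have h2 := hW p
  rw [ContinuousMap.comp_apply] at h2
  rw [h1, ← h2, torusCover_apply, ← Circle.exp_zsmul, ← Circle.exp_zsmul, ← Circle.exp_add,
    ← Circle.exp_add]
  congr 1
  simp only [D', ContinuousMap.coe_mk, zsmul_eq_mul]
  ring

/-- A bounded perturbation of a linear automorphism of the plane has a zero: otherwise its argument
would be well defined on a large circle. -/
theorem exists_linear_add_eq_zero {a₁ b₁ a₂ b₂ : ℝ} (hd : a₁ * b₂ - a₂ * b₁ ≠ 0)
    (g : C(ℝ × ℝ, ℂ)) {C : ℝ} (hg : ∀ p, ‖g p‖ ≤ C) :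
    ∃ p : ℝ × ℝ, (⟨a₁ * p.1 + b₁ * p.2, a₂ * p.1 + b₂ * p.2⟩ : ℂ) + g p = 0 := by
  by_contra! hne
  let L : ℝ × ℝ → ℂ := fun p => ⟨a₁ * p.1 + b₁ * p.2, a₂ * p.1 + b₂ * p.2⟩
  have hL : Continuous L := by
    have : L = fun p =>
        ((a₁ * p.1 + b₁ * p.2 : ℝ) : ℂ) + (a₂ * p.1 + b₂ * p.2 : ℝ) * Complex.I := by
      funext p
      exact Complex.mk_eq_add_mul_I _ _
    rw [this]
    fun_prop
  let Φ : ℝ × ℝ → ℂ := fun p => L p + g p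
  have hΦ : Continuous Φ := hL.add g.continuous
  have hΦ0 : ∀ p, Φ p ≠ 0 := hne
  have hC : 0 ≤ C := (norm_nonneg _).trans (hg 0)
  let u : C(ℝ × ℝ, {z : ℂ // z ≠ 0}) := ⟨fun p => ⟨Φ p, hΦ0 p⟩, hΦ.subtype_mk _⟩
  obtain ⟨F, ⟨-, hF⟩, -⟩ := Complex.isCoveringMap_exp.existsUnique_continuousMap_lifts u 0
    (Complex.log (Φ 0)) (Subtype.ext (Complex.exp_log (hΦ0 0)))
  have hFexp : ∀ p, Complex.exp (F p) = Φ p := fun p => congrArg Subtype.val (congrFun hF p)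
  -- the preimage of the circle of radius `R` under the linear part
  let R : ℝ := C + 1
  have hR : 0 < R := by positivity
  let P : ℝ → ℝ × ℝ := fun α => (R / (a₁ * b₂ - a₂ * b₁) * (b₂ * cos α - b₁ * sin α),
    R / (a₁ * b₂ - a₂ * b₁) * (a₁ * sin α - a₂ * cos α))
  have hP : Continuous P := by fun_prop
  have hLP : ∀ α, L (P α) = R * Complex.exp (α * Complex.I) := by
    intro α
    rw [Complex.exp_mul_I, ← Complex.ofReal_cos, ← Complex.ofReal_sin]
    apply Complex.ext
    · simp [L, P, -Complex.ofReal_cos, -Complex.ofReal_sin]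
      field_simp
      ring
    · simp [L, P, -Complex.ofReal_cos, -Complex.ofReal_sin]
      field_simp
      ring
  let ε : ℝ → ℂ := fun α => g (P α) / (R * Complex.exp (α * Complex.I))
  have hden : ∀ α : ℝ, (R : ℂ) * Complex.exp (α * Complex.I) ≠ 0 := fun α =>
    mul_ne_zero (Complex.ofReal_ne_zero.2 hR.ne') (Complex.exp_ne_zero _)
  have hε : Continuous ε := Continuous.div (by fun_prop) (by fun_prop) hden
  have hε1 : ∀ α, ‖ε α‖ < 1 := by
    intro α
    rw [norm_div, norm_mul, Complex.norm_exp_ofReal_mul_I, mul_one, Complex.norm_real,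
      Real.norm_of_nonneg hR.le, div_lt_one hR]
    exact (hg _).trans_lt (lt_add_one C)
  have hslit : ∀ α, 1 + ε α ∈ Complex.slitPlane := fun α =>
    Complex.mem_slitPlane_of_norm_lt_one (hε1 α)
  -- Along the circle the logarithm `F` differs by the logarithm of `1 + ε`, which is single-valued,
  -- and by a constant from the angle; so it increases by `2 * π * I`, but `P` is periodic.
  let k : ℝ → ℂ := fun α => F (P α) - α * Complex.I - Complex.log (1 + ε α)
  have hk : Continuous k :=
    ((F.continuous.comp hP).sub (by fun_prop)).sub
      (Continuous.clog (continuous_const.add hε) hslit)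
  have hkexp : ∀ α, Complex.exp (k α) = R := by
    intro α
    have h1 : Φ (P α) = R * Complex.exp (α * Complex.I) * (1 + ε α) := by
      simp only [Φ, hLP, ε]
      rw [mul_add, mul_one, mul_div_cancel₀ _ (hden α)]
    rw [Complex.exp_sub, Complex.exp_sub, hFexp,
      Complex.exp_log (Complex.slitPlane_ne_zero (hslit α)),
      h1]
    have := Complex.exp_ne_zero (α * Complex.I)
    have := Complex.slitPlane_ne_zero (hslit α)
    field_simp
  have hR' : (R : ℂ) ≠ 0 := Complex.ofReal_ne_zero.2 hR.ne'
  have hconst : k (2 * π) = k 0 := isPreconnected_univ.constant_of_mapsTo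
    (T := (fun z : ℂ => (⟨_, z.exp_ne_zero⟩ : {z : ℂ // z ≠ 0})) ⁻¹' {⟨R, hR'⟩})
    ⟨(Complex.isCoveringMap_exp _).discreteTopology_fiber⟩ hk.continuousOn
    (fun α _ => Subtype.ext (hkexp α)) trivial trivial
  have hP2 : P (2 * π) = P 0 := by simp [P]
  have hε2 : ε (2 * π) = ε 0 := by
    simp only [ε, hP2]
    congr 2
    push_cast
    rw [Complex.exp_two_pi_mul_I]
    simp
  simp only [k, hP2, hε2] at hconst
  have : ((2 * π : ℝ) : ℂ) * Complex.I = 0 := by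
    have h0 : ((0 : ℝ) : ℂ) * Complex.I = 0 := by simp
    rw [h0] at hconst
    linear_combination -hconst
  rcases mul_eq_zero.1 this with h | h
  · exact (by positivity : (2 * π : ℝ) ≠ 0) (Complex.ofReal_eq_zero.1 h)
  · exact Complex.I_ne_zero h

end CircleMaps

/-! ### Pairs of points disconnect a monotone image of the torus -/

section Monotone

open Real Filter

theorem Circle.coe_mem_slitPlane {z : Circle} (hz : z ≠ Circle.exp π) :
    (z : ℂ) ∈ Complex.slitPlane := by
  refine Complex.mem_slitPlane_iff_arg.2 ⟨fun h => hz ?_, z.coe_ne_zero⟩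
  rw [← Circle.exp_arg z, h]

universe u

variable {Γ : Type u} [TopologicalSpace Γ] [T2Space Γ] (G : GraphStructure Γ)

/-- A point `z` inside an edge is marked by a circle-valued map which takes the value `-1` only at
`z` and whose argument jumps there from `π` to `-π`: it goes once around the circle along the edge
containing `z`, and is constant elsewhere. -/
theorem GraphStructure.exists_marker {z : Γ} (hz : z ∉ G.V) :
    ∃ u : C(Γ, Circle), (∀ y, u y = Circle.exp π ↔ y = z) ∧
      (∃ l : Filter Γ, l.NeBot ∧ l ≤ 𝓝[≠] z ∧ Tendsto (fun y => (u y : ℂ).arg) l (𝓝 π)) ∧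
      ∃ l : Filter Γ, l.NeBot ∧ l ≤ 𝓝[≠] z ∧ Tendsto (fun y => (u y : ℂ).arg) l (𝓝 (-π)) := by
  classical
  obtain ⟨e, r, hr, rfl⟩ := G.exhaust z hz
  have hr0 : (0 : ℝ) < r := hr.1
  have hr1 : (r : ℝ) < 1 := hr.2
  have hr1' : (0 : ℝ) < 1 - r := by linarith
  -- the angle grows from `0` to `2 * π` along the edge and passes `π` at the parameter `r` of `z`
  let θ : C(unitInterval, ℝ) :=
    ⟨fun t => π * (min ((t : ℝ) / r) 1 + max (((t : ℝ) - r) / (1 - r)) 0), by fun_prop⟩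
  have hlt : ∀ t : unitInterval, t ≤ r → θ t = π * (t / r) := by
    intro t ht
    have ht' : (t : ℝ) ≤ r := ht
    simp only [θ, ContinuousMap.coe_mk]
    rw [min_eq_left ((div_le_one hr0).2 ht'), max_eq_right, add_zero]
    exact div_nonpos_of_nonpos_of_nonneg (by linarith) hr1'.le
  have hgt : ∀ t : unitInterval, r ≤ t → θ t = π * (1 + (t - r) / (1 - r)) := by
    intro t ht
    have ht' : (r : ℝ) ≤ t := ht
    simp only [θ, ContinuousMap.coe_mk]
    rw [min_eq_right ((one_le_div hr0).2 ht'), max_eq_left]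
    exact div_nonneg (by linarith) hr1'.le
  have hθr : θ r = π := by rw [hlt r le_rfl, div_self hr0.ne', mul_one]
  have harg1 : ∀ t, t < r → ((Circle.exp (θ t) : Circle) : ℂ).arg = θ t ∧ θ t < π := by
    intro t ht
    have ht' : (t : ℝ) < r := ht
    have h0 : 0 ≤ (t : ℝ) / r := div_nonneg t.2.1 hr0.le
    have h1 : (t : ℝ) / r < 1 := (div_lt_one hr0).2 ht'
    rw [hlt t ht.le]
    have := pi_pos
    exact ⟨Circle.arg_exp (by nlinarith) (by nlinarith), by nlinarith⟩
  have harg2 : ∀ t, r < t → ((Circle.exp (θ t) : Circle) : ℂ).arg = θ t - 2 * π ∧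
      -π < θ t - 2 * π ∧ θ t - 2 * π ≤ 0 := by
    intro t ht
    have ht' : (r : ℝ) < t := ht
    have h0 : 0 < ((t : ℝ) - r) / (1 - r) := div_pos (by linarith) hr1'
    have h1 : ((t : ℝ) - r) / (1 - r) ≤ 1 := (div_le_one hr1').2 (by linarith [t.2.2])
    have := pi_pos
    rw [← Circle.exp_sub_two_pi, hgt t ht.le]
    exact ⟨Circle.arg_exp (by nlinarith) (by nlinarith), by nlinarith, by nlinarith⟩
  have hexp : ∀ t, Circle.exp (θ t) = Circle.exp π ↔ t = r := by
    intro t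
    refine ⟨fun h => ?_, fun h => by rw [h, hθr]⟩
    have h' : ((Circle.exp (θ t) : Circle) : ℂ).arg = π := by
      rw [h]
      exact Circle.arg_exp (by linarith [pi_pos]) le_rfl
    rcases lt_trichotomy t r with h1 | h1 | h1
    · have := harg1 t h1
      linarith
    · exact h1
    · have := harg2 t h1
      linarith [pi_pos]
  have h10 : (1 : Circle) ≠ Circle.exp π := by
    intro h
    have h' := congrArg (fun z : Circle => (z : ℂ).arg) h
    simp only [Circle.coe_one, Complex.arg_one] at h'
    rw [Circle.arg_exp (by linarith [pi_pos]) le_rfl] at h'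
    exact pi_pos.ne h'
  obtain ⟨u, huV, huE⟩ := G.exists_lift (fun _ => (1 : Circle))
    (fun d => if d = e then (⟨Circle.exp, Circle.isCoveringMap_exp.continuous⟩ :
      C(ℝ, Circle)).comp θ else ContinuousMap.const _ 1)
    (fun d => by
      split_ifs
      · have : θ 0 = 0 := by
          rw [hlt 0 r.2.1]
          simp
        simp [this]
      · rfl)
    (fun d => by
      split_ifs
      · have : θ 1 = 2 * π := by
          rw [hgt 1 r.2.2, Icc.coe_one, div_self hr1'.ne']
          ring
        simp [this]
      · rfl)
  have hue : ∀ t, u (G.edge e t) = Circle.exp (θ t) := fun t => by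
    rw [huE, if_pos rfl]
    rfl
  refine ⟨u, fun y => ?_, ?_, ?_⟩
  · by_cases hy : y ∈ G.V
    · rw [huV y hy]
      exact ⟨fun h => absurd h h10, fun h => absurd hy (h ▸ hz)⟩
    obtain ⟨d, t, ht, rfl⟩ := G.exhaust y hy
    by_cases hd : d = e
    · subst hd
      rw [hue, hexp]
      exact ⟨fun h => h ▸ rfl, fun h => (G.eq_of_edge_eq ht h).2⟩
    · rw [huE, if_neg hd]
      exact ⟨fun h => absurd h h10, fun h => absurd (G.eq_of_edge_eq ht h).1 hd⟩
  · refine ⟨map (G.edge e) (𝓝[<] r), ?_, ?_, ?_⟩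
    · have : (𝓝[<] r).NeBot := nhdsLT_neBot_of_exists_lt ⟨0, hr.1⟩
      infer_instance
    · refine tendsto_nhdsWithin_iff.2 ⟨(G.edge e).continuous.continuousAt.tendsto.mono_left
        nhdsWithin_le_nhds, ?_⟩
      filter_upwards [self_mem_nhdsWithin] with t ht h
      exact (ne_of_lt ht) (G.eq_of_edge_eq hr h.symm).2.symm
    · rw [tendsto_map'_iff]
      have : Tendsto θ (𝓝[<] r) (𝓝 π) := by
        have := (θ.continuous.tendsto r).mono_left (nhdsWithin_le_nhds (s := Iio r))
        rwa [hθr] at this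
      refine this.congr' ?_
      filter_upwards [self_mem_nhdsWithin] with t ht
      rw [Function.comp_apply, hue, (harg1 t ht).1]
  · refine ⟨map (G.edge e) (𝓝[>] r), ?_, ?_, ?_⟩
    · have : (𝓝[>] r).NeBot := nhdsGT_neBot_of_exists_gt ⟨1, hr.2⟩
      infer_instance
    · refine tendsto_nhdsWithin_iff.2 ⟨(G.edge e).continuous.continuousAt.tendsto.mono_left
        nhdsWithin_le_nhds, ?_⟩
      filter_upwards [self_mem_nhdsWithin] with t ht h
      exact (ne_of_gt ht) (G.eq_of_edge_eq hr h.symm).2.symm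
    · rw [tendsto_map'_iff]
      have : Tendsto (fun t => θ t - 2 * π) (𝓝[>] r) (𝓝 (-π)) := by
        have := ((θ.continuous.tendsto r).mono_left
          (nhdsWithin_le_nhds (s := Ioi r))).sub_const (2 * π)
        rw [hθr] at this
        convert this using 2
        ring
      refine this.congr' ?_
      filter_upwards [self_mem_nhdsWithin] with t ht
      rw [Function.comp_apply, hue, (harg2 t ht).1]

/-- Let `u` and `v` be circle-valued maps which take the value `-1` only at `z` and `w`
respectively, and suppose that the argument of `u` jumps at `z`. If `u ^ m * v ^ n` has a continuous
real logarithm and the complement of `z` and `w` is connected, then `m = 0`. -/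
theorem eq_zero_of_zpow_mul_zpow_eq_exp {z w : Γ} (hzw : z ≠ w)
    (hconn : _root_.IsPreconnected ({z, w}ᶜ : Set Γ)) {u v : C(Γ, Circle)}
    (hu : ∀ y, u y = Circle.exp π ↔ y = z) (hv : ∀ y, v y = Circle.exp π ↔ y = w)
    (h₁ : ∃ l : Filter Γ, l.NeBot ∧ l ≤ 𝓝[≠] z ∧ Tendsto (fun y => (u y : ℂ).arg) l (𝓝 π))
    (h₂ : ∃ l : Filter Γ, l.NeBot ∧ l ≤ 𝓝[≠] z ∧ Tendsto (fun y => (u y : ℂ).arg) l (𝓝 (-π)))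
    {m n : ℤ} {h : C(Γ, ℝ)} (hh : ∀ y, Circle.exp (h y) = u y ^ m * v y ^ n) : m = 0 := by
  -- a logarithm of the constant `1`, continuous off `z` and `w`, which jumps by `2 * π * m` at `z`
  let k : Γ → ℝ := fun y => h y - n * (v y : ℂ).arg - m * (u y : ℂ).arg
  have hcont : ∀ (u : C(Γ, Circle)) (z : Γ), (∀ y, u y = Circle.exp π ↔ y = z) → ∀ y, y ≠ z →
      ContinuousAt (fun y => (u y : ℂ).arg) y := fun u z hu y hy =>
    (Complex.continuousAt_arg (Circle.coe_mem_slitPlane fun h => hy ((hu y).1 h))).comp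
      (f := fun y => (u y : ℂ)) (by fun_prop)
  have hk : ContinuousOn k ({z, w}ᶜ : Set Γ) := fun y hy =>
    (((h.continuous.continuousAt).sub (continuousAt_const.mul
      (hcont v w hv y fun h => hy (Or.inr h)))).sub (continuousAt_const.mul
      (hcont u z hu y fun h => hy (Or.inl h)))).continuousWithinAt
  have hexp : ∀ y ∈ ({z, w}ᶜ : Set Γ), Circle.exp (k y) = 1 := by
    intro y _
    simp only [k]
    rw [Circle.exp_sub, Circle.exp_sub, ← zsmul_eq_mul, ← zsmul_eq_mul, Circle.exp_zsmul,
      Circle.exp_zsmul, Circle.exp_arg, Circle.exp_arg, hh, mul_div_cancel_right, div_self']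
  have hlim : ∀ (l : Filter Γ) (a : ℝ), l ≤ 𝓝[≠] z → Tendsto (fun y => (u y : ℂ).arg) l (𝓝 a) →
      Tendsto k l (𝓝 (h z - n * (v z : ℂ).arg - m * a)) := by
    intro l a hl ha
    have hl' : l ≤ 𝓝 z := hl.trans nhdsWithin_le_nhds
    exact (((h.continuous.tendsto z).mono_left hl').sub
      (((hcont v w hv z hzw).tendsto.mono_left hl').const_mul _)).sub (ha.const_mul _)
  have hmem : ({z, w}ᶜ : Set Γ) ∈ 𝓝[≠] z := by
    filter_upwards [self_mem_nhdsWithin, nhdsWithin_le_nhds (isOpen_ne.mem_nhds hzw)] with y h1 h2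
    rintro (h | h)
    · exact h1 h
    · exact h2 h
  obtain ⟨l₁, hl₁, hle₁, ht₁⟩ := h₁
  obtain ⟨l₂, hl₂, hle₂, ht₂⟩ := h₂
  obtain ⟨y₀, hy₀⟩ := Filter.nonempty_of_mem (hle₁ hmem)
  have hval : ∀ (l : Filter Γ), l.NeBot → l ≤ 𝓝[≠] z → ∀ b, Tendsto k l (𝓝 b) → b = k y₀ := by
    intro l hl hle b hb
    refine tendsto_nhds_unique (hb.congr' ?_) tendsto_const_nhds
    filter_upwards [hle hmem] with y hy
    exact hconn.eq_of_circleExp_eq hk hexp hy hy₀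
  have e₁ := hval l₁ hl₁ hle₁ _ (hlim l₁ _ hle₁ ht₁)
  have e₂ := hval l₂ hl₂ hle₂ _ (hlim l₂ _ hle₂ ht₂)
  have : (m : ℝ) * π = 0 := by linarith
  exact_mod_cast (mul_eq_zero.1 this).resolve_right pi_ne_zero

/-- In a graph which is a quotient of the torus with connected fibres, any two points inside the
edges disconnect. Otherwise two circle-valued maps marking the points would have independent
restrictions to the one-dimensional cohomology of the graph, hence of the torus, and the pair would
have nonzero degree as a map from the torus to itself; but it omits the value `(-1, -1)`. -/
theorem GraphStructure.not_isPreconnected_compl_pair {q : C(Torus, Γ)} (hq : IsQuotientMap q)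
    (hfib : ∀ y, _root_.IsPreconnected (q ⁻¹' {y})) {z w : Γ} (hz : z ∉ G.V) (hw : w ∉ G.V)
    (hzw : z ≠ w) : ¬ _root_.IsPreconnected ({z, w}ᶜ : Set Γ) := by
  intro hconn
  obtain ⟨u, hu, hu₁, hu₂⟩ := G.exists_marker hz
  obtain ⟨v, hv, hv₁, hv₂⟩ := G.exists_marker hw
  obtain ⟨a₁, b₁, D₁, hD₁⟩ := exists_eq_zpow_mul_exp (u.comp q)
  obtain ⟨a₂, b₂, D₂, hD₂⟩ := exists_eq_zpow_mul_exp (v.comp q)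
  -- a trivial integral combination of the classes on the torus descends to one on the graph,
  -- because a real logarithm is constant on the connected fibres of `q`
  have hzero : ∀ m n : ℤ, m * a₁ + n * a₂ = 0 → m * b₁ + n * b₂ = 0 → m = 0 ∧ n = 0 := by
    intro m n ha hb
    let H : C(Torus, ℝ) := ⟨fun x => m * D₁ x + n * D₂ x, by fun_prop⟩
    have hH : ∀ x, Circle.exp (H x) = u (q x) ^ m * v (q x) ^ n := by
      intro x
      have e₁ := hD₁ x
      have e₂ := hD₂ x
      rw [ContinuousMap.comp_apply] at e₁ e₂
      have hx : (x.1 : Circle) ^ (m * a₁ + n * a₂) * x.2 ^ (m * b₁ + n * b₂) = 1 := by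
        rw [ha, hb, zpow_zero, zpow_zero, one_mul]
      have : Circle.exp (H x) = Circle.exp (D₁ x) ^ m * Circle.exp (D₂ x) ^ n := by
        simp only [H, ContinuousMap.coe_mk]
        rw [Circle.exp_add, ← zsmul_eq_mul, ← zsmul_eq_mul, Circle.exp_zsmul, Circle.exp_zsmul]
      rw [this, e₁, e₂, ← one_mul (_ * _), ← hx]
      simp only [zpow_add, mul_zpow, zpow_mul']
      simp only [← zpow_mul]
      ac_rfl
    have hfac : Function.FactorsThrough H q := by
      intro x x' hxx'
      refine (hfib (q x)).eq_of_circleExp_eq H.continuous.continuousOn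
        (c := u (q x) ^ m * v (q x) ^ n) (fun y hy => ?_) rfl hxx'.symm
      rw [hH, show q y = q x from hy]
    let h : C(Γ, ℝ) := hq.lift H hfac
    have hh : ∀ y, Circle.exp (h y) = u y ^ m * v y ^ n := by
      intro y
      obtain ⟨x, rfl⟩ := hq.surjective y
      rw [show h (q x) = H x from DFunLike.congr_fun (hq.lift_comp H hfac) x, hH]
    refine ⟨eq_zero_of_zpow_mul_zpow_eq_exp hzw hconn hu hv hu₁ hu₂ hh,
      eq_zero_of_zpow_mul_zpow_eq_exp hzw.symm (by rwa [pair_comm]) hv hu hv₁ hv₂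
        (n := m) (h := h) fun y => ?_⟩
    rw [hh, mul_comm]
  have hdet : a₁ * b₂ - a₂ * b₁ ≠ 0 := by
    intro hd
    have h₁ := hzero a₂ (-a₁) (by ring) (by linarith)
    have h₂ := hzero b₂ (-b₁) (by linarith) (by ring)
    have h₃ := hzero 1 0 (by linarith [h₁.2]) (by linarith [h₂.2])
    exact one_ne_zero h₃.1
  -- A zero of this perturbation of the linear map with rows `(a₁, b₁)` and `(a₂, b₂)` gives a point
  -- of the torus at which both markers are `-1`.
  let g : C(ℝ × ℝ, ℂ) := ⟨fun p => (D₁ (torusCover p) - π : ℝ) +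
    (D₂ (torusCover p) - π : ℝ) * Complex.I, by fun_prop⟩
  obtain ⟨C₁, hC₁⟩ := isCompact_univ.exists_bound_of_continuousOn D₁.continuous.continuousOn
  obtain ⟨C₂, hC₂⟩ := isCompact_univ.exists_bound_of_continuousOn D₂.continuous.continuousOn
  have hg : ∀ p, ‖g p‖ ≤ (C₁ + π) + (C₂ + π) := by
    intro p
    have hb : ∀ {D : C(Torus, ℝ)} {C : ℝ}, (∀ x ∈ univ, ‖D x‖ ≤ C) →
        ‖D (torusCover p) - π‖ ≤ C + π := fun {D C} h =>
      (norm_sub_le _ _).trans (add_le_add (h _ trivial) (Real.norm_of_nonneg pi_pos.le).le)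
    refine (norm_add_le _ _).trans (add_le_add ?_ ?_)
    · rw [Complex.norm_real]
      exact hb hC₁
    · rw [norm_mul, Complex.norm_I, mul_one, Complex.norm_real]
      exact hb hC₂
  have hdet' : (a₁ : ℝ) * b₂ - a₂ * b₁ ≠ 0 := by exact_mod_cast hdet
  obtain ⟨p, hp⟩ := exists_linear_add_eq_zero hdet' g hg
  have hre := congrArg Complex.re hp
  have him := congrArg Complex.im hp
  simp [g] at hre him
  have key : ∀ (a b : ℤ) (D : C(Torus, ℝ)),
      (a : ℝ) * p.1 + b * p.2 + (D (torusCover p) - π) = 0 →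
      (torusCover p).1 ^ a * (torusCover p).2 ^ b * Circle.exp (D (torusCover p)) =
        Circle.exp π := by
    intro a b D hD
    have : D (torusCover p) = π - (a * p.1 + b * p.2) := by linarith
    rw [this, torusCover_apply, ← Circle.exp_zsmul, ← Circle.exp_zsmul, ← Circle.exp_add,
      ← Circle.exp_add, zsmul_eq_mul, zsmul_eq_mul, add_sub_cancel]
  have h1 := (hu _).1 ((hD₁ (torusCover p)).trans (key a₁ b₁ D₁ hre))
  have h2 := (hv _).1 ((hD₂ (torusCover p)).trans (key a₂ b₂ D₂ him))
  exact hzw (h1.symm.trans h2)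

end Monotone

/-! ### Singular homology in degree one and the fundamental group -/

section Hurewicz

open Simplicial Opposite

variable {X : Type} [TopologicalSpace X]

section Simplices

variable {V : Type*} [AddCommGroup V] [Module ℝ V] [TopologicalSpace V] [IsTopologicalAddGroup V]
  [ContinuousSMul ℝ V]

theorem stdSimplex.continuous_coe_apply {n : ℕ} (i : Fin n) :
    Continuous fun w : stdSimplex ℝ (Fin n) => w i :=
  (continuous_apply i).comp continuous_subtype_val

theorem stdSimplex.map_apply_eq_sum {m n : ℕ} (f : Fin m → Fin n) (w : stdSimplex ℝ (Fin m))
    (j : Fin n) : stdSimplex.map f w j = ∑ i, if f i = j then w i else 0 := by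
  rw [stdSimplex.map_coe, FunOnFinite.linearMap_apply_apply, Finset.sum_filter]

/-- The singular `1`-simplex obtained by restricting a map to a segment. -/
noncomputable def singularSegment (F : C(V, X)) (A B : V) :
    (TopCat.toSSet.obj (TopCat.of X)) _⦋1⦌ :=
  (TopCat.toSSetObjEquiv (TopCat.of X) (op ⦋1⦌)).symm
    (⟨fun w : stdSimplex ℝ (Fin 2) => F (w 0 • A + w 1 • B), F.continuous.comp
      (((stdSimplex.continuous_coe_apply 0).smul continuous_const).add
        ((stdSimplex.continuous_coe_apply 1).smul continuous_const))⟩ :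
      C(stdSimplex ℝ (Fin 2), X))

/-- The singular `2`-simplex obtained by restricting a map to an affine triangle. -/
noncomputable def singularTriangle (F : C(V, X)) (A B D : V) :
    (TopCat.toSSet.obj (TopCat.of X)) _⦋2⦌ :=
  (TopCat.toSSetObjEquiv (TopCat.of X) (op ⦋2⦌)).symm
    (⟨fun w : stdSimplex ℝ (Fin 3) => F (w 0 • A + w 1 • B + w 2 • D), F.continuous.comp
      ((((stdSimplex.continuous_coe_apply 0).smul continuous_const).add
        ((stdSimplex.continuous_coe_apply 1).smul continuous_const)).add
        ((stdSimplex.continuous_coe_apply 2).smul continuous_const))⟩ :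
      C(stdSimplex ℝ (Fin 3), X))

theorem δ_zero_singularTriangle (F : C(V, X)) (A B D : V) :
    (TopCat.toSSet.obj (TopCat.of X)).δ 0 (singularTriangle F A B D) = singularSegment F B D := by
  apply (TopCat.toSSetObjEquiv (TopCat.of X) (op ⦋1⦌)).injective
  ext w
  change F _ = F _
  congr 1
  change stdSimplex ℝ (Fin 2) at w
  change (stdSimplex.map (Fin.succAbove 0) w) 0 • A + (stdSimplex.map (Fin.succAbove 0) w) 1 • B +
    (stdSimplex.map (Fin.succAbove 0) w) 2 • D = w 0 • B + w 1 • D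
  simp [stdSimplex.map_apply_eq_sum, Fin.sum_univ_two]

theorem δ_one_singularTriangle (F : C(V, X)) (A B D : V) :
    (TopCat.toSSet.obj (TopCat.of X)).δ 1 (singularTriangle F A B D) = singularSegment F A D := by
  apply (TopCat.toSSetObjEquiv (TopCat.of X) (op ⦋1⦌)).injective
  ext w
  change F _ = F _
  congr 1
  change stdSimplex ℝ (Fin 2) at w
  change (stdSimplex.map (Fin.succAbove 1) w) 0 • A + (stdSimplex.map (Fin.succAbove 1) w) 1 • B +
    (stdSimplex.map (Fin.succAbove 1) w) 2 • D = w 0 • A + w 1 • D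
  have h0 : Fin.succAbove (1 : Fin 3) (0 : Fin 2) = 0 := rfl
  have h1 : Fin.succAbove (1 : Fin 3) (1 : Fin 2) = 2 := rfl
  simp [stdSimplex.map_apply_eq_sum, Fin.sum_univ_two, h0, h1]

theorem δ_two_singularTriangle (F : C(V, X)) (A B D : V) :
    (TopCat.toSSet.obj (TopCat.of X)).δ 2 (singularTriangle F A B D) = singularSegment F A B := by
  apply (TopCat.toSSetObjEquiv (TopCat.of X) (op ⦋1⦌)).injective
  ext w
  change F _ = F _
  congr 1
  change stdSimplex ℝ (Fin 2) at w
  change (stdSimplex.map (Fin.succAbove 2) w) 0 • A + (stdSimplex.map (Fin.succAbove 2) w) 1 • B +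
    (stdSimplex.map (Fin.succAbove 2) w) 2 • D = w 0 • A + w 1 • B
  have h0 : Fin.succAbove (2 : Fin 3) (0 : Fin 2) = 0 := rfl
  have h1 : Fin.succAbove (2 : Fin 3) (1 : Fin 2) = 1 := rfl
  simp [stdSimplex.map_apply_eq_sum, Fin.sum_univ_two, h0, h1]

end Simplices

/-- The singular `1`-simplex of a path. -/
noncomputable def singularPath {x y : X} (p : Path x y) :
    (TopCat.toSSet.obj (TopCat.of X)) _⦋1⦌ :=
  singularSegment p.extend 0 1

/-- The singular `0`-simplex of a point. -/
noncomputable def singularPoint (x : X) : (TopCat.toSSet.obj (TopCat.of X)) _⦋0⦌ :=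
  (TopCat.toSSetObjEquiv (TopCat.of X) (op ⦋0⦌)).symm
    (ContinuousMap.const (stdSimplex ℝ (Fin 1)) x : C(stdSimplex ℝ (Fin 1), X))

theorem stdSimplex.eq_of_zero_eq {w : stdSimplex ℝ (Fin 2)} : w 0 = 1 - w 1 := by
  have := w.2.2
  rw [Fin.sum_univ_two] at this
  exact eq_sub_of_add_eq this

/-- A segment is determined by the path which it describes. -/
theorem singularSegment_eq_singularPath {V : Type*} [AddCommGroup V] [Module ℝ V]
    [TopologicalSpace V] [IsTopologicalAddGroup V] [ContinuousSMul ℝ V] (F : C(V, X)) (A B : V)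
    {x y : X} (p : Path x y) (h : ∀ t : unitInterval, F ((1 - (t : ℝ)) • A + (t : ℝ) • B) = p t) :
    singularSegment F A B = singularPath p := by
  apply (TopCat.toSSetObjEquiv (TopCat.of X) (op ⦋1⦌)).injective
  ext w
  change stdSimplex ℝ (Fin 2) at w
  change F (w 0 • A + w 1 • B) = p.extend (w 0 • 0 + w 1 • 1)
  have hw : w 1 ∈ unitInterval := ⟨w.2.1 1, by
    have h0 := w.2.1 0
    have h1 := stdSimplex.eq_of_zero_eq (w := w)
    change 0 ≤ w 0 at h0
    linarith⟩
  have := h ⟨w 1, hw⟩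
  rw [stdSimplex.eq_of_zero_eq, this]
  simp [Path.extend_apply p hw]

theorem δ_zero_singularPath {x y : X} (p : Path x y) :
    (TopCat.toSSet.obj (TopCat.of X)).δ 0 (singularPath p) = singularPoint y := by
  apply (TopCat.toSSetObjEquiv (TopCat.of X) (op ⦋0⦌)).injective
  ext w
  change stdSimplex ℝ (Fin 1) at w
  change p.extend ((stdSimplex.map (Fin.succAbove 0) w) 0 • 0 +
    (stdSimplex.map (Fin.succAbove 0) w) 1 • 1) = y
  have hw : w 0 = 1 := by simp
  have h0 : Fin.succAbove (0 : Fin 2) (0 : Fin 1) = 1 := rfl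
  simp only [stdSimplex.map_apply_eq_sum, Fin.sum_univ_one, h0, hw]
  simp

theorem δ_one_singularPath {x y : X} (p : Path x y) :
    (TopCat.toSSet.obj (TopCat.of X)).δ 1 (singularPath p) = singularPoint x := by
  apply (TopCat.toSSetObjEquiv (TopCat.of X) (op ⦋0⦌)).injective
  ext w
  change stdSimplex ℝ (Fin 1) at w
  change p.extend ((stdSimplex.map (Fin.succAbove 1) w) 0 • 0 +
    (stdSimplex.map (Fin.succAbove 1) w) 1 • 1) = x
  have h0 : Fin.succAbove (1 : Fin 2) (0 : Fin 1) = 0 := rfl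
  simp only [stdSimplex.map_apply_eq_sum, Fin.sum_univ_one, h0]
  simp

/-- Every singular `1`-simplex is the simplex of a path. -/
theorem exists_eq_singularPath (σ : (TopCat.toSSet.obj (TopCat.of X)) _⦋1⦌) :
    ∃ (x y : X) (p : Path x y), σ = singularPath p := by
  let g : C(stdSimplex ℝ (Fin 2), X) := TopCat.toSSetObjEquiv (TopCat.of X) (op ⦋1⦌) σ
  let c : C(unitInterval, stdSimplex ℝ (Fin 2)) :=
    ⟨fun t => ⟨![1 - (t : ℝ), t], by
      refine ⟨fun i => ?_, by simp [Fin.sum_univ_two]⟩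
      fin_cases i
      · exact sub_nonneg.2 t.2.2
      · exact t.2.1⟩, by
      refine Continuous.subtype_mk (continuous_pi fun i => ?_) _
      fin_cases i
      · exact continuous_const.sub continuous_subtype_val
      · exact continuous_subtype_val⟩
  refine ⟨_, _, (⟨g.comp c, rfl, rfl⟩ : Path (g (c 0)) (g (c 1))), ?_⟩
  apply (TopCat.toSSetObjEquiv (TopCat.of X) (op ⦋1⦌)).injective
  ext w
  change stdSimplex ℝ (Fin 2) at w
  have hw : w 1 ∈ unitInterval := ⟨w.2.1 1, by
    have h0 := w.2.1 0
    have h1 := stdSimplex.eq_of_zero_eq (w := w)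
    change 0 ≤ w 0 at h0
    linarith⟩
  change g w = Path.extend (⟨g.comp c, rfl, rfl⟩ : Path (g (c 0)) (g (c 1))) (w 0 • 0 + w 1 • 1)
  rw [smul_zero, zero_add, smul_eq_mul, mul_one, Path.extend_apply _ hw]
  change g w = g (c ⟨w 1, hw⟩)
  congr 1
  refine Subtype.ext (funext fun i => ?_)
  fin_cases i
  · exact stdSimplex.eq_of_zero_eq
  · rfl

/-! A homomorphism from the singular `1`-chains which vanishes on boundaries is a functor on the
fundamental groupoid. -/

section Functor

variable {R T : ModuleCat.{0} ℤ}
  (π : ((TopCat.toSSet.obj (TopCat.of X)).chainComplex R).X 1 ⟶ T)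

/-- The value on a singular `1`-simplex of a homomorphism from the singular `1`-chains. -/
noncomputable def simplexValue (σ : (TopCat.toSSet.obj (TopCat.of X)) _⦋1⦌) : R ⟶ T :=
  (TopCat.toSSet.obj (TopCat.of X)).ιChainComplex σ ≫ π

variable {π}

theorem simplexValue_singularSegment_add
    (hπ : ((TopCat.toSSet.obj (TopCat.of X)).chainComplex R).d 2 1 ≫ π = 0)
    {V : Type*} [AddCommGroup V] [Module ℝ V] [TopologicalSpace V] [IsTopologicalAddGroup V]
    [ContinuousSMul ℝ V] (F : C(V, X)) (A B D : V) :
    simplexValue π (singularSegment F A B) + simplexValue π (singularSegment F B D) =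
      simplexValue π (singularSegment F A D) := by
  have h : (TopCat.toSSet.obj (TopCat.of X)).ιChainComplex (singularTriangle F A B D) ≫
      ((TopCat.toSSet.obj (TopCat.of X)).chainComplex R).d 2 1 ≫ π = 0 := by
    rw [hπ, Limits.comp_zero]
  rw [← Category.assoc, SSet.ιChainComplex_d, Fin.sum_univ_three, δ_zero_singularTriangle,
    δ_one_singularTriangle, δ_two_singularTriangle] at h
  simp [Preadditive.add_comp, Preadditive.neg_comp] at h
  unfold simplexValue
  rw [← sub_eq_zero, ← h]
  abel

theorem simplexValue_refl
    (hπ : ((TopCat.toSSet.obj (TopCat.of X)).chainComplex R).d 2 1 ≫ π = 0) (x : X) :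
    simplexValue π (singularPath (Path.refl x)) = 0 := by
  have h := simplexValue_singularSegment_add hπ (ContinuousMap.const ℝ x) 0 0 0
  rw [singularSegment_eq_singularPath _ _ _ (Path.refl x) fun t => rfl] at h
  exact add_eq_left.1 h

theorem simplexValue_trans
    (hπ : ((TopCat.toSSet.obj (TopCat.of X)).chainComplex R).d 2 1 ≫ π = 0) {x y z : X}
    (p : Path x y) (q : Path y z) :
    simplexValue π (singularPath (p.trans q)) =
      simplexValue π (singularPath p) + simplexValue π (singularPath q) := by
  have h := simplexValue_singularSegment_add hπ (p.trans q).extend 0 (1 / 2) 1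
  have h1 : ∀ t : unitInterval,
      (p.trans q).extend ((1 - (t : ℝ)) • 0 + (t : ℝ) • (1 / 2)) = p t := by
    intro t
    have ht : (1 - (t : ℝ)) • (0 : ℝ) + (t : ℝ) • (1 / 2 : ℝ) = t / 2 := by
      simp only [smul_eq_mul]
      ring
    have hm : (t : ℝ) / 2 ∈ unitInterval := ⟨by linarith [t.2.1], by linarith [t.2.2]⟩
    rw [ht, Path.extend_apply _ hm, Path.trans_apply, dif_pos (by simp only; linarith [t.2.2])]
    congr 1
    exact Subtype.ext (by simp only; ring)
  have h2 : ∀ t : unitInterval,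
      (p.trans q).extend ((1 - (t : ℝ)) • (1 / 2) + (t : ℝ) • 1) = q t := by
    intro t
    have ht : (1 - (t : ℝ)) • (1 / 2 : ℝ) + (t : ℝ) • (1 : ℝ) = (1 + t) / 2 := by
      simp only [smul_eq_mul]
      ring
    have hm : (1 + (t : ℝ)) / 2 ∈ unitInterval := ⟨by linarith [t.2.1], by linarith [t.2.2]⟩
    rw [ht, Path.extend_apply _ hm, Path.trans_apply]
    split_ifs with hle
    · have ht0 : (t : ℝ) = 0 := le_antisymm (by simp only at hle; linarith) t.2.1
      obtain rfl : t = 0 := Subtype.ext ht0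
      rw [q.source]
      convert p.target
      simp
    · congr 1
      exact Subtype.ext (by simp only; ring)
  rw [singularSegment_eq_singularPath _ _ _ p h1, singularSegment_eq_singularPath _ _ _ q h2] at h
  exact h.symm

/-- Homotopic paths have the same value: cut the square of the homotopy along a diagonal. -/
theorem simplexValue_congr
    (hπ : ((TopCat.toSSet.obj (TopCat.of X)).chainComplex R).d 2 1 ≫ π = 0) {x y : X}
    {p q : Path x y} (hpq : p.Homotopic q) :
    simplexValue π (singularPath p) = simplexValue π (singularPath q) := by
  obtain ⟨H⟩ := hpq
  let F : C(ℝ × ℝ, X) := ⟨fun a => H (projIcc 0 1 zero_le_one a.1, projIcc 0 1 zero_le_one a.2),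
    H.continuous.comp ((continuous_projIcc.comp continuous_fst).prodMk
      (continuous_projIcc.comp continuous_snd))⟩
  have hF : ∀ s t : unitInterval, F (s, t) = H (s, t) := fun s t => by
    simp [F]
  have h1 := simplexValue_singularSegment_add hπ F (0, 0) (0, 1) (1, 1)
  have h2 := simplexValue_singularSegment_add hπ F (0, 0) (1, 0) (1, 1)
  rw [← h2, singularSegment_eq_singularPath F (0, 0) (0, 1) p fun t => ?_,
    singularSegment_eq_singularPath F (0, 1) (1, 1) (Path.refl y) fun t => ?_,
    singularSegment_eq_singularPath F (0, 0) (1, 0) (Path.refl x) fun t => ?_,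
    singularSegment_eq_singularPath F (1, 0) (1, 1) q fun t => ?_,
    simplexValue_refl hπ, simplexValue_refl hπ, add_zero, zero_add] at h1
  · exact h1
  · simpa using hF 1 t
  · simpa using hF t 0
  · simpa using hF t 1
  · simpa using hF 0 t

/-- The value on a homotopy class of paths. -/
noncomputable def classValue
    (hπ : ((TopCat.toSSet.obj (TopCat.of X)).chainComplex R).d 2 1 ≫ π = 0) {x y : X} :
    Path.Homotopic.Quotient x y → (R ⟶ T) :=
  Quotient.lift (fun p => simplexValue π (singularPath p)) fun _ _ h => simplexValue_congr hπ h

theorem classValue_trans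
    (hπ : ((TopCat.toSSet.obj (TopCat.of X)).chainComplex R).d 2 1 ≫ π = 0) {x y z : X}
    (a : Path.Homotopic.Quotient x y) (b : Path.Homotopic.Quotient y z) :
    classValue hπ (a.trans b) = classValue hπ a + classValue hπ b := by
  induction a with | mk a => induction b with | mk b =>
  exact simplexValue_trans hπ a b

theorem classValue_symm
    (hπ : ((TopCat.toSSet.obj (TopCat.of X)).chainComplex R).d 2 1 ≫ π = 0) {x y : X}
    (a : Path.Homotopic.Quotient x y) : classValue hπ a.symm = -classValue hπ a := by
  rw [eq_neg_iff_add_eq_zero, ← classValue_trans, Path.Homotopic.Quotient.symm_trans]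
  exact simplexValue_refl hπ y

/-- The value on the fundamental group, as a homomorphism. -/
noncomputable def classValueHom
    (hπ : ((TopCat.toSSet.obj (TopCat.of X)).chainComplex R).d 2 1 ≫ π = 0) (x : X) :
    FundamentalGroup X x →* Multiplicative (R ⟶ T) :=
  MonoidHom.mk' (fun a => Multiplicative.ofAdd (classValue hπ a)) fun a b => by
    change Multiplicative.ofAdd (classValue hπ (Path.Homotopic.Quotient.trans b a)) = _
    rw [classValue_trans, add_comm]
    rfl

end Functor

/-- If the fundamental group of a path connected space is cyclic, then the first singular homology
group is generated by the class of one loop. Indeed, modulo this class and boundaries, a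
`1`-simplex from `x` to `y` becomes the difference of the classes of fixed paths from the base point
to `y` and to `x`, hence depends only on its boundary. -/
theorem bettiOne_le_one [PathConnectedSpace X] {x₀ : X} (hcyc : IsCyclic (FundamentalGroup X x₀)) :
    bettiOne X ≤ 1 := by
  let K := TopCat.toSSet.obj (TopCat.of X)
  let R : ModuleCat.{0} ℤ := ModuleCat.of ℤ ℤ
  let C := K.chainComplex R
  obtain ⟨g, hg⟩ := hcyc
  obtain ⟨γ, hγg⟩ : ∃ γ : Path x₀ x₀, Path.Homotopic.Quotient.mk γ = g :=
    Quotient.exists_rep (g : Path.Homotopic.Quotient x₀ x₀)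
  let i : R ⟶ C.X 1 := K.ιChainComplex (singularPath γ)
  have hi : i ≫ C.d 1 0 = 0 := by
    simp only [i, C]
    rw [SSet.ιChainComplex_d, Fin.sum_univ_two, δ_zero_singularPath, δ_one_singularPath]
    simp
  let c : R ⟶ C.homology 1 := C.liftCycles i 0 (by simp) hi ≫ C.homologyπ 1
  have hsurj : Function.Surjective c.hom := by
    -- `c` is surjective if every map `π` out of the `1`-chains which kills boundaries and the
    -- loop also kills cycles, that is, factors through the differential
    let j : R ⟶ C.opcycles 1 := i ≫ C.pOpcycles 1
    let π : C.X 1 ⟶ Limits.cokernel j := C.pOpcycles 1 ≫ Limits.cokernel.π j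
    have hπ : C.d 2 1 ≫ π = 0 := by
      simp only [π, ← Category.assoc]
      rw [HomologicalComplex.d_pOpcycles, Limits.zero_comp]
    have hγ : classValueHom hπ x₀ g = 1 := by
      have h : i ≫ C.pOpcycles 1 ≫ Limits.cokernel.π j = 0 := by
        rw [← Category.assoc]
        exact Limits.cokernel.condition j
      rw [← hγg]
      exact congrArg Multiplicative.ofAdd h
    have hloop : ∀ a : FundamentalGroup X x₀, classValue hπ a = 0 := by
      intro a
      obtain ⟨n, rfl⟩ := hg a
      have h : classValueHom hπ x₀ (g ^ n) = 1 := by rw [map_zpow, hγ, one_zpow]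
      exact congrArg Multiplicative.toAdd h
    let p : ∀ x, Path.Homotopic.Quotient x₀ x := fun x =>
      Path.Homotopic.Quotient.mk (PathConnectedSpace.somePath x₀ x)
    let φ : C.X 0 ⟶ Limits.cokernel j := (K.isColimitChainComplexXCofan R 0).desc
      (Limits.Cofan.mk _ fun σ => classValue hπ (p (TopCat.toSSetObj₀Equiv σ)))
    have hφ : ∀ x, K.ιChainComplex (singularPoint x) ≫ φ = classValue hπ (p x) := fun x =>
      (K.isColimitChainComplexXCofan R 0).fac _ ⟨singularPoint x⟩
    have hfac : π = C.d 1 0 ≫ φ := by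
      refine SSet.chainComplex_hom_ext fun σ => ?_
      obtain ⟨x, y, q, rfl⟩ := exists_eq_singularPath σ
      have h := hloop (((p x).trans (Path.Homotopic.Quotient.mk q)).trans (p y).symm)
      rw [classValue_trans, classValue_trans, classValue_symm] at h
      change _ = K.ιChainComplex (singularPath q) ≫ (K.chainComplex R).d 1 0 ≫ φ
      rw [SSet.ιChainComplex_d_assoc, Fin.sum_univ_two, δ_zero_singularPath,
        δ_one_singularPath]
      simp only [Fin.val_zero, pow_zero, one_smul, Fin.val_one, pow_one, neg_smul,
        Preadditive.add_comp, Preadditive.neg_comp]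
      rw [hφ, hφ]
      change classValue hπ (Path.Homotopic.Quotient.mk q) = _
      rw [← sub_eq_zero, ← h]
      abel
    have hzero : C.homologyι 1 ≫ Limits.cokernel.π j = 0 := by
      rw [← cancel_epi (C.homologyπ 1), HomologicalComplex.homology_π_ι_assoc]
      change C.iCycles 1 ≫ π = _
      rw [hfac, HomologicalComplex.iCycles_d_assoc, Limits.zero_comp, Limits.comp_zero]
    have hinj : Function.Injective (C.homologyι 1) :=
      (ModuleCat.mono_iff_injective _).1 inferInstance
    intro h
    have hh : Limits.cokernel.π j (C.homologyι 1 h) = 0 := by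
      rw [← ModuleCat.comp_apply, hzero]
      rfl
    obtain ⟨n, hn⟩ := (ShortComplex.moduleCat_exact_iff _).1 (ShortComplex.exact_cokernel j) _ hh
    refine ⟨n, hinj ?_⟩
    have hc : c ≫ C.homologyι 1 = j := by
      simp [c, j]
    change C.homologyι 1 (c n) = _
    rw [← ModuleCat.comp_apply, hc]
    exact hn
  have := LinearMap.rank_le_of_surjective c.hom hsurj
  have hR : Module.rank ℤ R = 1 := Module.rank_self ℤ
  rw [hR] at this
  exact this

end Hurewicz

/-! ### The local structure of a smooth map away from its critical points -/

section Analysis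

open Filter Real

theorem contMDiff_circle_coe {m : ℕ∞ω} :
    ContMDiff (𝓡 1) 𝓘(ℝ, ℂ) m (fun z : Circle => (z : ℂ)) :=
  have : Fact (Module.finrank ℝ ℂ = 1 + 1) := finrank_real_complex_fact'
  contMDiff_coe_sphere (E := ℂ) (n := 1)

theorem contMDiff_torusCover {m : ℕ∞ω} :
    ContMDiff 𝓘(ℝ, ℝ × ℝ) ((𝓡 1).prod (𝓡 1)) m torusCover := by
  rw [modelWithCornersSelf_prod, ← chartedSpaceSelf_prod]
  exact contMDiff_circleExp.prodMap contMDiff_circleExp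

theorem contDiff_comp_torusCover {f : Torus → Circle} {m : ℕ∞ω}
    (hf : ContMDiff ((𝓡 1).prod (𝓡 1)) (𝓡 1) m f) :
    ContDiff ℝ m fun p => (f (torusCover p) : ℂ) :=
  (contMDiff_circle_coe.comp (hf.comp contMDiff_torusCover)).contDiff

theorem injective_mfderiv_circle_coe (z : Circle) :
    Function.Injective (mfderiv (𝓡 1) 𝓘(ℝ, ℂ) (fun z : Circle => (z : ℂ)) z) := by
  have : Fact (Module.finrank ℝ ℂ = 1 + 1) := finrank_real_complex_fact'
  exact injective_mvfderiv_subtypeVal_sphere (E := ℂ) (n := 1) z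

theorem surjective_mfderiv_circleExp (t : ℝ) :
    Function.Surjective (mfderiv 𝓘(ℝ, ℝ) (𝓡 1) Circle.exp t) := by
  let L : ℝ →ₗ[ℝ] EuclideanSpace ℝ (Fin 1) := (mfderiv 𝓘(ℝ, ℝ) (𝓡 1) Circle.exp t).toLinearMap
  have h1 : L 1 ≠ 0 := by
    intro h
    have hd : HasDerivAt (fun t : ℝ => (Circle.exp t : ℂ))
        (Complex.exp (t * Complex.I) * Complex.I) t := by
      have := ((hasDerivAt_id (t : ℂ)).mul_const Complex.I).cexp.comp_ofReal
      simpa using this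
    have hc := mfderiv_comp t (g := fun z : Circle => (z : ℂ)) (f := Circle.exp) (I := 𝓘(ℝ, ℝ))
      (I' := 𝓡 1) (I'' := 𝓘(ℝ, ℂ))
      ((contMDiff_circle_coe (m := 1)).mdifferentiableAt one_ne_zero)
      ((contMDiff_circleExp (m := 1)).mdifferentiableAt one_ne_zero)
    have h2 := DFunLike.congr_fun hc (1 : ℝ)
    rw [mfderiv_eq_fderiv] at h2
    have h3 : fderiv ℝ (fun t : ℝ => (Circle.exp t : ℂ)) t 1 =
        mfderiv (𝓡 1) 𝓘(ℝ, ℂ) (fun z : Circle => (z : ℂ)) (Circle.exp t) (L 1) := h2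
    rw [h] at h3
    have h4 : fderiv ℝ (fun t : ℝ => (Circle.exp t : ℂ)) t 1 = 0 :=
      h3.trans (map_zero (mfderiv (𝓡 1) 𝓘(ℝ, ℂ) (fun z : Circle => (z : ℂ)) (Circle.exp t)))
    rw [hd.hasFDerivAt.fderiv] at h4
    refine mul_ne_zero (Complex.exp_ne_zero (t * Complex.I)) Complex.I_ne_zero (Eq.trans ?_ h4)
    simp
  have hinj : Function.Injective L := by
    rw [injective_iff_map_eq_zero]
    intro a ha
    have : L a = a • L 1 := by rw [← map_smul, smul_eq_mul, mul_one]
    rw [this] at ha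
    exact (smul_eq_zero.1 ha).resolve_right h1
  have hsurj : Function.Surjective L :=
    (LinearMap.injective_iff_surjective_of_finrank_eq_finrank (K := ℝ) (V := ℝ)
      (V₂ := EuclideanSpace ℝ (Fin 1)) (by simp)).1 hinj
  exact hsurj

/-- A point is critical if the derivative of the map vanishes at a lift of the point to the
universal covering. -/
theorem isCritical_of_fderiv_eq_zero {f : Torus → Circle}
    (hf : ContMDiff ((𝓡 1).prod (𝓡 1)) (𝓡 1) ∞ f) {p : ℝ × ℝ}
    (hp : fderiv ℝ (fun p => (f (torusCover p) : ℂ)) p = 0) : IsCritical f (torusCover p) := by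
  have hE : MDifferentiableAt 𝓘(ℝ, ℝ × ℝ) ((𝓡 1).prod (𝓡 1)) torusCover p :=
    (contMDiff_torusCover (m := 1)).mdifferentiableAt one_ne_zero
  have hf' : MDifferentiableAt ((𝓡 1).prod (𝓡 1)) (𝓡 1) f (torusCover p) :=
    hf.mdifferentiableAt (by simp)
  have hc := mfderiv_comp p (g := fun z : Circle => (z : ℂ)) (f := f ∘ torusCover)
      (I := 𝓘(ℝ, ℝ × ℝ)) (I' := 𝓡 1) (I'' := 𝓘(ℝ, ℂ))
      ((contMDiff_circle_coe (m := 1)).mdifferentiableAt one_ne_zero) (hf'.comp p hE)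
  rw [mfderiv_comp p hf' hE, mfderiv_eq_fderiv] at hc
  have hsurj : Function.Surjective (mfderiv 𝓘(ℝ, ℝ × ℝ) ((𝓡 1).prod (𝓡 1)) torusCover p) := by
    have h : mfderiv (𝓘(ℝ, ℝ).prod 𝓘(ℝ, ℝ)) ((𝓡 1).prod (𝓡 1)) (Prod.map Circle.exp Circle.exp) p =
        (mfderiv 𝓘(ℝ, ℝ) (𝓡 1) Circle.exp p.1).prodMap (mfderiv 𝓘(ℝ, ℝ) (𝓡 1) Circle.exp p.2) :=
      mfderiv_prodMap ((contMDiff_circleExp (m := 1)).mdifferentiableAt one_ne_zero)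
        ((contMDiff_circleExp (m := 1)).mdifferentiableAt one_ne_zero)
    rw [modelWithCornersSelf_prod, ← chartedSpaceSelf_prod]
    change Function.Surjective (mfderiv (𝓘(ℝ, ℝ).prod 𝓘(ℝ, ℝ)) ((𝓡 1).prod (𝓡 1))
      (Prod.map Circle.exp Circle.exp) p)
    rw [h]
    exact (surjective_mfderiv_circleExp p.1).prodMap (surjective_mfderiv_circleExp p.2)
  refine ContinuousLinearMap.ext fun v => ?_
  obtain ⟨w, rfl⟩ := hsurj v
  refine injective_mfderiv_circle_coe (f (torusCover p)) ?_
  have h := DFunLike.congr_fun hc w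
  have h0 : fderiv ℝ ((fun z : Circle => (z : ℂ)) ∘ (f ∘ torusCover)) p = 0 := hp
  rw [h0] at h
  exact h.symm.trans
    (map_zero (mfderiv (𝓡 1) 𝓘(ℝ, ℂ) (fun z : Circle => (z : ℂ)) (f (torusCover p)))).symm

/-- By the implicit function theorem, near a point where the derivative does not vanish the levels
of a circle-valued map form a trivial family of arcs. -/
theorem isLocallyFibered_of_fderiv_ne_zero {f : C(Torus, Circle)}
    (hf : ContDiff ℝ ∞ fun p => (f (torusCover p) : ℂ)) {p₀ : ℝ × ℝ}
    (hp₀ : fderiv ℝ (fun p => (f (torusCover p) : ℂ)) p₀ ≠ 0) :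
    IsLocallyFibered f (torusCover p₀) := by
  let c : Circle := f (torusCover p₀)
  let g : ℝ × ℝ → ℂ := fun p => (f (torusCover p) : ℂ)
  -- a local logarithm of the map
  let F : ℝ × ℝ → ℝ := fun p => (Complex.log (g p / c)).im
  have hF₀ : F p₀ = 0 := by
    simp only [F, g, c]
    rw [div_self (Circle.coe_ne_zero _), Complex.log_one, Complex.zero_im]
  have hFg : ∀ p, f (torusCover p) = c * Circle.exp (F p) := by
    intro p
    have : Circle.exp (F p) = f (torusCover p) / c := by
      simp only [F, Complex.log_im, g]
      rw [← Circle.coe_div, Circle.exp_arg]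
    rw [this, mul_div_cancel]
  have hslit : g p₀ / c ∈ Complex.slitPlane := by
    rw [show g p₀ / c = 1 from div_self (Circle.coe_ne_zero _)]
    exact Complex.one_mem_slitPlane
  have hFs : ContDiffAt ℝ 1 F p₀ :=
    Complex.imCLM.contDiff.contDiffAt.comp p₀
      (((Complex.contDiffAt_log hslit).restrict_scalars ℝ).comp p₀
        ((hf.of_le (by norm_cast)).contDiffAt.div_const _))
  have hstrict : HasStrictFDerivAt F (fderiv ℝ F p₀) p₀ := hFs.hasStrictFDerivAt one_ne_zero
  have hne : fderiv ℝ F p₀ ≠ 0 := by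
    intro h0
    refine hp₀ ?_
    have hF' : HasFDerivAt F (0 : ℝ × ℝ →L[ℝ] ℝ) p₀ := h0 ▸ hstrict.hasFDerivAt
    have h1 : HasFDerivAt (fun p => (F p : ℂ)) (0 : ℝ × ℝ →L[ℝ] ℂ) p₀ := by
      have := Complex.ofRealCLM.hasFDerivAt.comp p₀ hF'
      rwa [ContinuousLinearMap.comp_zero] at this
    have h2 : HasFDerivAt (fun p => (c : ℂ) * Complex.exp (F p * Complex.I))
        (0 : ℝ × ℝ →L[ℝ] ℂ) p₀ := by
      have := ((h1.mul_const Complex.I).cexp).const_mul (c : ℂ)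
      refine this.congr_fderiv (ContinuousLinearMap.ext fun v => ?_)
      simp
    have h3 : (fun p => (f (torusCover p) : ℂ)) =
        fun p => (c : ℂ) * Complex.exp (F p * Complex.I) := by
      funext p
      rw [hFg, Circle.coe_mul, Circle.coe_exp]
    rw [h3]
    exact h2.fderiv
  have hrange : (fderiv ℝ F p₀).range = ⊤ := by
    rw [LinearMap.range_eq_top]
    exact LinearMap.surjective (f := (fderiv ℝ F p₀ : ℝ × ℝ →ₗ[ℝ] ℝ)) fun h => hne
      (ContinuousLinearMap.ext fun v => DFunLike.congr_fun h v)
  let φ := hstrict.implicitToOpenPartialHomeomorph F _ hrange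
  have hφF : ∀ p, (φ p).1 = F p := fun p => hstrict.implicitToOpenPartialHomeomorph_fst hrange p
  have hp₀φ : p₀ ∈ φ.source := hstrict.mem_implicitToOpenPartialHomeomorph_source hrange
  intro U hU
  have hU' : φ.symm ⁻¹' (torusCover ⁻¹' U) ∈ 𝓝 (φ p₀) :=
    (φ.continuousAt_symm (φ.map_source hp₀φ)).preimage_mem_nhds (by
      rw [φ.left_inv hp₀φ]
      exact torusCover.continuous.continuousAt.preimage_mem_nhds hU)
  obtain ⟨δ, hδ, hball⟩ := Metric.mem_nhds_iff.1
    (inter_mem (φ.open_target.mem_nhds (φ.map_source hp₀φ)) hU')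
  -- the radius `r` is at most `π` so that the first coordinate in the box is determined by its
  -- exponential
  let r := min δ π
  have hr : 0 < r := lt_min hδ pi_pos
  let k₀ := (φ p₀).2
  have hφp₀ : φ p₀ = (0, k₀) := Prod.ext (by rw [hφF, hF₀]) rfl
  let box : Set (ℝ × (fderiv ℝ F p₀).ker) := Metric.ball 0 r ×ˢ Metric.ball k₀ δ
  have hbox : box ⊆ φ.target ∩ φ.symm ⁻¹' (torusCover ⁻¹' U) := by
    refine Subset.trans ?_ hball
    rw [hφp₀, ← ball_prod_same]
    exact prod_mono (Metric.ball_subset_ball (min_le_left _ _)) Subset.rfl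
  have hboxo : IsOpen box := Metric.isOpen_ball.prod Metric.isOpen_ball
  refine ⟨torusCover '' (φ.symm '' box), ?_, ?_, ?_, ?_⟩
  · exact isOpenQuotientMap_torusCover.isOpenMap _
      (φ.isOpen_image_symm_of_subset_target hboxo fun x hx => (hbox hx).1)
  · refine ⟨p₀, ⟨φ p₀, ?_, φ.left_inv hp₀φ⟩, rfl⟩
    rw [hφp₀]
    exact ⟨Metric.mem_ball_self hr, Metric.mem_ball_self hδ⟩
  · rintro _ ⟨_, ⟨x, hx, rfl⟩, rfl⟩
    exact (hbox hx).2
  · have hval : ∀ x ∈ box, f (torusCover (φ.symm x)) = c * Circle.exp x.1 := fun x hx => by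
      rw [hFg, ← hφF, φ.right_inv (hbox hx).1]
    have hcont : ContinuousAt (fun z : Circle => ((z / c : Circle) : ℂ).arg) c := by
      refine ContinuousAt.comp (f := fun z : Circle => ((z / c : Circle) : ℂ)) (g := Complex.arg)
        (Complex.continuousAt_arg ?_) (by fun_prop)
      rw [div_self', Circle.coe_one]
      exact Complex.one_mem_slitPlane
    have hev : ∀ᶠ z in 𝓝 c, ((z / c : Circle) : ℂ).arg ∈ Metric.ball (0 : ℝ) r := by
      refine hcont.eventually (Metric.isOpen_ball.mem_nhds ?_)
      change ((c / c : Circle) : ℂ).arg ∈ _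
      rw [div_self', Circle.coe_one, Complex.arg_one]
      exact Metric.mem_ball_self hr
    filter_upwards [hev] with z hz
    have hset : torusCover '' (φ.symm '' box) ∩ f ⁻¹' {z} =
        (fun x => torusCover (φ.symm x)) '' ({((z / c : Circle) : ℂ).arg} ×ˢ Metric.ball k₀ δ) := by
      ext y
      constructor
      · rintro ⟨⟨_, ⟨x, hx, rfl⟩, rfl⟩, hy⟩
        refine ⟨x, ⟨?_, hx.2⟩, rfl⟩
        rw [mem_preimage, mem_singleton_iff, hval x hx] at hy
        have h1 : |x.1| < r := by simpa using hx.1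
        have h2 := abs_lt.1 (h1.trans_le (min_le_right _ _))
        rw [mem_singleton_iff, ← hy, mul_div_cancel_left, Circle.arg_exp h2.1 h2.2.le]
      · rintro ⟨x, ⟨hx1, hx2⟩, rfl⟩
        have hx : x ∈ box := ⟨by rw [mem_singleton_iff.1 hx1]; exact hz, hx2⟩
        refine ⟨⟨_, ⟨x, hx, rfl⟩, rfl⟩, ?_⟩
        rw [mem_preimage, mem_singleton_iff, hval x hx, mem_singleton_iff.1 hx1, Circle.exp_arg,
          mul_div_cancel]
    rw [hset]
    refine (isConnected_singleton.prod (Metric.isConnected_ball hδ)).image _ ?_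
    refine torusCover.continuous.comp_continuousOn (φ.continuousOn_symm.mono ?_)
    rintro x ⟨hx1, hx2⟩
    exact (hbox (show x ∈ box from ⟨by rw [mem_singleton_iff.1 hx1]; exact hz, hx2⟩)).1

/-- The critical points of a smooth map with isolated singularities lie in a finite set, off which
the map is locally a trivial family of arcs. -/
theorem exists_finite_isLocallyFibered {f : C(Torus, Circle)} (hf : HasIsolatedSingularities f) :
    ∃ C : Set Torus, C.Finite ∧ ∀ x ∉ C, IsLocallyFibered f x := by
  have hg := contDiff_comp_torusCover hf.1
  let Z : Set (ℝ × ℝ) := {p | fderiv ℝ (fun p => (f (torusCover p) : ℂ)) p = 0}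
  have hZ : IsClosed Z := isClosed_eq (hg.continuous_fderiv (by simp)) continuous_const
  -- closed by construction; of its relation to the critical set only `hcrit` below matters
  let C : Set Torus := (torusCover '' Zᶜ)ᶜ
  have hC : IsClosed C :=
    (isOpenQuotientMap_torusCover.isOpenMap _ hZ.isOpen_compl).isClosed_compl
  have hcrit : ∀ x ∈ C, IsCritical f x := by
    intro x hx
    obtain ⟨p, rfl⟩ := isOpenQuotientMap_torusCover.surjective x
    exact isCritical_of_fderiv_eq_zero hf.1 (by_contra fun h => hx ⟨p, h, rfl⟩)
  refine ⟨C, ?_, ?_⟩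
  · by_contra hinf
    obtain ⟨x, hxC, hx⟩ :=
      Set.Infinite.exists_accPt_of_subset_isCompact hinf hC.isCompact Subset.rfl
    have := accPt_iff_frequently.1 hx
    have h2 := hf.2 x (hcrit x hxC)
    rw [eventually_nhdsWithin_iff] at h2
    obtain ⟨y, ⟨hy1, hy2⟩, hy3⟩ := (this.and_eventually h2).exists
    exact hy3 hy1 (hcrit y hy2)
  · intro x hx
    obtain ⟨p, hp, rfl⟩ : x ∈ torusCover '' Zᶜ := by_contra hx
    exact isLocallyFibered_of_fderiv_ne_zero hg hp

end Analysis

/-! ### The fundamental group of the torus is not cyclic -/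

theorem Circle.exists_fundamentalGroup_zpow_eq_one_imp (z : Circle) :
    ∃ g : FundamentalGroup Circle z, ∀ n : ℤ, g ^ n = 1 → n = 0 := by
  obtain ⟨t, ht⟩ := Circle.exp_surjective z
  let φ := Circle.isAddQuotientCoveringMap_exp.fundamentalGroupToMulOpposite (x := z) ⟨t, ht⟩
  have hφ : Function.Surjective φ :=
    Circle.isAddQuotientCoveringMap_exp.fundamentalGroupToMulOpposite_surjective _
  obtain ⟨g, hg⟩ := hφ (MulOpposite.op (Multiplicative.ofAdd
    ⟨2 * Real.pi, AddSubgroup.mem_zmultiples _⟩))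
  refine ⟨g, fun n hn => ?_⟩
  have h := congrArg φ hn
  rw [map_zpow, map_one, hg, ← MulOpposite.op_zpow, MulOpposite.op_eq_one_iff, ← ofAdd_zsmul,
    ofAdd_eq_one] at h
  have h' : n • (2 * Real.pi) = 0 := congrArg Subtype.val h
  exact (smul_eq_zero.1 h').resolve_right Real.two_pi_pos.ne'

theorem not_isCyclic_fundamentalGroup_torus (x : Torus) :
    ¬ IsCyclic (FundamentalGroup Torus x) := by
  intro ⟨γ, hγ⟩
  obtain ⟨g, hg⟩ := Circle.exists_fundamentalGroup_zpow_eq_one_imp x.1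
  obtain ⟨g', hg'⟩ := Circle.exists_fundamentalGroup_zpow_eq_one_imp x.2
  -- the classes of the two factor circles
  let α : FundamentalGroup Torus x := Path.Homotopic.prod g (.refl x.2)
  let β : FundamentalGroup Torus x := Path.Homotopic.prod (.refl x.1) g'
  let p₁ : FundamentalGroup Torus x →* FundamentalGroup Circle x.1 :=
    FundamentalGroup.map ContinuousMap.fst x
  let p₂ : FundamentalGroup Torus x →* FundamentalGroup Circle x.2 :=
    FundamentalGroup.map ContinuousMap.snd x
  have hα : p₁ α = g := Path.Homotopic.projLeft_prod g (.refl x.2)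
  have hβ₁ : p₁ β = 1 := Path.Homotopic.projLeft_prod (.refl x.1) g'
  have hβ₂ : p₂ β = g' := Path.Homotopic.projRight_prod (.refl x.1) g'
  obtain ⟨m, hm⟩ := hγ α
  obtain ⟨n, hn⟩ := hγ β
  change γ ^ m = α at hm
  change γ ^ n = β at hn
  -- in a cyclic group `α = γ ^ m` and `β = γ ^ n` have a common power
  have h : α ^ n = β ^ m := by rw [← hm, ← hn, ← zpow_mul, ← zpow_mul, mul_comm]
  have hn0 : n = 0 := hg n (by rw [← hα, ← map_zpow, h, map_zpow, hβ₁, one_zpow])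
  have hβ : β = 1 := by rw [← hn, hn0, zpow_zero]
  exact one_ne_zero (hg' 1 (by rw [zpow_one, ← hβ₂, hβ, map_one]))

/-! ### The Reeb graph of a circle-valued function on the torus -/

/-- A map to the circle which factors through a simply connected space factors through the line,
and hence is null-homotopic. -/
theorem ContinuousMap.Nullhomotopic.of_comp_simplyConnected {X A : Type*} [TopologicalSpace X]
    [TopologicalSpace A] [SimplyConnectedSpace A] [LocallyPathConnectedSpace A] (g : C(A, Circle))
    (q : C(X, A)) : (g.comp q).Nullhomotopic := by
  obtain ⟨F, hF⟩ := exists_real_lift g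
  have hg : g = Circle.exp.comp ((ContinuousMap.id ℝ).comp F) :=
    ContinuousMap.ext fun a => (hF a).symm
  rw [hg]
  exact (((id_nullhomotopic ℝ).comp_left F).comp_right Circle.exp).comp_left q

theorem exists_graphStructure_reebGraph {f : C(Torus, Circle)} (hf : HasIsolatedSingularities f) :
    Nonempty (GraphStructure (ReebGraph f)) := by
  have := t2Space_reebGraph f.continuous
  obtain ⟨C, hC, hreg⟩ := exists_finite_isLocallyFibered hf
  exact exists_graphStructure (continuous_reebMap f.continuous)
    (fun S hS c hc => subsingleton_of_reebMap_const f.continuous hS hc) (hC.image _)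
    (isLocalHomeomorphOn_reebMap f.continuous hC.isClosed hreg)

theorem surjective_fundamentalGroup_map_reebQuotient {f : C(Torus, Circle)}
    (G : GraphStructure (ReebGraph f)) (x : Torus) :
    Function.Surjective (FundamentalGroup.map (reebQuotient f) x) := by
  have := t2Space_reebGraph f.continuous
  refine FundamentalGroup.map_surjective_of_open_cover G.isOpen_starCover G.exists_mem_starCover
    (fun i y y' p q hp hq => G.mk_eq_of_subset_starCover hp hq) _ reebQuotient_surjective
    (fun i => ?_) x
  have hopen : IsOpen (reebQuotient f ⁻¹' G.starCover i) :=
    (G.isOpen_starCover i).preimage (reebQuotient f).continuous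
  have hconn := G.isConnected_starCover i
  exact hopen.isConnected_iff_isPathConnected.1 ⟨hconn.nonempty.preimage reebQuotient_surjective,
    hconn.isPreconnected.preimage_reebQuotient f.continuous⟩

theorem mainTheorem4 (f : C(Torus, Circle)) (hf : HasIsolatedSingularities f) :
    IsFiniteGraph (ReebGraph f) ∧
    (∀ x : Torus,
      Function.Surjective (FundamentalGroup.map (reebQuotient f) x) ∧
      (FundamentalGroup.map (reebQuotient f) x).ker ≠ ⊥) ∧
    bettiOne (ReebGraph f) ≤ 1 ∧
    (IsTreeSpace (ReebGraph f) ∨ ∃! S : Set (ReebGraph f), IsCycle S) ∧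
    (¬ f.Nullhomotopic → ¬ IsTreeSpace (ReebGraph f)) := by
  have := t2Space_reebGraph f.continuous
  obtain ⟨G⟩ := exists_graphStructure_reebGraph hf
  have hD : ∀ z ∉ G.V, ∀ w ∉ G.V, z ≠ w → ¬ _root_.IsPreconnected ({z, w}ᶜ : Set (ReebGraph f)) :=
    fun z hz w hw => G.not_isPreconnected_compl_pair isQuotientMap_reebQuotient
      (fun y => (isConnected_preimage_reebQuotient_singleton y).isPreconnected) hz hw
  have hcyc := G.isCyclic_fundamentalGroup hD
  refine ⟨G.isFiniteGraph, fun x => ⟨surjective_fundamentalGroup_map_reebQuotient G x, ?_⟩,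
    bettiOne_le_one (hcyc (reebQuotient f 1)), ?_, ?_⟩
  · intro hker
    have := hcyc (reebQuotient f x)
    exact not_isCyclic_fundamentalGroup_torus x
      (isCyclic_of_injective _ ((MonoidHom.ker_eq_bot_iff _).1 hker))
  · by_cases h : ∃ S : Set (ReebGraph f), IsCycle S
    · obtain ⟨S, hS⟩ := h
      exact Or.inr ⟨S, hS, fun S' hS' => (hS'.eq_closure hD).trans (hS.eq_closure hD).symm⟩
    · exact Or.inl ⟨G.isFiniteGraph, inferInstance, not_exists.1 h⟩
  · rintro hnull ⟨-, -, hS⟩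
    have := G.simplyConnectedSpace hS
    exact hnull (ContinuousMap.Nullhomotopic.of_comp_simplyConnected
      ⟨reebMap f, continuous_reebMap f.continuous⟩ (reebQuotient f))
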